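/- **Theorem 1.1.** Let $\Delta\subset\mathbb C$ be a domain, let $\phi,\psi$ be analytic in $\Delta$, and suppose that there are constants $c,\rho>0$ such that for all $\xi\in\Delta$ either 1. $|\phi(\xi)|\le \dfrac{c}{1+|\xi|^{1+\rho}}$ and $|\psi(\xi)|\le \dfrac{c}{1+|\xi|^{1+\rho}}$ (Condition 1), or 2. $|\phi(\xi)|\le \dfrac{c}{1+|\xi|^{1/2+\rho}}$, $|\phi'(\xi)|\le \dfrac{c}{1+|\xi|^{1+\rho}}$ and $|\psi(\xi)|\le \dfrac{c}{1+|\xi|^{1+\rho}}$ (Condition 2) (the same alternative for all $\xi$). Let $d>0$ and let $\Gamma^{\pm}(d)$ be any non-empty subdomain of $\Delta$ such that each point of $\Gamma^\pm(d)$ has distance at least $d$ from each boundary point of $\Delta$, and $\xi\in\Gamma^\pm(d)$ implies $\xi\mp x\in\Gamma^\pm(d)$ for all $x>0$. (The upper and lower signs are independent statements: each concerns only its own $\Gamma^\pm(d)$.) For $r>0$ put $B(r)=\{t:|t|<r\}$ and $U(r)=\{t:\Re t>0,\ |\Im t|<r\}\cup B(r)$. Define $\mathsf A_0^\pm=1$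 and, for $n\ge0$ and $\xi\in\Gamma^\pm(d)$, $$\mathsf A_{n+1}^\pm(\xi)=-\tfrac12\phi(\xi)\mathsf A_n^\pm(\xi)\mp\tfrac12\frac{\mathrm d\mathsf A_n^\pm(\xi)}{\mathrm d\xi}\mp\tfrac12\int_{\mp\infty+\mathrm i\Im\xi}^{\xi}\Big(\tfrac14\phi^2(t)\mp\tfrac12\phi'(t)-\psi(t)\Big)\mathsf A_n^\pm(t)\,\mathrm dt ,$$ the integrals being taken along horizontal half-lines. These integrals converge absolutely and the $\mathsf A_n^\pm$ are analytic in $\Gamma^\pm(d)$. Then there are functions $\eta^\pm(u,\xi)$, analytic in $\{u:\Re u>0\}\times\Gamma^\pm(d)$, and $F^\pm(t,\xi)$, analytic in $U(2d)\times\Gamma^\pm(d)$, with the following properties. * $\phi$ has a primitive in $\Gamma^\pm(d)$, and for every primitive $\Phi(\xi)=\int^\xi\phi(t)\,\mathrm dt$ of $\phi$ in $\Gamma^\pm(d)$ (arbitrary constant of integration) and every $u$ with $\Re u>0$, the function $$W^\pm(u,\xi)=\exp\!\big(\pm u\xi\pm\tfrac12\Phi(\xi)\big)\big(1+\eta^\pm(u,\xi)\big)$$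 is an analytic solution of $\dfrac{\mathrm d^2W}{\mathrm d\xi^2}=\big(u^2+u\phi(\xi)+\psi(\xi)\big)W$ in $\Gamma^\pm(d)$. * For each $u$ with $\Re u>0$, $\eta^\pm(u,\xi)\to0$ as $\Re\xi\to\mp\infty$ within $\Gamma^\pm(d)$. * For $\Re u>0$ and $\xi\in\Gamma^\pm(d)$, $\eta^\pm(u,\xi)=\int_0^{+\infty}\mathrm e^{-ut}F^\pm(t,\xi)\,\mathrm dt$, the integral being absolutely convergent. * $F^\pm(t,\xi)=\sum_{n=0}^\infty\dfrac{\mathsf A_{n+1}^\pm(\xi)}{n!}t^n$ (convergent) for $(t,\xi)\in B(2d)\times\Gamma^\pm(d)$. * For each $\sigma>0$ and $0<r<d$ there is $K^\pm=K^\pm(\sigma,r)>0$, independent of $t$ and $\xi$, such that $$|F^\pm(t,\xi)|\le K^\pm\,\frac{\mathrm e^{\sigma\Re t}}{\max\!\big(1,\mp\operatorname{sgn}(\Re\xi)|\Re\xi|^\rho\big)},\qquad (t,\xi)\in U(2r)\times\Gamma^\pm(d).$$ * For each $\sigma>0$, $\eta^\pm(u,\xi)\sim\sum_{n=1}^\infty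 \mathsf A_n^\pm(\xi)/u^n$ as $|u|\to+\infty$ in $\Re u>\sigma$, uniformly in $\xi\in\Gamma^\pm(d)$: for each $N\ge0$, $\eta^\pm(u,\xi)-\sum_{n=1}^{N}\mathsf A_n^\pm(\xi)/u^n=\mathcal O(|u|^{-N-1})$ uniformly in $\xi$. The same holds as $|u|\to+\infty$ in each closed sector $|\arg u|\le\theta$ with $\theta<\pi/2$. -/

import Mathlib

open Set Filter Topology MeasureTheory

noncomputable section

namespace WKB

/-! The upper and lower signs are treated together: `s = 1` stands for the superscript `+`
and `s = -1` for the superscript `-`. -/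

/-- A domain in the complex plane: a non-empty connected open set. -/
def IsPlaneDomain (D : Set ℂ) : Prop := IsOpen D ∧ IsConnected D

/-- First decay condition: `φ`, `ψ` are analytic in `Δ` and both are
bounded by `c / (1 + |ξ|^(1+ρ))` there. -/
def DecayCond1 (Δ : Set ℂ) (φ ψ : ℂ → ℂ) (c ρ : ℝ) : Prop :=
  AnalyticOnNhd ℂ φ Δ ∧ AnalyticOnNhd ℂ ψ Δ ∧
    ∀ ξ ∈ Δ, ‖φ ξ‖ ≤ c / (1 + ‖ξ‖ ^ (1 + ρ)) ∧ ‖ψ ξ‖ ≤ c / (1 + ‖ξ‖ ^ (1 + ρ))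

/-- Second decay condition: slower decay of `φ`, but with a bound on `φ'`. -/
def DecayCond2 (Δ : Set ℂ) (φ ψ : ℂ → ℂ) (c ρ : ℝ) : Prop :=
  AnalyticOnNhd ℂ φ Δ ∧ AnalyticOnNhd ℂ ψ Δ ∧
    ∀ ξ ∈ Δ, ‖φ ξ‖ ≤ c / (1 + ‖ξ‖ ^ (1 / 2 + ρ)) ∧
      ‖deriv φ ξ‖ ≤ c / (1 + ‖ξ‖ ^ (1 + ρ)) ∧ ‖ψ ξ‖ ≤ c / (1 + ‖ξ‖ ^ (1 + ρ))

/-- `Γ` is an admissible subdomain `Γ^±(d)` of `Δ`: each of its points has distance at least `d`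
from each boundary point of `Δ`, and `ξ ∈ Γ` implies `ξ ∓ x ∈ Γ` for all `x > 0`. -/
def IsGammaDomain (s : ℝ) (Δ : Set ℂ) (d : ℝ) (Γ : Set ℂ) : Prop :=
  IsPlaneDomain Γ ∧ Γ ⊆ Δ ∧ (∀ ξ ∈ Γ, ∀ ζ ∈ frontier Δ, d ≤ dist ξ ζ) ∧
    ∀ ξ ∈ Γ, ∀ x : ℝ, 0 < x → ξ - (s : ℂ) * (x : ℂ) ∈ Γ

/-- The integral of `g` along the horizontal half-line from `∓∞ + i Im ξ` to `ξ`.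
With the parametrization `t = ξ ∓ x`, `x > 0`, it equals `± ∫_0^∞ g (ξ ∓ x) dx`. -/
def rayIntegral (s : ℝ) (g : ℂ → ℂ) (ξ : ℂ) : ℂ :=
  (s : ℂ) * ∫ x in Ioi (0 : ℝ), g (ξ - (s : ℂ) * (x : ℂ))

/-- The function `¼ φ² ∓ ½ φ' - ψ`. -/
def wkbPotential (s : ℝ) (φ ψ : ℂ → ℂ) (t : ℂ) : ℂ :=
  1 / 4 * φ t ^ 2 - (s : ℂ) * (1 / 2) * deriv φ t - ψ t

/-- The coefficients `A_n^±` of the formal WKB series, normalized at `∓∞`. -/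
def wkbCoeff (s : ℝ) (φ ψ : ℂ → ℂ) : ℕ → ℂ → ℂ
  | 0 => fun _ => 1
  | n + 1 => fun ξ =>
      -(1 / 2) * φ ξ * wkbCoeff s φ ψ n ξ
        - (s : ℂ) * (1 / 2) * deriv (wkbCoeff s φ ψ n) ξ
        - (s : ℂ) * (1 / 2) *
          rayIntegral s (fun t => wkbPotential s φ ψ t * wkbCoeff s φ ψ n t) ξ

/-- `U(r)`: the points at distance less than `r` from the positive real axis. -/
def stripU (r : ℝ) : Set ℂ := {t | 0 < t.re ∧ |t.im| < r} ∪ Metric.ball 0 r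

/-- `Φ` is a primitive of `φ` on `Γ`, i.e. a determination of `ξ ↦ ∫_α^ξ φ(t) dt`. Every choice of
the (finite or infinite) base point `α` and of a contour from `α` into `Γ` gives such a `Φ`. -/
def IsPrimitiveOn (φ Φ : ℂ → ℂ) (Γ : Set ℂ) : Prop :=
  ∀ ξ ∈ Γ, HasDerivAt Φ (φ ξ) ξ

/-- `W^±(u, ξ) = exp (± u ξ ± ½ Φ(ξ)) (1 + η(u, ξ))`. -/
def wkbForm (s : ℝ) (Φ : ℂ → ℂ) (η : ℂ → ℂ → ℂ) (u ξ : ℂ) : ℂ :=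
  Complex.exp ((s : ℂ) * u * ξ + (s : ℂ) * (1 / 2) * Φ ξ) * (1 + η u ξ)

/-- `w` is an analytic solution of `w'' = (u² + u φ + ψ) w` on `Γ`. -/
def SolvesEq (φ ψ : ℂ → ℂ) (u : ℂ) (w : ℂ → ℂ) (Γ : Set ℂ) : Prop :=
  AnalyticOnNhd ℂ w Γ ∧
    ∀ ξ ∈ Γ, deriv (deriv w) ξ = (u ^ 2 + u * φ ξ + ψ ξ) * w ξ

/-- `η(u, ξ) ~ ∑_{n ≥ 1} A_n(ξ) / u^n` as `|u| → ∞` with `u ∈ S`, uniformly in `ξ ∈ Γ`. -/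
def UniformAsymptotic (S Γ : Set ℂ) (η : ℂ → ℂ → ℂ) (A : ℕ → ℂ → ℂ) : Prop :=
  ∀ N : ℕ, ∃ C R : ℝ, 0 < R ∧ ∀ u ∈ S, R ≤ ‖u‖ → ∀ ξ ∈ Γ,
    ‖η u ξ - ∑ n ∈ Finset.Icc 1 N, A n ξ / u ^ n‖ ≤ C / ‖u‖ ^ (N + 1)

end WKB

end

/-!
Take the upper sign and put `V = φ² / 4 - φ' / 2 - ψ`. The function `exp (u ξ + Φ / 2) (1 + η)` solves
the equation if and only if `η'' + (2 u + φ) η' + (V + φ') (1 + η) = 0`, and this is the derivative of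
`η' + 2 u η + φ (1 + η) + ∫_{-∞}^ξ V (1 + η) = 0`. If `η` is the Laplace transform of `F(·, ξ)`, the
last equation amounts to the transport equation `2 F_t + F_ξ = -φ F - ∫_{-∞}^ξ V F` with initial value
`F(0, ξ) = A₁(ξ)`.

Integrated along its characteristics `ξ - t / 2 = const`, the transport equation becomes a fixed point
equation `F = A₁(ξ - t / 2) + step F` on the domain `shiftDomain E` of pairs `(t, ξ)` whose
characteristic stays in `E`. Here `E` is the `r`-neighbourhood of `Γ` with `r < d`, and the domain
contains `stripU (2 r) × Γ`. The decay of `φ` and `V` allows, for every `σ > 0`, a weight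
`exp (growth σ b t) * M (Re ξ)` in which `step` is a contraction (`exists_isMajorant`,
`LeftData.norm_step_le`). Hence the Neumann series `borel` converges to an analytic `F` with the
required growth; its terms do not depend on `r` or `σ`, so all these bounds concern one function.

The `t`-derivatives of `F` satisfy the same transport equation, which at `t = 0` is the recurrence of
the WKB coefficients (`LeftData.wkbCoeff_succ`). The differential equation follows from
`LeftData.hasDerivAt_laplaceBorel`, and the asymptotic expansions from repeated integration by parts
with Cauchy estimates for the `t`-derivatives in the strip (`IsStripBounded.norm_laplace_sub_sum_le`).
Analyticity in both variables rests on Osgood's lemma (`analyticOnNhd_of_separately`). The lower sign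
is reduced to the upper one by the reflection `ξ ↦ -ξ`.
-/

noncomputable section

namespace WKB

/-! ### Holomorphic functions of two variables -/

/-- Differentiation under the integral sign for holomorphic integrands: a domination of the
integrand itself suffices, since Cauchy's estimate on a smaller disc dominates its derivative. -/
theorem hasDerivAt_integral_of_holomorphic {α : Type*} [MeasurableSpace α] {μ : Measure α}
    {f : ℂ → α → ℂ} {g : α → ℝ} {z : ℂ} {ε : ℝ} (hε : 0 < ε)
    (hmeas : ∀ w ∈ Metric.ball z ε, AEStronglyMeasurable (f w) μ)
    (hdiff : ∀ᵐ a ∂μ, DifferentiableOn ℂ (fun w => f w a) (Metric.ball z ε))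
    (hg : Integrable g μ) (hbound : ∀ᵐ a ∂μ, ∀ w ∈ Metric.ball z ε, ‖f w a‖ ≤ g a) :
    Integrable (fun a => deriv (fun w => f w a) z) μ ∧
      HasDerivAt (fun w => ∫ a, f w a ∂μ) (∫ a, deriv (fun w => f w a) z ∂μ) z := by
  have hz : z ∈ Metric.ball z ε := Metric.mem_ball_self hε
  have hd : ∀ᵐ a ∂μ, ∀ w ∈ Metric.ball z (ε / 2),
      HasDerivAt (fun w => f w a) (deriv (fun w => f w a) w) w := by
    filter_upwards [hdiff] with a ha w hw
    exact ((ha w (Metric.ball_subset_ball (by linarith) hw)).differentiableAt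
      (Metric.isOpen_ball.mem_nhds (Metric.ball_subset_ball (by linarith) hw))).hasDerivAt
  refine hasDerivAt_integral_of_dominated_loc_of_deriv_le
    (F' := fun w a => deriv (fun w => f w a) w) (bound := fun a => g a / (ε / 4))
    (Metric.ball_mem_nhds z (half_pos hε)) ?_ ?_ ?_ ?_ (hg.div_const _) hd
  · filter_upwards [Metric.ball_mem_nhds z hε] with w hw using hmeas w hw
  · refine hg.mono' (hmeas z hz) ?_
    filter_upwards [hbound] with a ha using ha z hz
  · -- the derivative is an a.e. limit of difference quotients
    let h : ℕ → ℂ := fun n => ((ε / 2 / (n + 1) : ℝ) : ℂ)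
    have hpos : ∀ n : ℕ, 0 < ε / 2 / ((n : ℝ) + 1) := fun n => by positivity
    have h0 : Tendsto (fun n : ℕ => ε / 2 / ((n : ℝ) + 1)) atTop (𝓝 0) := by
      have := tendsto_one_div_add_atTop_nhds_zero_nat (𝕜 := ℝ)
      simpa [div_eq_mul_inv] using this.const_mul (ε / 2)
    have hh : Tendsto h atTop (𝓝[≠] 0) := by
      refine tendsto_nhdsWithin_iff.2 ⟨?_, Eventually.of_forall fun n => ?_⟩
      · have := (Complex.continuous_ofReal.tendsto 0).comp h0
        simpa [h, Function.comp_def] using this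
      · simpa [h] using Complex.ofReal_ne_zero.2 (hpos n).ne'
    refine aestronglyMeasurable_of_tendsto_ae (u := atTop)
      (f := fun n a => (h n)⁻¹ • (f (z + h n) a - f z a)) ?_ ?_
    · intro n
      refine AEStronglyMeasurable.const_smul
        (AEStronglyMeasurable.sub (hmeas (z + h n) ?_) (hmeas z hz)) (h n)⁻¹
      have : ε / 2 / ((n : ℝ) + 1) ≤ ε / 2 :=
        div_le_self (by positivity) (by linarith [n.cast_nonneg (α := ℝ)])
      simp only [Metric.mem_ball, dist_self_add_left, h, Complex.norm_real, Real.norm_eq_abs,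
        abs_of_pos (hpos n)]
      linarith
    · filter_upwards [hd] with a ha
      have := (ha z (Metric.mem_ball_self (half_pos hε))).tendsto_slope_zero
      exact this.comp hh
  · filter_upwards [hdiff, hbound] with a ha hb w hw
    have hsub : Metric.closedBall w (ε / 4) ⊆ Metric.ball z ε := by
      intro v hv
      rw [Metric.mem_ball] at hw ⊢
      rw [Metric.mem_closedBall] at hv
      linarith [dist_triangle v w z]
    refine Complex.norm_deriv_le_of_forall_mem_sphere_norm_le (by positivity) ?_ ?_
    · exact (ha.mono hsub).diffContOnCl_ball le_rfl
    · exact fun v hv => hb v (hsub (Metric.sphere_subset_closedBall hv))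

open scoped BoundedContinuousFunction in
/-- Osgood's lemma: a continuous, separately holomorphic function of two complex variables is
analytic. By Cauchy's formula in each variable the function is, near `(a, b)`, a continuous linear
functional of `(α - z)⁻¹ (β - w)⁻¹`, where `α`, `β` parametrize circles about `a`, `b` and the
inverses are taken in the Banach algebra of bounded continuous functions of the two parameters. -/
theorem analyticOnNhd_of_separately {f : ℂ × ℂ → ℂ} {U : Set (ℂ × ℂ)} (hU : IsOpen U)
    (hc : ContinuousOn f U)
    (h1 : ∀ p ∈ U, DifferentiableAt ℂ (fun z => f (z, p.2)) p.1)
    (h2 : ∀ p ∈ U, DifferentiableAt ℂ (fun w => f (p.1, w)) p.2) : AnalyticOnNhd ℂ f U := by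
  rintro ⟨a, b⟩ hab
  obtain ⟨R, hR, hRU⟩ : ∃ R : ℝ, 0 < R ∧
      Metric.closedBall a R ×ˢ Metric.closedBall b R ⊆ U := by
    obtain ⟨ε, hε, h⟩ := Metric.isOpen_iff.1 hU _ hab
    refine ⟨ε / 2, by positivity, fun p hp => h ?_⟩
    rw [← ball_prod_same]
    exact ⟨Metric.closedBall_subset_ball (by linarith) hp.1,
      Metric.closedBall_subset_ball (by linarith) hp.2⟩
  have hcirc : ∀ c : ℂ, ∀ x : ℝ, circleMap c R x ∈ Metric.closedBall c R :=
    fun c x => circleMap_mem_closedBall c hR.le x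
  let α : ℝ × ℝ →ᵇ ℂ := BoundedContinuousFunction.ofNormedAddCommGroup
    (fun p => circleMap a R p.1) (by fun_prop) (‖a‖ + R) (fun p => by
      have := hcirc a p.1
      rw [Metric.mem_closedBall, dist_eq_norm] at this
      linarith [norm_le_norm_add_norm_sub' (circleMap a R p.1) a])
  let β : ℝ × ℝ →ᵇ ℂ := BoundedContinuousFunction.ofNormedAddCommGroup
    (fun p => circleMap b R p.2) (by fun_prop) (‖b‖ + R) (fun p => by
      have := hcirc b p.2
      rw [Metric.mem_closedBall, dist_eq_norm] at this
      linarith [norm_le_norm_add_norm_sub' (circleMap b R p.2) b])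
  obtain ⟨B, hB⟩ : ∃ B, ∀ p ∈ Metric.closedBall a R ×ˢ Metric.closedBall b R, ‖f p‖ ≤ B :=
    ((isCompact_closedBall a R).prod (isCompact_closedBall b R)).exists_bound_of_continuousOn
      (hc.mono hRU)
  have hdcirc : ∀ c : ℂ, ∀ x : ℝ, ‖deriv (circleMap c R) x‖ = R := fun c x => by
    simp [deriv_circleMap, abs_of_pos hR]
  have hcf : Continuous fun p : ℝ × ℝ => f (circleMap a R p.1, circleMap b R p.2) :=
    hc.comp_continuous (by fun_prop) fun p => hRU ⟨hcirc a p.1, hcirc b p.2⟩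
  let Φ : ℝ × ℝ →ᵇ ℂ := BoundedContinuousFunction.ofNormedAddCommGroup
    (fun p => deriv (circleMap a R) p.1 * deriv (circleMap b R) p.2 *
      f (circleMap a R p.1, circleMap b R p.2))
    (by simp only [deriv_circleMap]; exact Continuous.mul (by fun_prop) hcf) (R * R * B) (fun p => by
      rw [norm_mul, norm_mul, hdcirc, hdcirc]
      exact mul_le_mul_of_nonneg_left (hB _ ⟨hcirc a p.1, hcirc b p.2⟩) (by positivity))
  let ν : Measure ℝ := volume.restrict (Ioc 0 (2 * Real.pi))
  let Λ : (ℝ × ℝ →ᵇ ℂ) →L[ℂ] ℂ := LinearMap.mkContinuous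
    { toFun := fun k => ∫ p, k p ∂(ν.prod ν)
      map_add' := fun k l => integral_add (k.integrable _) (l.integrable _)
      map_smul' := fun c k => integral_const_mul c _ } ((ν.prod ν).real univ) (fun k => by
        exact k.norm_integral_le_mul_norm (ν.prod ν))
  have hunit : ∀ c : ℂ, ∀ k : ℝ × ℝ →ᵇ ℂ, (∀ p, ‖k p - c‖ = R) →
      IsUnit (k - algebraMap ℂ _ c) := by
    intro c k hk
    have hne : ∀ p, k p - c ≠ 0 := fun p h => by
      have := hk p
      rw [h, norm_zero] at this
      exact hR.ne this
    refine IsUnit.of_mul_eq_one (BoundedContinuousFunction.ofNormedAddCommGroup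
      (fun p => (k p - c)⁻¹) ((k.continuous.sub continuous_const).inv₀ hne) R⁻¹
      (fun p => by rw [norm_inv, hk p])) ?_
    ext p
    simpa [BoundedContinuousFunction.algebraMap_apply] using mul_inv_cancel₀ (hne p)
  have hna : ∀ x : ℝ, ‖circleMap a R x - a‖ = R := fun x => by
    simp [circleMap, abs_of_pos hR]
  have hnb : ∀ x : ℝ, ‖circleMap b R x - b‖ = R := fun x => by
    simp [circleMap, abs_of_pos hR]
  have hinv : ∀ c : ℂ, ∀ k : ℝ × ℝ →ᵇ ℂ, (∀ p, ‖k p - c‖ = R) →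
      AnalyticAt ℂ (fun z : ℂ => Ring.inverse (k - algebraMap ℂ (ℝ × ℝ →ᵇ ℂ) z)) c ∧
      ∀ᶠ z in 𝓝 c, ∀ p, Ring.inverse (k - algebraMap ℂ (ℝ × ℝ →ᵇ ℂ) z) p = (k p - z)⁻¹ := by
    intro c k hk
    obtain ⟨x, hx⟩ := hunit c k hk
    have hlin : AnalyticAt ℂ (fun z : ℂ => k - algebraMap ℂ (ℝ × ℝ →ᵇ ℂ) z) c :=
      analyticAt_const.sub ((algebraMapCLM ℂ (ℝ × ℝ →ᵇ ℂ)).analyticAt c)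
    refine ⟨AnalyticAt.fun_comp (hx ▸ analyticAt_inverse x) hlin, ?_⟩
    have ho : ∀ᶠ z in 𝓝 c, IsUnit (k - algebraMap ℂ (ℝ × ℝ →ᵇ ℂ) z) :=
      hlin.continuousAt.eventually (Units.isOpen.mem_nhds ⟨x, hx⟩)
    filter_upwards [ho] with z hz p
    have h := Ring.mul_inverse_cancel _ hz
    have h' := congrArg (fun l : ℝ × ℝ →ᵇ ℂ => l p) h
    simp [BoundedContinuousFunction.algebraMap_apply] at h'
    exact eq_inv_of_mul_eq_one_right h'
  obtain ⟨hα, hα'⟩ := hinv a α (fun p => hna p.1)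
  obtain ⟨hβ, hβ'⟩ := hinv b β (fun p => hnb p.2)
  have han : AnalyticAt ℂ (fun p : ℂ × ℂ => (2 * Real.pi * Complex.I)⁻¹ ^ 2 *
      Λ (Φ * Ring.inverse (α - algebraMap ℂ (ℝ × ℝ →ᵇ ℂ) p.1) *
        Ring.inverse (β - algebraMap ℂ (ℝ × ℝ →ᵇ ℂ) p.2))) (a, b) := by
    refine analyticAt_const.mul (AnalyticAt.fun_comp (Λ.analyticAt _) ?_)
    exact (analyticAt_const.mul (AnalyticAt.fun_comp (g := fun z : ℂ =>
        Ring.inverse (α - algebraMap ℂ (ℝ × ℝ →ᵇ ℂ) z)) hα analyticAt_fst)).mul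
      (AnalyticAt.fun_comp (g := fun z : ℂ =>
        Ring.inverse (β - algebraMap ℂ (ℝ × ℝ →ᵇ ℂ) z)) hβ analyticAt_snd)
  refine han.congr ?_
  have e1 : ∀ᶠ p : ℂ × ℂ in 𝓝 (a, b), p.1 ∈ Metric.ball a R ∧
      ∀ q, Ring.inverse (α - algebraMap ℂ (ℝ × ℝ →ᵇ ℂ) p.1) q = (α q - p.1)⁻¹ :=
    (continuous_fst.tendsto (a, b)).eventually (Eventually.and (p := fun z => z ∈ Metric.ball a R) (Metric.ball_mem_nhds a hR) hα')
  have e2 : ∀ᶠ p : ℂ × ℂ in 𝓝 (a, b), p.2 ∈ Metric.ball b R ∧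
      ∀ q, Ring.inverse (β - algebraMap ℂ (ℝ × ℝ →ᵇ ℂ) p.2) q = (β q - p.2)⁻¹ :=
    (continuous_snd.tendsto (a, b)).eventually (Eventually.and (p := fun z => z ∈ Metric.ball b R) (Metric.ball_mem_nhds b hR) hβ')
  filter_upwards [e1, e2] with ⟨z, w⟩ ⟨hz, hz'⟩ ⟨hw, hw'⟩
  -- Cauchy's formula in each variable
  have c2 : ∀ x : ℝ, f (circleMap a R x, w) = (2 * Real.pi * Complex.I)⁻¹ *
      ∫ y, deriv (circleMap b R) y * ((circleMap b R y - w)⁻¹ *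
        f (circleMap a R x, circleMap b R y)) ∂ν := by
    intro x
    have hd : DifferentiableOn ℂ (fun v => f (circleMap a R x, v)) (Metric.closedBall b R) :=
      fun v hv => (h2 (circleMap a R x, v) (hRU ⟨hcirc a x, hv⟩)).differentiableWithinAt
    have := (hd.diffContOnCl_ball le_rfl).two_pi_i_inv_smul_circleIntegral_sub_inv_smul hw
    rw [← this, circleIntegral, intervalIntegral.integral_of_le Real.two_pi_pos.le]
    simp only [smul_eq_mul]
    rfl
  have c1 : f (z, w) = (2 * Real.pi * Complex.I)⁻¹ *
      ∫ x, deriv (circleMap a R) x * ((circleMap a R x - z)⁻¹ * f (circleMap a R x, w)) ∂ν := by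
    have hd : DifferentiableOn ℂ (fun v => f (v, w)) (Metric.closedBall a R) :=
      fun v hv => (h1 (v, w) (hRU ⟨hv, Metric.ball_subset_closedBall hw⟩)).differentiableWithinAt
    have := (hd.diffContOnCl_ball le_rfl).two_pi_i_inv_smul_circleIntegral_sub_inv_smul hz
    rw [← this, circleIntegral, intervalIntegral.integral_of_le Real.two_pi_pos.le]
    simp only [smul_eq_mul]
    rfl
  change _ * ∫ q, _ ∂(ν.prod ν) = _
  rw [integral_prod _ (BoundedContinuousFunction.integrable _ _), c1, pow_two, mul_assoc,
    ← integral_const_mul]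
  congr 1
  refine integral_congr_ae (Eventually.of_forall fun x => ?_)
  simp only []
  rw [c2 x, ← integral_const_mul, ← integral_const_mul, ← integral_const_mul, ← integral_const_mul]
  refine integral_congr_ae (Eventually.of_forall fun y => ?_)
  simp only [BoundedContinuousFunction.mul_apply, hz', hw']
  change _ * (deriv (circleMap a R) x * deriv (circleMap b R) y *
      f (circleMap a R x, circleMap b R y) * (circleMap a R x - z)⁻¹ *
      (circleMap b R y - w)⁻¹) = _
  ring

theorem analyticOnNhd_integral {α : Type*} [MeasurableSpace α] {μ : Measure α}
    {f : ℂ × ℂ → α → ℂ} {U : Set (ℂ × ℂ)} (hU : IsOpen U)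
    (hmeas : ∀ p ∈ U, AEStronglyMeasurable (f p) μ)
    (han : ∀ᵐ a ∂μ, AnalyticOnNhd ℂ (fun p => f p a) U)
    (hbound : ∀ p ∈ U, ∃ g : α → ℝ, ∃ ε > 0, Integrable g μ ∧
      ∀ᵐ a ∂μ, ∀ q ∈ Metric.ball p ε ∩ U, ‖f q a‖ ≤ g a) :
    AnalyticOnNhd ℂ (fun p => ∫ a, f p a ∂μ) U := by
  have key : ∀ p ∈ U, ∃ g : α → ℝ, ∃ ε > 0, Integrable g μ ∧ Metric.ball p ε ⊆ U ∧
      ∀ᵐ a ∂μ, ∀ q ∈ Metric.ball p ε, ‖f q a‖ ≤ g a := by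
    intro p hp
    obtain ⟨g, ε, hε, hg, hb⟩ := hbound p hp
    obtain ⟨δ, hδ, hδU⟩ := Metric.isOpen_iff.1 hU p hp
    refine ⟨g, min ε δ, lt_min hε hδ, hg,
      (Metric.ball_subset_ball (min_le_right _ _)).trans hδU, ?_⟩
    filter_upwards [hb] with a ha q hq
    exact ha q ⟨Metric.ball_subset_ball (min_le_left _ _) hq,
      hδU (Metric.ball_subset_ball (min_le_right _ _) hq)⟩
  refine analyticOnNhd_of_separately hU ?_ ?_ ?_
  · intro p hp
    obtain ⟨g, ε, hε, hg, hbU, hb⟩ := key p hp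
    refine (continuousAt_of_dominated (bound := g) ?_ ?_ hg ?_).continuousWithinAt
    · filter_upwards [hU.mem_nhds hp] with q hq using hmeas q hq
    · filter_upwards [Metric.ball_mem_nhds p hε] with q hq
      filter_upwards [hb] with a ha using ha q hq
    · filter_upwards [han] with a ha using (ha p hp).continuousAt
  · rintro ⟨z, w⟩ hp
    obtain ⟨g, ε, hε, hg, hbU, hb⟩ := key _ hp
    have hin : ∀ v ∈ Metric.ball z ε, (v, w) ∈ Metric.ball (z, w) ε := fun v hv => by
      rw [← ball_prod_same]
      exact ⟨hv, Metric.mem_ball_self hε⟩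
    refine (hasDerivAt_integral_of_holomorphic (f := fun v a => f (v, w) a) hε
      (fun v hv => hmeas _ (hbU (hin v hv))) ?_ hg ?_).2.differentiableAt
    · filter_upwards [han] with a ha v hv
      have h1 : DifferentiableAt ℂ (fun p => f p a) (v, w) :=
        (ha (v, w) (hbU (hin v hv))).differentiableAt
      exact (DifferentiableAt.fun_comp' (g := fun p => f p a) v h1
        (differentiableAt_id.prodMk (differentiableAt_const w))).differentiableWithinAt
    · filter_upwards [hb] with a ha v hv using ha _ (hin v hv)
  · rintro ⟨z, w⟩ hp
    obtain ⟨g, ε, hε, hg, hbU, hb⟩ := key _ hp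
    have hin : ∀ v ∈ Metric.ball w ε, (z, v) ∈ Metric.ball (z, w) ε := fun v hv => by
      rw [← ball_prod_same]
      exact ⟨Metric.mem_ball_self hε, hv⟩
    refine (hasDerivAt_integral_of_holomorphic (f := fun v a => f (z, v) a) hε
      (fun v hv => hmeas _ (hbU (hin v hv))) ?_ hg ?_).2.differentiableAt
    · filter_upwards [han] with a ha v hv
      have h1 : DifferentiableAt ℂ (fun p => f p a) (z, v) :=
        (ha (z, v) (hbU (hin v hv))).differentiableAt
      exact (DifferentiableAt.fun_comp' (g := fun p => f p a) v h1
        ((differentiableAt_const z).prodMk differentiableAt_id)).differentiableWithinAt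
    · filter_upwards [hb] with a ha v hv using ha _ (hin v hv)

theorem analyticOnNhd_tsum {f : ℕ → ℂ × ℂ → ℂ} {U : Set (ℂ × ℂ)} (hU : IsOpen U)
    (han : ∀ k, AnalyticOnNhd ℂ (f k) U)
    (hbound : ∀ p ∈ U, ∃ u : ℕ → ℝ, Summable u ∧ ∀ᶠ q in 𝓝 p, ∀ k, ‖f k q‖ ≤ u k) :
    AnalyticOnNhd ℂ (fun p => ∑' k, f k p) U := by
  have key : ∀ p ∈ U, ∃ u : ℕ → ℝ, ∃ ε > 0, Summable u ∧ Metric.ball p ε ⊆ U ∧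
      ∀ k, ∀ q ∈ Metric.ball p ε, ‖f k q‖ ≤ u k := by
    intro p hp
    obtain ⟨u, hu, hb⟩ := hbound p hp
    obtain ⟨ε, hε, h⟩ := Metric.eventually_nhds_iff_ball.1 (hb.and (hU.mem_nhds hp))
    exact ⟨u, ε, hε, hu, fun q hq => (h q hq).2, fun k q hq => (h q hq).1 k⟩
  refine analyticOnNhd_of_separately hU ?_ ?_ ?_
  · intro p hp
    obtain ⟨u, ε, hε, hu, hbU, hb⟩ := key p hp
    exact ((continuousOn_tsum (fun k => (han k).continuousOn.mono hbU) hu hb).continuousAt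
      (Metric.ball_mem_nhds p hε)).continuousWithinAt
  · rintro ⟨z, w⟩ hp
    obtain ⟨u, ε, hε, hu, hbU, hb⟩ := key _ hp
    have hin : ∀ v ∈ Metric.ball z ε, (v, w) ∈ Metric.ball (z, w) ε := fun v hv => by
      rw [← ball_prod_same]
      exact ⟨hv, Metric.mem_ball_self hε⟩
    refine (Complex.differentiableOn_tsum_of_summable_norm (F := fun k v => f k (v, w)) hu ?_
      Metric.isOpen_ball fun k v hv => hb k _ (hin v hv)).differentiableAt
      (Metric.ball_mem_nhds z hε)
    intro k v hv
    exact (DifferentiableAt.fun_comp' (g := f k) v (han k (v, w) (hbU (hin v hv))).differentiableAt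
      (differentiableAt_id.prodMk (differentiableAt_const w))).differentiableWithinAt
  · rintro ⟨z, w⟩ hp
    obtain ⟨u, ε, hε, hu, hbU, hb⟩ := key _ hp
    have hin : ∀ v ∈ Metric.ball w ε, (z, v) ∈ Metric.ball (z, w) ε := fun v hv => by
      rw [← ball_prod_same]
      exact ⟨Metric.mem_ball_self hε, hv⟩
    refine (Complex.differentiableOn_tsum_of_summable_norm (F := fun k v => f k (z, v)) hu ?_
      Metric.isOpen_ball fun k v hv => hb k _ (hin v hv)).differentiableAt
      (Metric.ball_mem_nhds w hε)
    intro k v hv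
    exact (DifferentiableAt.fun_comp' (g := f k) v (han k (z, v) (hbU (hin v hv))).differentiableAt
      ((differentiableAt_const z).prodMk differentiableAt_id)).differentiableWithinAt

/-! ### The majorant -/

/-- The weight `(1 + |x|)^(-a)`. -/
def decay (a x : ℝ) : ℝ := (1 + |x|) ^ (-a)

theorem decay_pos (a x : ℝ) : 0 < decay a x := by unfold decay; positivity

theorem decay_le_one {a : ℝ} (ha : 0 ≤ a) (x : ℝ) : decay a x ≤ 1 :=
  Real.rpow_le_one_of_one_le_of_nonpos (by linarith [abs_nonneg x]) (by linarith)

theorem decay_anti {a b : ℝ} (hab : a ≤ b) (x : ℝ) : decay b x ≤ decay a x :=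
  Real.rpow_le_rpow_of_exponent_le (by linarith [abs_nonneg x]) (by linarith)

theorem decay_mul (a b x : ℝ) : decay a x * decay b x = decay (a + b) x := by
  unfold decay
  rw [← Real.rpow_add (by positivity)]
  congr 1
  ring

theorem continuous_decay (a : ℝ) : Continuous (decay a) := by
  unfold decay
  exact Continuous.rpow_const (by fun_prop) fun x => Or.inl (by positivity)

/-- The increasing `C¹` function with `ramp' = ρ (1 + |x|)^(-(1 + ρ))` which vanishes at `-∞`; it is
of order `|x|^(-ρ)` on the left and bounded on the right. -/
def ramp (ρ x : ℝ) : ℝ := if x ≤ 0 then (1 - x) ^ (-ρ) else 2 - (1 + x) ^ (-ρ)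

theorem ramp_of_nonpos {ρ x : ℝ} (hx : x ≤ 0) : ramp ρ x = decay ρ x := by
  rw [ramp, if_pos hx, decay, abs_of_nonpos hx, sub_eq_add_neg]

theorem ramp_of_nonneg {ρ x : ℝ} (hx : 0 ≤ x) : ramp ρ x = 2 - decay ρ x := by
  rcases hx.eq_or_lt with rfl | hx
  · rw [ramp_of_nonpos le_rfl]
    norm_num [decay]
  · rw [ramp, if_neg hx.not_ge, decay, abs_of_pos hx]

theorem decay_le_ramp {ρ : ℝ} (hρ : 0 ≤ ρ) (x : ℝ) : decay ρ x ≤ ramp ρ x := by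
  rcases le_total x 0 with hx | hx
  · rw [ramp_of_nonpos hx]
  · rw [ramp_of_nonneg hx]
    linarith [decay_le_one hρ x]

theorem ramp_pos {ρ : ℝ} (hρ : 0 ≤ ρ) (x : ℝ) : 0 < ramp ρ x :=
  (decay_pos ρ x).trans_le (decay_le_ramp hρ x)

theorem ramp_le_two {ρ : ℝ} (hρ : 0 ≤ ρ) (x : ℝ) : ramp ρ x ≤ 2 := by
  rcases le_total x 0 with hx | hx
  · rw [ramp_of_nonpos hx]
    linarith [decay_le_one hρ x]
  · rw [ramp_of_nonneg hx]
    linarith [decay_pos ρ x]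

theorem continuous_ramp (ρ : ℝ) : Continuous (ramp ρ) := by
  have h1 : ContinuousOn (ramp ρ) (Iic 0) :=
    (continuous_decay ρ).continuousOn.congr fun x hx => ramp_of_nonpos hx
  have h2 : ContinuousOn (ramp ρ) (Ici 0) :=
    (continuous_const.sub (continuous_decay ρ)).continuousOn.congr fun x hx => ramp_of_nonneg hx
  rw [← continuousOn_univ, ← Iic_union_Ici (a := (0 : ℝ))]
  exact h1.union_of_isClosed h2 isClosed_Iic isClosed_Ici

theorem hasDerivAt_ramp (ρ x : ℝ) : HasDerivAt (ramp ρ) (ρ * decay (1 + ρ) x) x := by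
  have hd : ∀ y : ℝ, y ≠ 0 → HasDerivAt (ramp ρ) (ρ * decay (1 + ρ) y) y := by
    intro y hy
    rcases lt_or_gt_of_ne hy with hy | hy
    · have h1 : HasDerivAt (fun z : ℝ => (1 - z) ^ (-ρ)) (ρ * decay (1 + ρ) y) y := by
        have := ((hasDerivAt_id y).const_sub 1).rpow_const (p := -ρ) (Or.inl (by simp; linarith))
        refine this.congr_deriv ?_
        simp only [id, decay, abs_of_neg hy]
        rw [show -ρ - 1 = -(1 + ρ) by ring, ← sub_eq_add_neg]
        ring
      refine h1.congr_of_eventuallyEq ?_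
      filter_upwards [Iio_mem_nhds hy] with z hz
      rw [ramp, if_pos (le_of_lt hz)]
    · have h1 : HasDerivAt (fun z : ℝ => 2 - (1 + z) ^ (-ρ)) (ρ * decay (1 + ρ) y) y := by
        have := (((hasDerivAt_id y).const_add 1).rpow_const (p := -ρ)
          (Or.inl (by simp; linarith))).const_sub 2
        refine this.congr_deriv ?_
        simp only [id, decay, abs_of_pos hy]
        rw [show -ρ - 1 = -(1 + ρ) by ring]
        ring
      refine h1.congr_of_eventuallyEq ?_
      filter_upwards [Ioi_mem_nhds hy] with z hz
      rw [ramp, if_neg (not_le.2 hz)]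
  by_cases hx : x = 0
  · subst hx
    exact hasDerivAt_of_hasDerivAt_of_ne hd (continuous_ramp ρ).continuousAt
      (continuous_const.mul (continuous_decay _)).continuousAt
  · exact hd x hx

theorem tendsto_ramp_atBot {ρ : ℝ} (hρ : 0 < ρ) : Tendsto (ramp ρ) atBot (𝓝 0) := by
  have h : Tendsto (fun x : ℝ => (1 - x) ^ (-ρ)) atBot (𝓝 0) :=
    (tendsto_rpow_neg_atTop hρ).comp (tendsto_atTop_add_const_left _ 1 tendsto_neg_atBot_atTop)
  refine h.congr' ?_
  filter_upwards [Iic_mem_atBot 0] with x hx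
  exact (if_pos (mem_Iic.1 hx)).symm

theorem ramp_le_div_max {ρ : ℝ} (hρ : 0 < ρ) (x : ℝ) :
    ramp ρ x ≤ 2 / max 1 (-Real.sign x * |x| ^ ρ) := by
  rcases le_or_gt 0 x with hx | hx
  · have : max 1 (-Real.sign x * |x| ^ ρ) = 1 := by
      refine max_eq_left ?_
      have h1 : 0 ≤ Real.sign x := by
        rcases hx.eq_or_lt with rfl | hx
        · simp
        · simp [Real.sign_of_pos hx]
      have h2 : 0 ≤ |x| ^ ρ := by positivity
      nlinarith
    rw [this, div_one]
    exact ramp_le_two hρ.le x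
  · rw [ramp_of_nonpos hx.le, Real.sign_of_neg hx, neg_neg, one_mul, decay,
      Real.rpow_neg (by positivity), ← one_div]
    refine div_le_div₀ (by norm_num) (by norm_num) (by positivity) (max_le ?_ ?_)
    · exact Real.one_le_rpow (by linarith [abs_nonneg x]) hρ.le
    · exact Real.rpow_le_rpow (abs_nonneg x) (by linarith) hρ.le

/-- `M` (with derivative `M'`) is a supersolution adapted to the transport equation
`2 F_t + F_ξ = -φ F - ∫ V F` when `φ` and `V` have the decay of `LeftData` with constant `C`.
It is comparable to `ramp ρ`; `decay_mul_le` makes the nonlocal term small, and `transport` says that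
along `l ↦ (l t, x - (1 - l) Re t / 2)` the weight `exp (growth σ b (l t)) * M` grows at least as
fast as the source terms. The rate `σ > 0` can be prescribed; `b`, `K`, `δ` and `M` depend on it. -/
structure IsMajorant (C ρ σ b K δ : ℝ) (M M' : ℝ → ℝ) : Prop where
  b_nonneg : 0 ≤ b
  K_pos : 0 < K
  δ_pos : 0 < δ
  hasDerivAt : ∀ x, HasDerivAt M (M' x) x
  continuous_deriv : Continuous M'
  deriv_nonneg : ∀ x, 0 ≤ M' x
  ramp_le : ∀ x, ramp ρ x ≤ M x
  le_ramp : ∀ x, M x ≤ K * ramp ρ x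
  decay_mul_le : ∀ x, decay (1 + ρ) x * M x ≤ δ * M' x
  transport : ∀ (x : ℝ) (t : ℂ), ‖t‖ * (C * decay (1 / 2 + ρ) x + C * δ) * M x ≤
    (σ * ‖t‖ + b * (‖t‖ - t.re)) * M x + t.re / 2 * M' x

/-- The majorant is `ramp ρ * exp (L * ramp ρ)` with `L` large. -/
theorem exists_isMajorant {C ρ σ : ℝ} (hC : 0 < C) (hρ : 0 < ρ) (hσ : 0 < σ) :
    ∃ (b K δ : ℝ) (M M' : ℝ → ℝ), IsMajorant C ρ σ b K δ M M' := by
  obtain ⟨δ, hδ, hδ1, hδ2⟩ : ∃ δ : ℝ, 0 < δ ∧ C * δ ≤ σ / 2 ∧ 8 * C ^ 2 * δ ≤ σ := by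
    refine ⟨min (σ / (2 * C)) (σ / (8 * C ^ 2)), by positivity, ?_, ?_⟩
    · calc C * min (σ / (2 * C)) (σ / (8 * C ^ 2)) ≤ C * (σ / (2 * C)) := by
            gcongr; exact min_le_left _ _
        _ = σ / 2 := by field_simp
    · calc 8 * C ^ 2 * min (σ / (2 * C)) (σ / (8 * C ^ 2)) ≤ 8 * C ^ 2 * (σ / (8 * C ^ 2)) := by
            gcongr; exact min_le_right _ _
        _ = σ := by field_simp
  obtain ⟨L, hL, hLδ⟩ : ∃ L : ℝ, 0 < L ∧ δ * (ρ * L) = 1 :=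
    ⟨1 / (ρ * δ), by positivity, by field_simp⟩
  set q := decay (1 + ρ) with hq
  have hq0 : ∀ x, 0 < q x := decay_pos _
  have hr0 : ∀ x, 0 < ramp ρ x := ramp_pos hρ.le
  have hr2 : ∀ x, ramp ρ x ≤ 2 := ramp_le_two hρ.le
  have hq1 : ∀ x, q x ≤ 1 := decay_le_one (by linarith)
  have hqr : ∀ x, q x ≤ ramp ρ x := fun x =>
    (decay_anti (by linarith) x).trans (decay_le_ramp hρ.le x)
  have hgq : ∀ x, C * decay (1 / 2 + ρ) x * δ ≤ σ / 2 * δ + q x / 4 := by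
    intro x
    have hgp := decay_pos (1 / 2 + ρ) x
    rcases le_or_gt (C * decay (1 / 2 + ρ) x) (σ / 2) with h | h
    · have := mul_le_mul_of_nonneg_right h hδ.le
      linarith [hq0 x]
    · have h1 : q x = decay (1 / 2 + ρ) x * decay (1 / 2) x := by
        rw [decay_mul, hq]
        congr 1
        ring
      have h2 : decay (1 / 2 + ρ) x ≤ decay (1 / 2) x := decay_anti (by linarith) x
      have h3 : σ * decay (1 / 2 + ρ) x ≤ 2 * C * q x := by
        rw [h1]
        nlinarith
      have h4 : C * decay (1 / 2 + ρ) x * δ * (8 * C) ≤ q x / 4 * (8 * C) := by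
        have := mul_le_mul_of_nonneg_right hδ2 hgp.le
        nlinarith
      have h5 := le_of_mul_le_mul_right h4 (by positivity)
      have : 0 ≤ σ / 2 * δ := by positivity
      linarith
  set μ := ρ * (1 + L) with hμ
  have hμ0 : 0 < μ := by positivity
  refine ⟨2 * C * (1 + δ) + μ, Real.exp (L * 2), δ, fun x => ramp ρ x * Real.exp (L * ramp ρ x),
    fun x => ρ * q x * (1 + L * ramp ρ x) * Real.exp (L * ramp ρ x), by positivity, by positivity,
    hδ, ?_, ?_, ?_, ?_, ?_, ?_, ?_⟩
  · intro x
    have h := hasDerivAt_ramp ρ x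
    have := h.mul ((h.const_mul L).exp)
    refine this.congr_deriv ?_
    rw [hq]
    ring
  · have h1 := continuous_ramp ρ
    have h2 := continuous_decay (1 + ρ)
    fun_prop
  · intro x
    have := hr0 x
    have := hq0 x
    positivity
  · intro x
    have := hr0 x
    exact le_mul_of_one_le_right this.le (Real.one_le_exp (by positivity))
  · intro x
    rw [mul_comm]
    have := hr0 x
    gcongr
    exact hr2 x
  · intro x
    have h1 := hr0 x
    have h2 := hq0 x
    calc q x * (ramp ρ x * Real.exp (L * ramp ρ x))
        = (δ * (ρ * L)) * (q x * (ramp ρ x * Real.exp (L * ramp ρ x))) := by rw [hLδ, one_mul]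
      _ ≤ (δ * (ρ * L)) * (q x * (ramp ρ x * Real.exp (L * ramp ρ x))) +
          δ * (ρ * q x * Real.exp (L * ramp ρ x)) := le_add_of_nonneg_right (by positivity)
      _ = _ := by ring
  · intro x t
    have hr := hr0 x
    have hqp := hq0 x
    have hg1 : decay (1 / 2 + ρ) x ≤ 1 := decay_le_one (by linarith) x
    have ht : t.re ≤ ‖t‖ := Complex.re_le_norm t
    have ht' : -‖t‖ ≤ t.re := (abs_le.1 (Complex.abs_re_le_norm t)).1
    have hn := norm_nonneg t
    -- divide by the positive factor `exp (L * ramp ρ x)`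
    suffices h : ‖t‖ * (C * decay (1 / 2 + ρ) x + C * δ) * ramp ρ x ≤
        (σ * ‖t‖ + (2 * C * (1 + δ) + μ) * (‖t‖ - t.re)) * ramp ρ x +
          t.re / 2 * (ρ * q x * (1 + L * ramp ρ x)) by
      have := mul_le_mul_of_nonneg_right h (Real.exp_pos (L * ramp ρ x)).le
      calc _ = ‖t‖ * (C * decay (1 / 2 + ρ) x + C * δ) * ramp ρ x * Real.exp (L * ramp ρ x) := by
            ring
        _ ≤ _ := this
        _ = _ := by ring
    -- For `t` near the positive real axis the increase of `M` along the characteristic absorbs the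
    -- integrable part of the sources and `σ` the rest; elsewhere `b * (‖t‖ - t.re)` absorbs all.
    rcases le_or_gt (‖t‖ / 2) t.re with hc | hc
    · have h1 : C * decay (1 / 2 + ρ) x + C * δ ≤ σ + ρ * L / 4 * q x := by
        have h := mul_le_mul_of_nonneg_right (hgq x) (by positivity : 0 ≤ ρ * L)
        have e1 : C * decay (1 / 2 + ρ) x * δ * (ρ * L) = C * decay (1 / 2 + ρ) x := by
          rw [mul_assoc _ δ, hLδ, mul_one]
        have e2 : (σ / 2 * δ + q x / 4) * (ρ * L) = σ / 2 + ρ * L / 4 * q x := by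
          rw [add_mul, mul_assoc _ δ, hLδ]; ring
        rw [e1, e2] at h
        linarith
      have h2 : 0 ≤ (2 * C * (1 + δ) + μ) * (‖t‖ - t.re) * ramp ρ x := by
        have : 0 ≤ ‖t‖ - t.re := by linarith
        positivity
      have h3 : ‖t‖ / 2 / 2 * (ρ * q x * (L * ramp ρ x)) ≤
          t.re / 2 * (ρ * q x * (1 + L * ramp ρ x)) := by
        have : 0 ≤ t.re := by linarith
        gcongr
        linarith
      have h4 : ‖t‖ * (C * decay (1 / 2 + ρ) x + C * δ) * ramp ρ x ≤
          ‖t‖ * (σ + ρ * L / 4 * q x) * ramp ρ x := by gcongr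
      linarith
    · have h1 : ρ * q x * (1 + L * ramp ρ x) ≤ μ * ramp ρ x := by
        have h : q x * (1 + L * ramp ρ x) ≤ (1 + L) * ramp ρ x := by
          have := mul_le_mul_of_nonneg_right (hq1 x) (mul_pos hL hr).le
          linarith [hqr x]
        have := mul_le_mul_of_nonneg_left h hρ.le
        rw [hμ]
        linarith
      have h1' : 0 ≤ ρ * q x * (1 + L * ramp ρ x) := by positivity
      have h2 : -(‖t‖ / 2 * (μ * ramp ρ x)) ≤ t.re / 2 * (ρ * q x * (1 + L * ramp ρ x)) := by
        have a1 : ‖t‖ / 2 * (ρ * q x * (1 + L * ramp ρ x)) ≤ ‖t‖ / 2 * (μ * ramp ρ x) := by gcongr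
        have a2 : -(‖t‖ / 2) * (ρ * q x * (1 + L * ramp ρ x)) ≤
            t.re / 2 * (ρ * q x * (1 + L * ramp ρ x)) := by gcongr; linarith
        linarith
      have h3 : (2 * C * (1 + δ) + μ) * (‖t‖ / 2) * ramp ρ x ≤
          (2 * C * (1 + δ) + μ) * (‖t‖ - t.re) * ramp ρ x := by gcongr; linarith
      have h4 : ‖t‖ * (C * decay (1 / 2 + ρ) x + C * δ) * ramp ρ x ≤
          ‖t‖ * (C * 1 + C * δ) * ramp ρ x := by gcongr
      have h5 : 0 ≤ σ * ‖t‖ * ramp ρ x := by positivity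
      linarith

theorem integral_Ioi_comp_sub {P P' : ℝ → ℝ} (hP : ∀ x, HasDerivAt P (P' x) x)
    (hP' : ∀ x, 0 ≤ P' x) (h0 : Tendsto P atBot (𝓝 0)) (x : ℝ) :
    IntegrableOn (fun y => P' (x - y)) (Ioi 0) ∧ ∫ y in Ioi (0 : ℝ), P' (x - y) = P x := by
  have hd : ∀ y : ℝ, HasDerivAt (fun y => -P (x - y)) (P' (x - y)) y := fun y => by
    have := ((hP (x - y)).comp y ((hasDerivAt_id y).const_sub x)).neg
    exact this.congr_deriv (by simp)
  have ht : Tendsto (fun y => -P (x - y)) atTop (𝓝 0) := by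
    have : Tendsto (fun y : ℝ => x - y) atTop atBot :=
      tendsto_atBot_add_const_left _ x tendsto_neg_atTop_atBot
    simpa using (h0.comp this).neg
  refine ⟨integrableOn_Ioi_deriv_of_nonneg' (fun y _ => hd y) (fun y _ => hP' _) ht, ?_⟩
  rw [integral_Ioi_of_hasDerivAt_of_nonneg' (fun y _ => hd y) (fun y _ => hP' _) ht]
  simp

theorem integral_decay {ρ : ℝ} (hρ : 0 < ρ) (x : ℝ) :
    IntegrableOn (fun y => decay (1 + ρ) (x - y)) (Ioi 0) ∧
      ∫ y in Ioi (0 : ℝ), decay (1 + ρ) (x - y) = ramp ρ x / ρ := by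
  have h := integral_Ioi_comp_sub (P := fun x => ramp ρ x / ρ) (P' := decay (1 + ρ))
    (fun y => by
      exact ((hasDerivAt_ramp ρ y).div_const ρ).congr_deriv (mul_div_cancel_left₀ _ hρ.ne')) (fun y => (decay_pos _ y).le)
    (by simpa using (tendsto_ramp_atBot hρ).div_const ρ) x
  exact h

/-- The exponential growth rate of the majorant in `t`: it equals `σ t` for `t ≥ 0`, exceeds
`σ Re t` by a bounded amount on each strip `stripU r`, and is homogeneous along rays. -/
def growth (σ b : ℝ) (t : ℂ) : ℝ := σ * ‖t‖ + b * (‖t‖ - t.re)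

theorem growth_smul (σ b : ℝ) {l : ℝ} (hl : 0 ≤ l) (t : ℂ) :
    growth σ b (l * t) = l * growth σ b t := by
  simp only [growth, norm_mul, Complex.norm_real, Real.norm_of_nonneg hl, Complex.re_ofReal_mul]
  ring

theorem growth_nonneg {σ b : ℝ} (hσ : 0 ≤ σ) (hb : 0 ≤ b) (t : ℂ) :
    0 ≤ growth σ b t := by
  have : 0 ≤ ‖t‖ - t.re := by linarith [Complex.re_le_norm t]
  unfold growth
  positivity

namespace IsMajorant

variable {C ρ σ b K δ : ℝ} {M M' : ℝ → ℝ}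

theorem pos (h : IsMajorant C ρ σ b K δ M M') (hρ : 0 < ρ) (x : ℝ) : 0 < M x :=
  (ramp_pos hρ.le x).trans_le (h.ramp_le x)

theorem continuous (h : IsMajorant C ρ σ b K δ M M') : Continuous M :=
  continuous_iff_continuousAt.2 fun x => (h.hasDerivAt x).continuousAt

theorem le_const (h : IsMajorant C ρ σ b K δ M M') (hρ : 0 < ρ) (x : ℝ) : M x ≤ K * 2 :=
  (h.le_ramp x).trans (mul_le_mul_of_nonneg_left (ramp_le_two hρ.le x) h.K_pos.le)

theorem integral_le (h : IsMajorant C ρ σ b K δ M M') (hρ : 0 < ρ) (x : ℝ) :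
    IntegrableOn (fun y => decay (1 + ρ) (x - y) * M (x - y)) (Ioi 0) ∧
      ∫ y in Ioi (0 : ℝ), decay (1 + ρ) (x - y) * M (x - y) ≤ δ * M x := by
  have h0 : Tendsto M atBot (𝓝 0) := by
    refine squeeze_zero (fun x => (h.pos hρ x).le) h.le_ramp ?_
    simpa using (tendsto_ramp_atBot hρ).const_mul K
  obtain ⟨hi, he⟩ := integral_Ioi_comp_sub h.hasDerivAt h.deriv_nonneg h0 x
  have hi' : IntegrableOn (fun y => decay (1 + ρ) (x - y) * M (x - y)) (Ioi 0) := by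
    refine (hi.const_mul δ).mono' ?_ (Eventually.of_forall fun y => ?_)
    · have h1 := continuous_decay (1 + ρ)
      have h2 := h.continuous
      exact Continuous.aestronglyMeasurable (by fun_prop)
    · rw [Real.norm_of_nonneg (mul_nonneg (decay_pos _ _).le (h.pos hρ _).le)]
      exact h.decay_mul_le _
  refine ⟨hi', ?_⟩
  rw [← he, ← integral_const_mul]
  exact integral_mono hi' (hi.const_mul δ) fun y => h.decay_mul_le _

theorem hasDerivAt_ray (h : IsMajorant C ρ σ b K δ M M') (x : ℝ) (t : ℂ) (l : ℝ) :
    HasDerivAt (fun l => Real.exp (l * growth σ b t) * M (x - (1 - l) * (t.re / 2)))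
      (Real.exp (l * growth σ b t) * (growth σ b t * M (x - (1 - l) * (t.re / 2)) +
        t.re / 2 * M' (x - (1 - l) * (t.re / 2)))) l := by
  have h1 : HasDerivAt (fun l : ℝ => Real.exp (l * growth σ b t))
      (Real.exp (l * growth σ b t) * growth σ b t) l := by
    simpa using ((hasDerivAt_id l).mul_const (growth σ b t)).exp
  have h2 : HasDerivAt (fun l : ℝ => x - (1 - l) * (t.re / 2)) (t.re / 2) l := by
    have := (((hasDerivAt_id l).const_sub 1).mul_const (t.re / 2)).const_sub x
    simpa using this
  have h3 := h1.mul ((h.hasDerivAt _).comp l h2)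
  refine h3.congr_deriv ?_
  simp only [Function.comp]
  ring

theorem ray_le (h : IsMajorant C ρ σ b K δ M M') (hC : 0 ≤ C) (hρ : 0 < ρ) (x : ℝ) (t : ℂ)
    {l : ℝ} (hl : l ≤ 1) :
    Real.exp (l * growth σ b t) * M (x - (1 - l) * (t.re / 2)) ≤
      Real.exp (growth σ b t) * M x := by
  have hm := monotone_of_hasDerivAt_nonneg (h.hasDerivAt_ray x t) (fun l => by
    refine mul_nonneg (Real.exp_pos _).le (le_trans ?_ (h.transport _ t))
    have := decay_pos (1 / 2 + ρ) (x - (1 - l) * (t.re / 2))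
    have := h.pos hρ (x - (1 - l) * (t.re / 2))
    have := h.δ_pos
    positivity)
  simpa using hm hl

/-- The weighted source terms, integrated along a characteristic, are bounded by the final value
of `exp (growth σ b (l t)) * M`. -/
theorem integral_ray_le (h : IsMajorant C ρ σ b K δ M M') (hρ : 0 < ρ) (x : ℝ)
    (t : ℂ) :
    ∫ l in (0 : ℝ)..1, ‖t‖ * (C * decay (1 / 2 + ρ) (x - (1 - l) * (t.re / 2)) + C * δ) *
        (Real.exp (l * growth σ b t) * M (x - (1 - l) * (t.re / 2))) ≤
      Real.exp (growth σ b t) * M x := by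
  have hcM := h.continuous
  have hcM' := h.continuous_deriv
  have hcd := continuous_decay (1 / 2 + ρ)
  have hc : Continuous fun l => (Real.exp (l * growth σ b t) *
      (growth σ b t * M (x - (1 - l) * (t.re / 2)) +
        t.re / 2 * M' (x - (1 - l) * (t.re / 2)))) := by fun_prop
  have hftc := intervalIntegral.integral_eq_sub_of_hasDerivAt (a := 0) (b := 1)
    (fun l _ => h.hasDerivAt_ray x t l) (hc.intervalIntegrable _ _)
  refine (intervalIntegral.integral_mono_on zero_le_one
    (Continuous.intervalIntegrable (by fun_prop) _ _) (hc.intervalIntegrable _ _)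
    fun l _ => ?_).trans (hftc.le.trans ?_)
  · have := mul_le_mul_of_nonneg_left (h.transport (x - (1 - l) * (t.re / 2)) t)
      (Real.exp_pos (l * growth σ b t)).le
    calc _ = Real.exp (l * growth σ b t) * (‖t‖ *
          (C * decay (1 / 2 + ρ) (x - (1 - l) * (t.re / 2)) + C * δ) *
            M (x - (1 - l) * (t.re / 2))) := by ring
      _ ≤ _ := this
  · have := h.pos hρ (x - t.re / 2)
    simp
    exact this.le

end IsMajorant

/-! ### Half-line and segment integrals, the characteristic domain -/

theorem decay_le_mul_decay {a : ℝ} (ha : 0 ≤ a) (x y : ℝ) :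
    decay a y ≤ (1 + |x - y|) ^ a * decay a x := by
  have h : 1 + |x| ≤ (1 + |x - y|) * (1 + |y|) := by
    have h1 : |x| ≤ |x - y| + |y| := by simpa using abs_add_le (x - y) y
    nlinarith [mul_nonneg (abs_nonneg (x - y)) (abs_nonneg y)]
  have h2 : (1 + |x|) ^ a ≤ (1 + |x - y|) ^ a * (1 + |y|) ^ a := by
    rw [← Real.mul_rpow (by positivity) (by positivity)]
    exact Real.rpow_le_rpow (by positivity) h ha
  unfold decay
  rw [Real.rpow_neg (by positivity), Real.rpow_neg (by positivity), ← div_eq_mul_inv,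
    le_div_iff₀ (by positivity), inv_mul_le_iff₀ (by positivity)]
  linarith

theorem hasSum_integral_of_geometric {α : Type*} [MeasurableSpace α] {μ : Measure α}
    {f : ℕ → α → ℂ} {g : α → ℝ} (hmeas : ∀ k, AEStronglyMeasurable (f k) μ)
    (hg : Integrable g μ) (hb : ∀ k, ∀ᵐ a ∂μ, ‖f k a‖ ≤ (1 / 2) ^ k * g a) :
    HasSum (fun k => ∫ a, f k a ∂μ) (∫ a, ∑' k, f k a ∂μ) := by
  have hi : ∀ k, Integrable (f k) μ := fun k => (hg.const_mul _).mono' (hmeas k) (hb k)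
  refine hasSum_integral_of_summable_integral_norm hi ?_
  refine Summable.of_nonneg_of_le (fun k => integral_nonneg fun a => norm_nonneg _) (fun k => ?_)
    (summable_geometric_two.mul_right (∫ a, g a ∂μ))
  rw [← integral_const_mul]
  exact integral_mono_ae (hi k).norm (hg.const_mul _) (hb k)

/-- The analytic input of the construction: an open set `E` closed under translations to the left,
and holomorphic `φ`, `V` on it with the stated decay in the real part. -/
structure LeftData (E : Set ℂ) (φ V : ℂ → ℂ) (C ρ : ℝ) : Prop where
  isOpen : IsOpen E
  left : ∀ ξ ∈ E, ∀ x : ℝ, 0 ≤ x → ξ - x ∈ E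
  C_pos : 0 < C
  ρ_pos : 0 < ρ
  differentiableOn_φ : DifferentiableOn ℂ φ E
  differentiableOn_V : DifferentiableOn ℂ V E
  norm_φ_le : ∀ ξ ∈ E, ‖φ ξ‖ ≤ C * decay (1 / 2 + ρ) ξ.re
  norm_V_le : ∀ ξ ∈ E, ‖V ξ‖ ≤ C * decay (1 + ρ) ξ.re

/-- The pairs `(t, ξ)` for which the segment from `ξ - t / 2` to `ξ`, the projection of the
characteristic through `(t, ξ)` issued from `t = 0`, lies in `E`. -/
def shiftDomain (E : Set ℂ) : Set (ℂ × ℂ) :=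
  {p | ∀ l ∈ Icc (0 : ℝ) 1, p.2 - l * (p.1 / 2) ∈ E}

/-- The coefficient `A₁^+`, the initial value of the Borel transform at `t = 0`. -/
def firstCoeff (φ V : ℂ → ℂ) (ξ : ℂ) : ℂ :=
  -(1 / 2) * φ ξ - 1 / 2 * ∫ x in Ioi (0 : ℝ), V (ξ - x)

/-- The source `φ f + ∫_{-∞}^ξ V f` of the transport equation `2 F_t + F_ξ = -source F`. -/
def source (φ V : ℂ → ℂ) (f : ℂ → ℂ → ℂ) (t ξ : ℂ) : ℂ :=
  φ ξ * f t ξ + ∫ x in Ioi (0 : ℝ), V (ξ - x) * f t (ξ - x)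

/-- The integral of `-source / 2` along the characteristic from `(0, ξ - t / 2)` to `(t, ξ)`,
parametrized by `l ↦ (l t, ξ - (1 - l) t / 2)`. -/
def step (φ V : ℂ → ℂ) (f : ℂ → ℂ → ℂ) (t ξ : ℂ) : ℂ :=
  -(1 / 2) * ∫ l in Ioc (0 : ℝ) 1, t * source φ V f (l * t) (ξ - (1 - l) * (t / 2))

/-- The terms of the Neumann series of the equation `F = A₁^+(ξ - t / 2) + step F`. -/
def iterates (φ V : ℂ → ℂ) : ℕ → ℂ → ℂ → ℂ
  | 0 => fun t ξ => firstCoeff φ V (ξ - t / 2)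
  | k + 1 => step φ V (iterates φ V k)

/-- The Borel transform `F^+`, defined as the sum of the Neumann series. -/
def borel (φ V : ℂ → ℂ) (t ξ : ℂ) : ℂ := ∑' k, iterates φ V k t ξ

section Domain

variable {E : Set ℂ}

theorem isOpen_shiftDomain (hE : IsOpen E) : IsOpen (shiftDomain E) := by
  rw [isOpen_iff_mem_nhds]
  intro p hp
  refine isCompact_Icc.eventually_forall_of_forall_eventually
    (P := fun (q : ℂ × ℂ) (l : ℝ) => q.2 - l * (q.1 / 2) ∈ E) fun l hl => ?_
  have hc : Continuous fun z : (ℂ × ℂ) × ℝ => z.1.2 - z.2 * (z.1.1 / 2) := by fun_prop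
  exact (hc.tendsto (p, l)).eventually (hE.mem_nhds (hp l hl))

theorem shiftDomain_snd {p : ℂ × ℂ} (hp : p ∈ shiftDomain E) : p.2 ∈ E := by
  simpa using hp 0 (by simp)

theorem shiftDomain_shift {p : ℂ × ℂ} (hp : p ∈ shiftDomain E) : p.2 - p.1 / 2 ∈ E := by
  simpa using hp 1 (by simp)

theorem mk_zero_mem_shiftDomain {ξ : ℂ} (hξ : ξ ∈ E) : ((0 : ℂ), ξ) ∈ shiftDomain E := by
  intro l _
  simpa using hξ

theorem shiftDomain_ray {t ξ : ℂ} (hp : (t, ξ) ∈ shiftDomain E) {l : ℝ} (hl : l ∈ Icc (0 : ℝ) 1) :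
    ((l : ℂ) * t, ξ - (1 - l) * (t / 2)) ∈ shiftDomain E := by
  intro m hm
  have := hp (1 - l + m * l) ⟨by nlinarith [hl.1, hl.2, hm.1, hm.2, mul_nonneg hm.1 hl.1],
    by nlinarith [hl.1, hl.2, hm.1, hm.2, mul_nonneg (sub_nonneg.2 hm.2) hl.1]⟩
  push_cast at this
  convert this using 1
  ring

theorem shiftDomain_left (hE : ∀ ξ ∈ E, ∀ x : ℝ, 0 ≤ x → ξ - x ∈ E) {t ξ : ℂ}
    (hp : (t, ξ) ∈ shiftDomain E) {x : ℝ} (hx : 0 ≤ x) : (t, ξ - x) ∈ shiftDomain E := by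
  intro l hl
  have := hE _ (hp l hl) x hx
  convert this using 1
  ring

theorem ofReal_mem_shiftDomain (hE : ∀ ξ ∈ E, ∀ x : ℝ, 0 ≤ x → ξ - x ∈ E) {ξ : ℂ} (hξ : ξ ∈ E)
    {t : ℝ} (ht : 0 ≤ t) : ((t : ℂ), ξ) ∈ shiftDomain E := by
  intro l hl
  have := hE _ hξ (l * (t / 2)) (mul_nonneg hl.1 (by positivity))
  push_cast at this
  exact this

end Domain

theorem re_sub_ofReal (ξ : ℂ) (x : ℝ) : (ξ - x).re = ξ.re - x := by simp

theorem re_ray (ξ t : ℂ) (l : ℝ) : (ξ - (1 - l) * (t / 2)).re = ξ.re - (1 - l) * (t.re / 2) := by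
  have : ((1 : ℂ) - l) * (t / 2) = ((1 - l : ℝ) : ℂ) * (t / 2) := by push_cast; ring
  rw [this, Complex.sub_re, Complex.re_ofReal_mul]
  simp

/-- The integral over the half-line from `-∞` to `ξ` is a primitive of the integrand. -/
theorem hasDerivAt_integral_left {E : Set ℂ} (hEo : IsOpen E)
    (hE : ∀ ξ ∈ E, ∀ x : ℝ, 0 ≤ x → ξ - x ∈ E) {g : ℂ → ℂ} {B ρ : ℝ} (hρ : 0 < ρ)
    (hg : DifferentiableOn ℂ g E) (hB : ∀ ξ ∈ E, ‖g ξ‖ ≤ B * decay (1 + ρ) ξ.re)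
    {ξ : ℂ} (hξ : ξ ∈ E) :
    IntegrableOn (fun x : ℝ => g (ξ - x)) (Ioi 0) ∧
      HasDerivAt (fun ξ => ∫ x in Ioi (0 : ℝ), g (ξ - x)) (g ξ) ξ := by
  have hmeas : ∀ w ∈ E, AEStronglyMeasurable (fun x : ℝ => g (w - x))
      (volume.restrict (Ioi 0)) := fun w hw => by
    refine ContinuousOn.aestronglyMeasurable ?_ measurableSet_Ioi
    exact hg.continuousOn.comp (by fun_prop) fun x hx => hE w hw x (le_of_lt hx)
  have hint : Integrable (fun x : ℝ => B * decay (1 + ρ) (ξ.re - x)) (volume.restrict (Ioi 0)) :=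
    (integral_decay hρ ξ.re).1.const_mul B
  have hB0 : 0 ≤ B := by
    have := (norm_nonneg _).trans (hB ξ hξ)
    exact nonneg_of_mul_nonneg_left this (decay_pos _ _)
  have hd : ∀ x : ℝ, 0 ≤ x → HasDerivAt g (deriv g (ξ - x)) (ξ - x) := fun x hx =>
    ((hg _ (hE ξ hξ x hx)).differentiableAt (hEo.mem_nhds (hE ξ hξ x hx))).hasDerivAt
  have hi : IntegrableOn (fun x : ℝ => g (ξ - x)) (Ioi 0) := by
    refine hint.mono' (hmeas ξ hξ) ?_
    filter_upwards [ae_restrict_mem measurableSet_Ioi] with x hx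
    simpa using hB _ (hE ξ hξ x (le_of_lt hx))
  refine ⟨hi, ?_⟩
  obtain ⟨ε, hε, hεE⟩ := Metric.isOpen_iff.1 hEo ξ hξ
  have hPI := hasDerivAt_integral_of_holomorphic (μ := volume.restrict (Ioi (0 : ℝ)))
    (f := fun w x => g (w - x)) (z := ξ) (ε := ε)
    (g := fun x => B * ((1 + ε) ^ (1 + ρ) * decay (1 + ρ) (ξ.re - x))) hε
    (fun w hw => hmeas w (hεE hw)) ?_ ?_ ?_
  · refine hPI.2.congr_deriv ?_
    have hi' := hPI.1
    have hder : ∀ᵐ x : ℝ ∂(volume.restrict (Ioi (0 : ℝ))),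
        deriv (fun w => g (w - x)) ξ = deriv g (ξ - x) := by
      filter_upwards [ae_restrict_mem measurableSet_Ioi] with x hx
      exact deriv_comp_sub_const ..
    rw [integral_congr_ae hder]
    have hFTC := integral_Ioi_of_hasDerivAt_of_tendsto' (a := 0) (m := (0 : ℂ))
      (f := fun x : ℝ => -g (ξ - x)) (f' := fun x : ℝ => deriv g (ξ - x)) ?_ ?_ ?_
    · rw [hFTC]; simp
    · intro x hx
      have h1 : HasDerivAt (fun x : ℝ => ξ - (x : ℂ)) (-1) x :=
        (Complex.ofRealCLM.hasDerivAt (x := x)).const_sub ξ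
      have := ((hd x hx).scomp x h1).neg
      refine this.congr_deriv ?_
      simp
    · exact hi'.congr hder
    · rw [← neg_zero]
      refine Tendsto.neg ?_
      refine squeeze_zero_norm' (a := fun x : ℝ => B * decay (1 + ρ) (ξ.re - x)) ?_ ?_
      · filter_upwards [Ici_mem_atTop 0] with x hx
        simpa using hB _ (hE ξ hξ x hx)
      · have h1 : Tendsto (fun x : ℝ => 1 + |ξ.re - x|) atTop atTop :=
          tendsto_atTop_add_const_left _ _ (tendsto_abs_atBot_atTop.comp
            (tendsto_atBot_add_const_left _ _ tendsto_neg_atTop_atBot))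
        have := ((tendsto_rpow_neg_atTop (by linarith : (0 : ℝ) < 1 + ρ)).comp h1).const_mul B
        simpa [decay, Function.comp_def] using this
  · filter_upwards [ae_restrict_mem measurableSet_Ioi] with x hx w hw
    have h1 := (hg _ (hE w (hεE hw) x (le_of_lt hx))).differentiableAt
      (hEo.mem_nhds (hE w (hεE hw) x (le_of_lt hx)))
    exact (h1.comp w (differentiableAt_id.sub_const _)).differentiableWithinAt
  · exact ((integral_decay hρ ξ.re).1.const_mul _).const_mul B
  · filter_upwards [ae_restrict_mem measurableSet_Ioi] with x hx w hw
    refine (hB _ (hE w (hεE hw) x (le_of_lt hx))).trans ?_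
    gcongr
    refine (decay_le_mul_decay (by linarith) (ξ.re - x) _).trans ?_
    have : |ξ.re - x - (w - x).re| ≤ ε := by
      have h1 : ξ.re - x - (w - x).re = (ξ - w).re := by simp
      rw [h1]
      refine (Complex.abs_re_le_norm _).trans ?_
      rw [← dist_eq_norm, dist_comm]
      exact (Metric.mem_ball.1 hw).le
    have hdp := decay_pos (1 + ρ) (ξ.re - x)
    gcongr

/-- On a set star-shaped about `0`, the integral of a holomorphic function along the segment from
`0` to `t` is a primitive of it. -/
theorem hasDerivAt_integral_segment {S : Set ℂ} (hS : IsOpen S)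
    (hstar : ∀ z ∈ S, ∀ l ∈ Icc (0 : ℝ) 1, (l : ℂ) * z ∈ S) {h : ℂ → ℂ}
    (hh : DifferentiableOn ℂ h S) {t : ℂ} (ht : t ∈ S) :
    HasDerivAt (fun τ => ∫ l in Ioc (0 : ℝ) 1, τ * h (l * τ)) (h t) t := by
  obtain ⟨ε, hε, hεS⟩ := Metric.nhds_basis_closedBall.mem_iff.1 (hS.mem_nhds ht)
  obtain ⟨B, hB⟩ : ∃ B, ∀ p ∈ Icc (0 : ℝ) 1 ×ˢ Metric.closedBall t ε,
      ‖p.2 * h ((p.1 : ℂ) * p.2)‖ ≤ B := by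
    refine (isCompact_Icc.prod (isCompact_closedBall t ε)).exists_bound_of_continuousOn ?_
    refine continuousOn_snd.mul (hh.continuousOn.comp (by fun_prop) fun p hp => ?_)
    exact hstar _ (hεS hp.2) _ hp.1
  have hPI := hasDerivAt_integral_of_holomorphic (μ := volume.restrict (Ioc (0 : ℝ) 1))
    (f := fun τ l => τ * h (l * τ)) (z := t) (ε := ε) (g := fun _ => B) hε ?_ ?_
    (integrable_const _) ?_
  · refine hPI.2.congr_deriv ?_
    have hdh : ∀ l ∈ Icc (0 : ℝ) 1, HasDerivAt h (deriv h (l * t)) (l * t) := fun l hl =>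
      ((hh _ (hstar t ht l hl)).differentiableAt (hS.mem_nhds (hstar t ht l hl))).hasDerivAt
    have hd : ∀ l ∈ Icc (0 : ℝ) 1, deriv (fun τ => τ * h (l * τ)) t =
        h (l * t) + t * (deriv h (l * t) * l) := by
      intro l hl
      have h1 := (hasDerivAt_id t).mul ((hdh l hl).comp t ((hasDerivAt_id t).const_mul (l : ℂ)))
      have h2 := h1.deriv
      simp only [id, one_mul, mul_one] at h2
      exact h2
    have hd2 : ∀ l ∈ uIcc (0 : ℝ) 1, HasDerivAt (fun l : ℝ => (l : ℂ) * h (l * t))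
        (deriv (fun τ => τ * h (l * τ)) t) l := by
      intro l hl
      rw [uIcc_of_le zero_le_one] at hl
      rw [hd l hl]
      have h1 : HasDerivAt (fun l : ℝ => (l : ℂ)) 1 l := Complex.ofRealCLM.hasDerivAt
      have h2 := h1.mul ((hdh l hl).scomp l (h1.mul_const t))
      refine h2.congr_deriv ?_
      simp only [Function.comp, one_mul, smul_eq_mul]
      ring
    have := intervalIntegral.integral_eq_sub_of_hasDerivAt hd2
      ((intervalIntegrable_iff_integrableOn_Ioc_of_le zero_le_one).2 hPI.1)
    rw [intervalIntegral.integral_of_le zero_le_one] at this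
    rw [this]
    simp
  · intro w hw
    refine ContinuousOn.aestronglyMeasurable ?_ measurableSet_Ioc
    refine continuousOn_const.mul (hh.continuousOn.comp (by fun_prop) fun l hl => ?_)
    exact hstar _ (hεS (Metric.ball_subset_closedBall hw)) _ (Ioc_subset_Icc_self hl)
  · filter_upwards [ae_restrict_mem measurableSet_Ioc] with l hl w hw
    have hm := hstar _ (hεS (Metric.ball_subset_closedBall hw)) _ (Ioc_subset_Icc_self hl)
    have h1 := (hh _ hm).differentiableAt (hS.mem_nhds hm)
    exact (differentiableAt_id.mul (h1.comp w
      (differentiableAt_id.const_mul (l : ℂ)))).differentiableWithinAt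
  · filter_upwards [ae_restrict_mem measurableSet_Ioc] with l hl w hw
    exact hB (l, w) ⟨Ioc_subset_Icc_self hl, Metric.ball_subset_closedBall hw⟩

/-! ### The Borel transform as a Neumann series -/

theorem growth_le {σ b : ℝ} (hb : 0 ≤ b) (t : ℂ) : growth σ b t ≤ (σ + 2 * b) * ‖t‖ := by
  have := (abs_le.1 (Complex.abs_re_le_norm t)).1
  unfold growth
  nlinarith

theorem growth_le_of_mem_ball {σ b : ℝ} (hσ : 0 ≤ σ) (hb : 0 ≤ b) {p q : ℂ × ℂ}
    (hq : q ∈ Metric.ball p 1) : growth σ b q.1 ≤ (σ + 2 * b) * (‖p.1‖ + 1) := by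
  refine (growth_le hb _).trans ?_
  gcongr
  have h1 : dist q.1 p.1 < 1 := (le_max_left _ _).trans_lt (Metric.mem_ball.1 hq)
  rw [dist_eq_norm] at h1
  linarith [norm_le_norm_add_norm_sub' q.1 p.1]

section

variable {E : Set ℂ} {φ V : ℂ → ℂ} {C ρ σ b K δ A : ℝ} {M M' : ℝ → ℝ} {f : ℂ → ℂ → ℂ}

theorem LeftData.norm_integrand_le (hL : LeftData E φ V C ρ) {t ξ : ℂ}
    (hA : ∀ ζ, (t, ζ) ∈ shiftDomain E → ‖f t ζ‖ ≤ A * M ζ.re) (hp : (t, ξ) ∈ shiftDomain E) {x : ℝ}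
    (hx : 0 ≤ x) : ‖V (ξ - x) * f t (ξ - x)‖ ≤
      C * A * (decay (1 + ρ) (ξ.re - x) * M (ξ.re - x)) := by
  have hm := shiftDomain_left hL.left hp hx
  have h1 := hL.norm_V_le _ (shiftDomain_snd hm)
  have h2 := hA _ hm
  rw [re_sub_ofReal] at h1 h2
  rw [norm_mul]
  calc _ ≤ (C * decay (1 + ρ) (ξ.re - x)) * (A * M (ξ.re - x)) := by
        gcongr
        exact (norm_nonneg _).trans h1
    _ = _ := by ring

theorem LeftData.norm_source_le (hL : LeftData E φ V C ρ) (hM : IsMajorant C ρ σ b K δ M M')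
    {t ξ : ℂ} (hA0 : 0 ≤ A)
    (hA : ∀ ζ, (t, ζ) ∈ shiftDomain E → ‖f t ζ‖ ≤ A * M ζ.re) (hp : (t, ξ) ∈ shiftDomain E) :
    ‖source φ V f t ξ‖ ≤ A * ((C * decay (1 / 2 + ρ) ξ.re + C * δ) * M ξ.re) := by
  obtain ⟨hi, hle⟩ := hM.integral_le hL.ρ_pos ξ.re
  have hC := hL.C_pos
  have h1 : ‖φ ξ * f t ξ‖ ≤ C * decay (1 / 2 + ρ) ξ.re * (A * M ξ.re) := by
    rw [norm_mul]
    have h2 : ‖φ ξ‖ ≤ C * decay (1 / 2 + ρ) ξ.re := hL.norm_φ_le _ (shiftDomain_snd hp)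
    exact mul_le_mul h2 (hA _ hp) (norm_nonneg _) ((norm_nonneg _).trans h2)
  have h3 : ‖∫ x in Ioi (0 : ℝ), V (ξ - x) * f t (ξ - x)‖ ≤ C * A * (δ * M ξ.re) := by
    refine (norm_integral_le_of_norm_le (hi.const_mul (C * A)) ?_).trans ?_
    · filter_upwards [ae_restrict_mem measurableSet_Ioi] with x hx
      exact hL.norm_integrand_le hA hp (le_of_lt hx)
    · rw [integral_const_mul]
      gcongr
  calc _ ≤ _ := norm_add_le _ _
    _ ≤ _ := add_le_add h1 h3
    _ = _ := by ring

theorem LeftData.aestronglyMeasurable_integrand (hL : LeftData E φ V C ρ)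
    (hf : ContinuousOn (fun p : ℂ × ℂ => f p.1 p.2) (shiftDomain E)) {t ξ : ℂ}
    (hp : (t, ξ) ∈ shiftDomain E) :
    AEStronglyMeasurable (fun x : ℝ => V (ξ - x) * f t (ξ - x)) (volume.restrict (Ioi 0)) := by
  refine ContinuousOn.aestronglyMeasurable ?_ measurableSet_Ioi
  have hm : ∀ x ∈ Ioi (0 : ℝ), (t, ξ - (x : ℂ)) ∈ shiftDomain E := fun x hx =>
    shiftDomain_left hL.left hp (le_of_lt hx)
  refine ContinuousOn.mul ?_ ?_
  · exact hL.differentiableOn_V.continuousOn.comp (by fun_prop) fun x hx => shiftDomain_snd (hm x hx)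
  · exact hf.comp (f := fun x : ℝ => (t, ξ - (x : ℂ))) (by fun_prop) hm

theorem LeftData.analyticOnNhd_source (hL : LeftData E φ V C ρ)
    (hM : IsMajorant C ρ σ b K δ M M') (hσ : 0 ≤ σ) (hA0 : 0 ≤ A)
    (hf : AnalyticOnNhd ℂ (fun p : ℂ × ℂ => f p.1 p.2) (shiftDomain E))
    (hA : ∀ p ∈ shiftDomain E, ‖f p.1 p.2‖ ≤ A * Real.exp (growth σ b p.1) * M p.2.re) :
    AnalyticOnNhd ℂ (fun p : ℂ × ℂ => source φ V f p.1 p.2) (shiftDomain E) := by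
  have hVa := hL.differentiableOn_V.analyticOnNhd hL.isOpen
  have hφa := hL.differentiableOn_φ.analyticOnNhd hL.isOpen
  have hC := hL.C_pos
  have hρ := hL.ρ_pos
  refine AnalyticOnNhd.add (AnalyticOnNhd.mul ?_ hf) ?_
  · exact fun p hp => (hφa _ (shiftDomain_snd hp)).fun_comp analyticAt_snd
  refine analyticOnNhd_integral (isOpen_shiftDomain hL.isOpen) (fun p hp =>
    hL.aestronglyMeasurable_integrand hf.continuousOn hp) ?_ ?_
  · filter_upwards [ae_restrict_mem measurableSet_Ioi] with x hx p hp
    have hm : (p.1, p.2 - (x : ℂ)) ∈ shiftDomain E := shiftDomain_left hL.left hp (le_of_lt hx)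
    refine AnalyticAt.mul ?_ ?_
    · exact (hVa _ (shiftDomain_snd hm)).fun_comp (f := fun p : ℂ × ℂ => p.2 - (x : ℂ))
        (analyticAt_snd.sub analyticAt_const)
    · exact (hf _ hm).fun_comp (f := fun p : ℂ × ℂ => (p.1, p.2 - (x : ℂ)))
        (analyticAt_fst.prod (analyticAt_snd.sub analyticAt_const))
  · intro p hp
    refine ⟨fun x => C * (A * Real.exp ((σ + 2 * b) * (‖p.1‖ + 1))) *
      ((1 + 1) ^ (1 + ρ) * decay (1 + ρ) (p.2.re - x) * (K * 2)), 1, one_pos,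
      (((integral_decay hL.ρ_pos p.2.re).1.const_mul _).mul_const _).const_mul _, ?_⟩
    filter_upwards [ae_restrict_mem measurableSet_Ioi] with x hx q hq
    have hK := hM.K_pos
    refine (hL.norm_integrand_le (A := A * Real.exp (growth σ b q.1)) (M := M)
      (fun ζ hζ => hA _ hζ) hq.2 (le_of_lt hx)).trans ?_
    have hdist : |p.2.re - x - (q.2.re - x)| ≤ 1 := by
      have h1 : p.2.re - x - (q.2.re - x) = (p.2 - q.2).re := by simp
      rw [h1]
      refine (Complex.abs_re_le_norm _).trans ?_
      rw [← dist_eq_norm, dist_comm]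
      exact (le_max_right _ _).trans (Metric.mem_ball.1 hq.1).le
    have hdec : decay (1 + ρ) (q.2.re - x) ≤ (1 + 1) ^ (1 + ρ) * decay (1 + ρ) (p.2.re - x) := by
      refine (decay_le_mul_decay (by linarith) (p.2.re - x) _).trans ?_
      have hdp := decay_pos (1 + ρ) (p.2.re - x)
      gcongr
    have hgr := growth_le_of_mem_ball hσ hM.b_nonneg hq.1
    have hMp := hM.pos hρ (q.2.re - x)
    have hMle := hM.le_const hρ (q.2.re - x)
    have hdp := decay_pos (1 + ρ) (p.2.re - x)
    have hdq := decay_pos (1 + ρ) (q.2.re - x)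
    gcongr

/-- `step` halves the weighted norm. -/
theorem LeftData.norm_step_le (hL : LeftData E φ V C ρ) (hM : IsMajorant C ρ σ b K δ M M')
    (hA0 : 0 ≤ A)
    (hA : ∀ p ∈ shiftDomain E, ‖f p.1 p.2‖ ≤ A * Real.exp (growth σ b p.1) * M p.2.re)
    {p : ℂ × ℂ} (hp : p ∈ shiftDomain E) :
    ‖step φ V f p.1 p.2‖ ≤ A * (1 / 2) * Real.exp (growth σ b p.1) * M p.2.re := by
  obtain ⟨t, ξ⟩ := p
  have hcM := hM.continuous
  have hcd := continuous_decay (1 / 2 + ρ)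
  have h1 : ‖∫ l in Ioc (0 : ℝ) 1, t * source φ V f (l * t) (ξ - (1 - l) * (t / 2))‖ ≤
      A * (Real.exp (growth σ b t) * M ξ.re) := by
    refine (norm_integral_le_of_norm_le (g := fun l : ℝ => A * (‖t‖ *
      (C * decay (1 / 2 + ρ) (ξ.re - (1 - l) * (t.re / 2)) + C * δ) *
        (Real.exp (l * growth σ b t) * M (ξ.re - (1 - l) * (t.re / 2))))) ?_ ?_).trans ?_
    · exact (Continuous.integrableOn_Icc (by fun_prop)).mono_set Ioc_subset_Icc_self
    · filter_upwards [ae_restrict_mem measurableSet_Ioc] with l hl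
      have hl' := Ioc_subset_Icc_self hl
      have := hL.norm_source_le hM (f := f) (A := A * Real.exp (growth σ b (l * t)))
        (by positivity) (fun ζ hζ => hA _ hζ) (shiftDomain_ray hp hl')
      rw [re_ray, growth_smul σ b hl'.1] at this
      rw [norm_mul]
      calc _ ≤ ‖t‖ * _ := mul_le_mul_of_nonneg_left this (norm_nonneg t)
        _ = _ := by ring
    · rw [integral_const_mul, ← intervalIntegral.integral_of_le zero_le_one]
      gcongr
      exact hM.integral_ray_le hL.ρ_pos ξ.re t
  rw [step, norm_mul]
  calc _ ≤ ‖(-(1 / 2) : ℂ)‖ * (A * (Real.exp (growth σ b t) * M ξ.re)) := by gcongr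
    _ = _ := by norm_num; ring

theorem LeftData.norm_ray_source_le (hL : LeftData E φ V C ρ)
    (hM : IsMajorant C ρ σ b K δ M M') (hσ : 0 ≤ σ) (hA0 : 0 ≤ A)
    (hA : ∀ p ∈ shiftDomain E, ‖f p.1 p.2‖ ≤ A * Real.exp (growth σ b p.1) * M p.2.re)
    {t ξ : ℂ} (hp : (t, ξ) ∈ shiftDomain E) {l : ℝ} (hl : l ∈ Icc (0 : ℝ) 1) :
    ‖t * source φ V f (l * t) (ξ - (1 - l) * (t / 2))‖ ≤
      A * (‖t‖ * Real.exp (growth σ b t) * ((C * 1 + C * δ) * (K * 2))) := by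
  have hC := hL.C_pos
  have hρ := hL.ρ_pos
  have hK := hM.K_pos
  have hδ := hM.δ_pos
  have h1 := hL.norm_source_le hM (f := f) (A := A * Real.exp (growth σ b (l * t)))
    (by positivity) (fun ζ hζ => hA _ hζ) (shiftDomain_ray hp hl)
  rw [growth_smul σ b hl.1] at h1
  have h0 := growth_nonneg hσ hM.b_nonneg t
  have h2 : l * growth σ b t ≤ growth σ b t := mul_le_of_le_one_left h0 hl.2
  have hd1 := decay_le_one (by linarith : 0 ≤ 1 / 2 + ρ) (ξ - (1 - l) * (t / 2)).re
  have hd0 := decay_pos (1 / 2 + ρ) (ξ - (1 - l) * (t / 2)).re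
  have hM1 := hM.le_const hρ (ξ - (1 - l) * (t / 2)).re
  have hM0 := hM.pos hρ (ξ - (1 - l) * (t / 2)).re
  rw [norm_mul]
  calc _ ≤ ‖t‖ * _ := mul_le_mul_of_nonneg_left h1 (norm_nonneg t)
    _ ≤ ‖t‖ * (A * Real.exp (growth σ b t) * ((C * 1 + C * δ) * (K * 2))) := by gcongr
    _ = _ := by ring

theorem LeftData.analyticOnNhd_step (hL : LeftData E φ V C ρ)
    (hM : IsMajorant C ρ σ b K δ M M') (hσ : 0 ≤ σ) (hA0 : 0 ≤ A)
    (hf : AnalyticOnNhd ℂ (fun p : ℂ × ℂ => f p.1 p.2) (shiftDomain E))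
    (hA : ∀ p ∈ shiftDomain E, ‖f p.1 p.2‖ ≤ A * Real.exp (growth σ b p.1) * M p.2.re) :
    AnalyticOnNhd ℂ (fun p : ℂ × ℂ => step φ V f p.1 p.2) (shiftDomain E) := by
  have hs := hL.analyticOnNhd_source hM hσ hA0 hf hA
  have hC := hL.C_pos
  have hK := hM.K_pos
  have hδ := hM.δ_pos
  refine analyticOnNhd_const.mul (analyticOnNhd_integral (isOpen_shiftDomain hL.isOpen) ?_ ?_ ?_)
  · intro p hp
    refine ContinuousOn.aestronglyMeasurable (continuousOn_const.mul ?_) measurableSet_Ioc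
    exact hs.continuousOn.comp
      (f := fun l : ℝ => ((l : ℂ) * p.1, p.2 - (1 - (l : ℂ)) * (p.1 / 2))) (by fun_prop)
      fun l hl => shiftDomain_ray hp (Ioc_subset_Icc_self hl)
  · filter_upwards [ae_restrict_mem measurableSet_Ioc] with l hl p hp
    refine analyticAt_fst.mul ((hs _ (shiftDomain_ray hp (Ioc_subset_Icc_self hl))).fun_comp
      (f := fun p : ℂ × ℂ => ((l : ℂ) * p.1, p.2 - (1 - (l : ℂ)) * (p.1 / 2))) ?_)
    exact (analyticAt_const.mul analyticAt_fst).prod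
      (analyticAt_snd.sub (analyticAt_const.mul (analyticAt_fst.div_const)))
  · intro p hp
    refine ⟨fun _ => A * ((‖p.1‖ + 1) * Real.exp ((σ + 2 * b) * (‖p.1‖ + 1)) *
      ((C * 1 + C * δ) * (K * 2))), 1, one_pos, integrable_const _, ?_⟩
    filter_upwards [ae_restrict_mem measurableSet_Ioc] with l hl q hq
    refine (hL.norm_ray_source_le hM hσ hA0 hA hq.2 (Ioc_subset_Icc_self hl)).trans ?_
    have hgr := growth_le_of_mem_ball hσ hM.b_nonneg hq.1
    have hn : ‖q.1‖ ≤ ‖p.1‖ + 1 := by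
      have h1 : dist q.1 p.1 < 1 := (le_max_left _ _).trans_lt (Metric.mem_ball.1 hq.1)
      rw [dist_eq_norm] at h1
      linarith [norm_le_norm_add_norm_sub' q.1 p.1]
    gcongr

theorem LeftData.differentiableOn_firstCoeff (hL : LeftData E φ V C ρ) :
    DifferentiableOn ℂ (firstCoeff φ V) E := fun ξ hξ =>
  ((hL.differentiableOn_φ ξ hξ).const_mul _).sub
    (((hasDerivAt_integral_left hL.isOpen hL.left hL.ρ_pos hL.differentiableOn_V hL.norm_V_le
      hξ).2.differentiableAt.differentiableWithinAt).const_mul _)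

theorem LeftData.norm_firstCoeff_le (hL : LeftData E φ V C ρ)
    (hM : IsMajorant C ρ σ b K δ M M') {ξ : ℂ} (hξ : ξ ∈ E) :
    ‖firstCoeff φ V ξ‖ ≤ (C + C / ρ) * M ξ.re := by
  have hC := hL.C_pos
  have hρ := hL.ρ_pos
  obtain ⟨hi, he⟩ := integral_decay hρ ξ.re
  have h1 : ‖φ ξ‖ ≤ C * M ξ.re := (hL.norm_φ_le ξ hξ).trans (by
    gcongr
    exact (decay_anti (by linarith) _).trans ((decay_le_ramp hρ.le _).trans (hM.ramp_le _)))
  have h2 : ‖∫ x in Ioi (0 : ℝ), V (ξ - x)‖ ≤ C / ρ * M ξ.re := by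
    refine (norm_integral_le_of_norm_le (hi.const_mul C) ?_).trans ?_
    · filter_upwards [ae_restrict_mem measurableSet_Ioi] with x hx
      simpa using hL.norm_V_le _ (hL.left ξ hξ x (le_of_lt hx))
    · rw [integral_const_mul, he]
      calc C * (ramp ρ ξ.re / ρ) = C / ρ * ramp ρ ξ.re := by ring
        _ ≤ _ := by gcongr; exact hM.ramp_le _
  have h3 : ‖firstCoeff φ V ξ‖ ≤ 1 / 2 * ‖φ ξ‖ + 1 / 2 * ‖∫ x in Ioi (0 : ℝ), V (ξ - x)‖ := by
    unfold firstCoeff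
    refine (norm_sub_le _ _).trans (le_of_eq ?_)
    rw [norm_mul, norm_mul]
    norm_num
  have : 0 ≤ (C + C / ρ) * M ξ.re := by
    have := hM.pos hρ ξ.re
    positivity
  linarith

theorem LeftData.iterates_spec (hL : LeftData E φ V C ρ) (hM : IsMajorant C ρ σ b K δ M M')
    (hσ : 0 ≤ σ) (k : ℕ) :
    AnalyticOnNhd ℂ (fun p : ℂ × ℂ => iterates φ V k p.1 p.2) (shiftDomain E) ∧
      ∀ p ∈ shiftDomain E, ‖iterates φ V k p.1 p.2‖ ≤
        (C + C / ρ) * (1 / 2) ^ k * Real.exp (growth σ b p.1) * M p.2.re := by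
  have hC := hL.C_pos
  have hρ := hL.ρ_pos
  induction k with
  | zero =>
    refine ⟨fun p hp => ?_, fun p hp => ?_⟩
    · exact ((hL.differentiableOn_firstCoeff.analyticOnNhd hL.isOpen) _
        (shiftDomain_shift hp)).fun_comp (f := fun p : ℂ × ℂ => p.2 - p.1 / 2)
        (analyticAt_snd.sub analyticAt_fst.div_const)
    · refine (hL.norm_firstCoeff_le hM (shiftDomain_shift hp)).trans ?_
      have := hM.ray_le hC.le hρ p.2.re p.1 (zero_le_one)
      simp only [zero_mul, Real.exp_zero, one_mul, sub_zero] at this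
      have h2 : (p.2 - p.1 / 2).re = p.2.re - p.1.re / 2 := by simp
      rw [h2, pow_zero, mul_one, mul_assoc]
      gcongr
  | succ k ih =>
    have hA0 : 0 ≤ (C + C / ρ) * (1 / 2) ^ k := by positivity
    refine ⟨hL.analyticOnNhd_step hM hσ hA0 ih.1 ih.2, fun p hp => ?_⟩
    have := hL.norm_step_le hM hA0 ih.2 hp
    rwa [mul_assoc (C + C / ρ), ← pow_succ] at this

theorem LeftData.hasSum_iterates (hL : LeftData E φ V C ρ) (hM : IsMajorant C ρ σ b K δ M M')
    (hσ : 0 ≤ σ) {p : ℂ × ℂ} (hp : p ∈ shiftDomain E) :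
    HasSum (fun k => iterates φ V k p.1 p.2) (borel φ V p.1 p.2) := by
  refine Summable.hasSum (Summable.of_norm_bounded
    (g := fun k => (C + C / ρ) * (1 / 2) ^ k * Real.exp (growth σ b p.1) * M p.2.re) ?_
    fun k => (hL.iterates_spec hM hσ k).2 p hp)
  exact ((summable_geometric_two.mul_left _).mul_right _).mul_right _

theorem LeftData.norm_borel_le (hL : LeftData E φ V C ρ) (hM : IsMajorant C ρ σ b K δ M M')
    (hσ : 0 ≤ σ) {p : ℂ × ℂ} (hp : p ∈ shiftDomain E) :
    ‖borel φ V p.1 p.2‖ ≤ (C + C / ρ) * 2 * Real.exp (growth σ b p.1) * M p.2.re :=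
  tsum_of_norm_bounded (((hasSum_geometric_two.mul_left _).mul_right _).mul_right _)
    fun k => (hL.iterates_spec hM hσ k).2 p hp

theorem LeftData.analyticOnNhd_borel (hL : LeftData E φ V C ρ)
    (hM : IsMajorant C ρ σ b K δ M M') (hσ : 0 ≤ σ) :
    AnalyticOnNhd ℂ (fun p : ℂ × ℂ => borel φ V p.1 p.2) (shiftDomain E) := by
  have hC := hL.C_pos
  have hρ := hL.ρ_pos
  have hK := hM.K_pos
  refine analyticOnNhd_tsum (isOpen_shiftDomain hL.isOpen)
    (fun k => (hL.iterates_spec hM hσ k).1) fun p hp =>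
    ⟨fun k => (C + C / ρ) * (1 / 2) ^ k * Real.exp ((σ + 2 * b) * (‖p.1‖ + 1)) * (K * 2),
      ((summable_geometric_two.mul_left _).mul_right _).mul_right _, ?_⟩
  filter_upwards [Metric.ball_mem_nhds p one_pos,
    (isOpen_shiftDomain hL.isOpen).mem_nhds hp] with q hq hqD k
  refine ((hL.iterates_spec hM hσ k).2 q hqD).trans ?_
  have hgr := growth_le_of_mem_ball hσ hM.b_nonneg hq
  have hM1 := hM.le_const hρ q.2.re
  have hM0 := hM.pos hρ q.2.re
  gcongr

theorem LeftData.hasSum_source (hL : LeftData E φ V C ρ)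
    (hM : IsMajorant C ρ σ b K δ M M') (hσ : 0 ≤ σ) {p : ℂ × ℂ} (hp : p ∈ shiftDomain E) :
    HasSum (fun k => source φ V (iterates φ V k) p.1 p.2)
      (source φ V (borel φ V) p.1 p.2) := by
  refine ((hL.hasSum_iterates hM hσ hp).mul_left (φ p.2)).add ?_
  have h := hasSum_integral_of_geometric (μ := volume.restrict (Ioi (0 : ℝ)))
    (f := fun k x => V (p.2 - x) * iterates φ V k p.1 (p.2 - x))
    (g := fun x => C * (C + C / ρ) * Real.exp (growth σ b p.1) *
      (decay (1 + ρ) (p.2.re - x) * M (p.2.re - x)))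
    (fun k => hL.aestronglyMeasurable_integrand (hL.iterates_spec hM hσ k).1.continuousOn hp)
    ((hM.integral_le hL.ρ_pos p.2.re).1.const_mul _) fun k => by
      filter_upwards [ae_restrict_mem measurableSet_Ioi] with x hx
      refine (hL.norm_integrand_le (M := M)
        (A := (C + C / ρ) * (1 / 2) ^ k * Real.exp (growth σ b p.1))
        (fun ζ hζ => (hL.iterates_spec hM hσ k).2 (p.1, ζ) hζ) hp (le_of_lt hx)).trans (le_of_eq ?_)
      ring
  have e : ∫ x in Ioi (0 : ℝ), V (p.2 - x) * borel φ V p.1 (p.2 - x) =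
      ∫ x in Ioi (0 : ℝ), ∑' k, V (p.2 - x) * iterates φ V k p.1 (p.2 - x) := by
    refine setIntegral_congr_fun measurableSet_Ioi fun x hx => ?_
    exact ((hL.hasSum_iterates hM hσ (shiftDomain_left hL.left hp (le_of_lt hx))).mul_left
      (V (p.2 - x))).tsum_eq.symm
  rw [e]
  exact h

/-- The Neumann series solves the integrated transport equation. -/
theorem LeftData.borel_eq (hL : LeftData E φ V C ρ)
    (hM : IsMajorant C ρ σ b K δ M M') (hσ : 0 ≤ σ) {p : ℂ × ℂ} (hp : p ∈ shiftDomain E) :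
    borel φ V p.1 p.2 = firstCoeff φ V (p.2 - p.1 / 2) + step φ V (borel φ V) p.1 p.2 := by
  have hC := hL.C_pos
  have hρ := hL.ρ_pos
  have h1 : HasSum (fun k => step φ V (iterates φ V k) p.1 p.2)
      (step φ V (borel φ V) p.1 p.2) := by
    have h := hasSum_integral_of_geometric (μ := volume.restrict (Ioc (0 : ℝ) 1))
      (f := fun k l => p.1 * source φ V (iterates φ V k) (l * p.1)
        (p.2 - (1 - l) * (p.1 / 2)))
      (g := fun l => (C + C / ρ) *
        (‖p.1‖ * Real.exp (growth σ b p.1) * ((C * 1 + C * δ) * (K * 2))))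
      (fun k => by
        have hs := hL.analyticOnNhd_source hM hσ (A := (C + C / ρ) * (1 / 2) ^ k) (by positivity) (hL.iterates_spec hM hσ k).1
          (hL.iterates_spec hM hσ k).2
        refine ContinuousOn.aestronglyMeasurable (continuousOn_const.mul ?_) measurableSet_Ioc
        exact hs.continuousOn.comp
          (f := fun l : ℝ => ((l : ℂ) * p.1, p.2 - (1 - (l : ℂ)) * (p.1 / 2))) (by fun_prop)
          fun l hl => shiftDomain_ray hp (Ioc_subset_Icc_self hl))
      (integrable_const _) fun k => by
        filter_upwards [ae_restrict_mem measurableSet_Ioc] with l hl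
        refine (hL.norm_ray_source_le hM hσ (by positivity) (hL.iterates_spec hM hσ k).2 hp
          (Ioc_subset_Icc_self hl)).trans (le_of_eq ?_)
        ring
    refine HasSum.mul_left (-(1 / 2) : ℂ) ?_
    have e : ∫ l in Ioc (0 : ℝ) 1, p.1 * source φ V (borel φ V) (l * p.1)
          (p.2 - (1 - l) * (p.1 / 2)) =
        ∫ l in Ioc (0 : ℝ) 1, ∑' k, p.1 * source φ V (iterates φ V k) (l * p.1)
          (p.2 - (1 - l) * (p.1 / 2)) := by
      refine setIntegral_congr_fun measurableSet_Ioc fun l hl => ?_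
      exact ((hL.hasSum_source hM hσ (shiftDomain_ray hp
        (Ioc_subset_Icc_self hl))).mul_left p.1).tsum_eq.symm
    rw [e]
    exact h
  have h2 := hL.hasSum_iterates hM hσ hp
  have h3 := (hasSum_nat_add_iff' 1).2 h2
  have h4 := h3.unique h1
  rw [Finset.sum_range_one] at h4
  rw [← h4]
  exact (add_sub_cancel _ _).symm

/-- The transport equation satisfied by the Borel transform. -/
theorem LeftData.transport_borel (hL : LeftData E φ V C ρ)
    (hM : IsMajorant C ρ σ b K δ M M') (hσ : 0 ≤ σ) {t ξ : ℂ} (hp : (t, ξ) ∈ shiftDomain E) :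
    2 * deriv (fun τ => borel φ V τ ξ) t + deriv (borel φ V t) ξ =
      -source φ V (borel φ V) t ξ := by
  have hC := hL.C_pos
  have hρ := hL.ρ_pos
  have hF := hL.analyticOnNhd_borel hM hσ
  have hs := hL.analyticOnNhd_source (A := (C + C / ρ) * 2) hM hσ (by positivity) hF
    (fun p hp => hL.norm_borel_le hM hσ hp)
  have hd : HasFDerivAt (fun p : ℂ × ℂ => borel φ V p.1 p.2)
    (fderiv ℂ (fun p : ℂ × ℂ => borel φ V p.1 p.2) (t, ξ)) (t, ξ) :=
    (hF _ hp).differentiableAt.hasFDerivAt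
  set L := fderiv ℂ (fun p : ℂ × ℂ => borel φ V p.1 p.2) (t, ξ)
  have h1 : HasDerivAt (fun τ => borel φ V τ ξ) (L (1, 0)) t :=
    hd.comp_hasDerivAt (f := fun τ => (τ, ξ)) t ((hasDerivAt_id t).prodMk (hasDerivAt_const t ξ))
  have h2 : HasDerivAt (borel φ V t) (L (0, 1)) ξ :=
    hd.comp_hasDerivAt (f := fun z => (t, z)) ξ ((hasDerivAt_const ξ t).prodMk (hasDerivAt_id ξ))
  rw [h1.deriv, h2.deriv]
  -- along the characteristic `ξ - t / 2 = ζ` the equation is an ordinary differential equation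
  set ζ := ξ - t / 2 with hζ
  have hline : ∀ τ : ℂ, HasDerivAt (fun τ : ℂ => (τ, ζ + τ / 2)) (1, 1 / 2) τ := fun τ =>
    (hasDerivAt_id τ).prodMk (((hasDerivAt_id τ).div_const 2).const_add ζ)
  have hpt : (t, ζ + t / 2) = (t, ξ) := by rw [hζ, sub_add_cancel]
  let S : Set ℂ := (fun τ : ℂ => (τ, ζ + τ / 2)) ⁻¹' shiftDomain E
  have hSo : IsOpen S := (isOpen_shiftDomain hL.isOpen).preimage (by fun_prop)
  have htS : t ∈ S := by
    change (t, ζ + t / 2) ∈ shiftDomain E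
    rwa [hpt]
  have hray : ∀ (l : ℝ) (τ : ℂ), ζ + τ / 2 - (1 - l) * (τ / 2) = ζ + l * τ / 2 := fun l τ => by
    ring
  have hstar : ∀ z ∈ S, ∀ l ∈ Icc (0 : ℝ) 1, (l : ℂ) * z ∈ S := fun z hz l hl => by
    have := shiftDomain_ray hz hl
    rwa [hray] at this
  have hh : DifferentiableOn ℂ (fun τ => source φ V (borel φ V) τ (ζ + τ / 2)) S := fun τ hτ =>
    (DifferentiableAt.fun_comp' (g := fun p : ℂ × ℂ => source φ V (borel φ V) p.1 p.2) τ
      (hs _ hτ).differentiableAt (hline τ).differentiableAt).differentiableWithinAt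
  have h3 := ((hasDerivAt_integral_segment hSo hstar hh htS).const_mul (-(1 / 2) : ℂ)).const_add
    (firstCoeff φ V ζ)
  have h4 : HasDerivAt (fun τ => borel φ V τ (ζ + τ / 2)) (L (1, 1 / 2)) t := by
    have hd' := hd
    rw [← hpt] at hd'
    exact hd'.comp_hasDerivAt (f := fun τ => (τ, ζ + τ / 2)) t (hline t)
  have h5 : (fun τ => borel φ V τ (ζ + τ / 2)) =ᶠ[𝓝 t] fun τ => firstCoeff φ V ζ +
      -(1 / 2) * ∫ l in Ioc (0 : ℝ) 1, τ * source φ V (borel φ V) (l * τ) (ζ + l * τ / 2) := by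
    filter_upwards [hSo.mem_nhds htS] with τ hτ
    have := hL.borel_eq hM hσ hτ
    simp only [step, add_sub_cancel_right, hray] at this
    exact this
  have h6 := h4.unique (h3.congr_of_eventuallyEq h5)
  have h7 : L (1, 1 / 2) = L (1, 0) + 1 / 2 * L (0, 1) := by
    have : ((1 : ℂ), (1 / 2 : ℂ)) = (1, 0) + (1 / 2 : ℂ) • (0, 1) := by simp
    rw [this, map_add, map_smul, smul_eq_mul]
  rw [h7] at h6
  have h8 : ζ + t / 2 = ξ := by rw [hζ, sub_add_cancel]
  rw [h8] at h6
  linear_combination 2 * h6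

end

/-! ### Taylor coefficients of the Borel transform -/

/-- `G` is an analytic solution of `2 G_t + G_ξ = -source G` on `shiftDomain E`, bounded along left
half-lines locally uniformly in `t`. -/
structure IsTransportSolution (E : Set ℂ) (φ V : ℂ → ℂ) (G : ℂ → ℂ → ℂ) : Prop where
  analyticOnNhd : AnalyticOnNhd ℂ (fun p : ℂ × ℂ => G p.1 p.2) (shiftDomain E)
  bounded : ∀ t ξ, (t, ξ) ∈ shiftDomain E → ∃ ε > 0, ∃ B : ℝ, ∀ τ ∈ Metric.ball t ε,
    ∀ x : ℝ, 0 ≤ x → (τ, ξ - (x : ℂ)) ∈ shiftDomain E ∧ ‖G τ (ξ - x)‖ ≤ B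
  transport : ∀ t ξ, (t, ξ) ∈ shiftDomain E →
    2 * deriv (fun τ => G τ ξ) t + deriv (G t) ξ = -source φ V G t ξ

section

variable {E : Set ℂ} {φ V : ℂ → ℂ} {C ρ σ b K δ : ℝ} {M M' : ℝ → ℝ} {G : ℂ → ℂ → ℂ}

theorem LeftData.isTransportSolution_borel (hL : LeftData E φ V C ρ) :
    IsTransportSolution E φ V (borel φ V) := by
  obtain ⟨b, K, δ, M, M', hM⟩ := exists_isMajorant hL.C_pos hL.ρ_pos one_pos
  have hC := hL.C_pos
  have hρ := hL.ρ_pos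
  have hK := hM.K_pos
  have hb := hM.b_nonneg
  refine ⟨hL.analyticOnNhd_borel hM zero_le_one, fun t ξ hp => ?_,
    fun t ξ hp => hL.transport_borel hM zero_le_one hp⟩
  obtain ⟨ε, hε, hεD⟩ := Metric.isOpen_iff.1 (isOpen_shiftDomain hL.isOpen) _ hp
  refine ⟨min ε 1, by positivity,
    (C + C / ρ) * 2 * Real.exp ((1 + 2 * b) * (‖t‖ + 1)) * (K * 2), fun τ hτ x hx => ?_⟩
  have hτε : (τ, ξ) ∈ Metric.ball (t, ξ) ε := by
    rw [← ball_prod_same]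
    exact ⟨Metric.ball_subset_ball (min_le_left _ _) hτ, Metric.mem_ball_self hε⟩
  have hτ1 : (τ, ξ) ∈ Metric.ball (t, ξ) 1 := by
    rw [← ball_prod_same]
    exact ⟨Metric.ball_subset_ball (min_le_right _ _) hτ, Metric.mem_ball_self one_pos⟩
  have hm := shiftDomain_left hL.left (hεD hτε) hx
  refine ⟨hm, (hL.norm_borel_le hM zero_le_one hm).trans ?_⟩
  have h1 := growth_le_of_mem_ball (σ := 1) zero_le_one hb hτ1
  have h2 := hM.le_const hρ (ξ - x).re
  have h3 := hM.pos hρ (ξ - x).re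
  dsimp only at h1 ⊢
  gcongr

theorem IsTransportSolution.hasDerivAt_fst (hG : IsTransportSolution E φ V G) {t ξ : ℂ}
    (hp : (t, ξ) ∈ shiftDomain E) : HasDerivAt (fun τ => G τ ξ)
      (fderiv ℂ (fun p : ℂ × ℂ => G p.1 p.2) (t, ξ) (1, 0)) t :=
  (hG.analyticOnNhd _ hp).differentiableAt.hasFDerivAt.comp_hasDerivAt (f := fun τ => (τ, ξ)) t
    ((hasDerivAt_id t).prodMk (hasDerivAt_const t ξ))

theorem IsTransportSolution.hasDerivAt_snd (hG : IsTransportSolution E φ V G) {t ξ : ℂ}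
    (hp : (t, ξ) ∈ shiftDomain E) : HasDerivAt (G t)
      (fderiv ℂ (fun p : ℂ × ℂ => G p.1 p.2) (t, ξ) (0, 1)) ξ :=
  (hG.analyticOnNhd _ hp).differentiableAt.hasFDerivAt.comp_hasDerivAt (f := fun z => (t, z)) ξ
    ((hasDerivAt_const ξ t).prodMk (hasDerivAt_id ξ))

theorem IsTransportSolution.hasDerivAt_source (hL : LeftData E φ V C ρ)
    (hG : IsTransportSolution E φ V G) {t ξ : ℂ} (hp : (t, ξ) ∈ shiftDomain E) :
    HasDerivAt (fun τ => source φ V G τ ξ)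
      (source φ V (fun t ξ => deriv (fun τ => G τ ξ) t) t ξ) t := by
  obtain ⟨ε, hε, B, hB⟩ := hG.bounded t ξ hp
  refine ((hG.hasDerivAt_fst hp).differentiableAt.hasDerivAt.const_mul (φ ξ)).add ?_
  have hPI := (hasDerivAt_integral_of_holomorphic (μ := volume.restrict (Ioi (0 : ℝ)))
    (f := fun τ x => V (ξ - x) * G τ (ξ - x)) (z := t) (ε := ε)
    (g := fun x => C * decay (1 + ρ) (ξ.re - x) * B) hε ?_ ?_
    (((integral_decay hL.ρ_pos ξ.re).1.const_mul C).mul_const B) ?_).2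
  · simpa only [deriv_const_mul_field] using hPI
  · intro w hw
    exact hL.aestronglyMeasurable_integrand hG.analyticOnNhd.continuousOn
      (by simpa using (hB w hw 0 le_rfl).1)
  · filter_upwards [ae_restrict_mem measurableSet_Ioi] with x hx w hw
    exact ((hG.hasDerivAt_fst (hB w hw x (le_of_lt hx)).1).differentiableAt.const_mul
      _).differentiableWithinAt
  · filter_upwards [ae_restrict_mem measurableSet_Ioi] with x hx w hw
    obtain ⟨hm, hb⟩ := hB w hw x (le_of_lt hx)
    have h1 := hL.norm_V_le _ (shiftDomain_snd hm)
    rw [re_sub_ofReal] at h1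
    rw [norm_mul]
    exact mul_le_mul h1 hb (norm_nonneg _) ((norm_nonneg _).trans h1)

/-- Neither the transport operator nor the source depends explicitly on `t`, so the `t`-derivative
of a solution is again a solution. -/
theorem IsTransportSolution.deriv_fst (hL : LeftData E φ V C ρ)
    (hG : IsTransportSolution E φ V G) :
    IsTransportSolution E φ V (fun t ξ => deriv (fun τ => G τ ξ) t) := by
  have hDo := isOpen_shiftDomain hL.isOpen
  set u : ℂ × ℂ → ℂ := fun p => G p.1 p.2 with hu
  have hfst : ∀ p ∈ shiftDomain E, fderiv ℂ u p (1, 0) = deriv (fun τ => G τ p.2) p.1 :=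
    fun p hp => (hG.hasDerivAt_fst hp).deriv.symm
  refine ⟨?_, ?_, ?_⟩
  · have h1 : AnalyticOnNhd ℂ (fun p => fderiv ℂ u p (1, 0)) (shiftDomain E) := fun p hp =>
      (ContinuousLinearMap.analyticAt (ContinuousLinearMap.apply ℂ ℂ ((1 : ℂ), (0 : ℂ)))
        _).fun_comp (hG.analyticOnNhd p hp).fderiv
    exact h1.congr hDo hfst
  · intro t ξ hp
    obtain ⟨ε, hε, B, hB⟩ := hG.bounded t ξ hp
    refine ⟨ε / 2, by positivity, B / (ε / 4), fun τ hτ x hx => ?_⟩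
    have hsub : Metric.closedBall τ (ε / 4) ⊆ Metric.ball t ε := by
      intro v hv
      rw [Metric.mem_ball] at hτ ⊢
      rw [Metric.mem_closedBall] at hv
      linarith [dist_triangle v τ t]
    have hτ' := Metric.ball_subset_ball (by linarith : ε / 2 ≤ ε) hτ
    refine ⟨(hB τ hτ' x hx).1, Complex.norm_deriv_le_of_forall_mem_sphere_norm_le
      (by positivity) (DifferentiableOn.diffContOnCl_ball (U := Metric.closedBall τ (ε / 4))
        (fun v hv => ?_) le_rfl) fun v hv => ?_⟩
    · exact (hG.hasDerivAt_fst (hB v (hsub hv) x hx).1).differentiableAt.differentiableWithinAt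
    · exact (hB v (hsub (Metric.sphere_subset_closedBall hv)) x hx).2
  · intro t ξ hp
    have hu2 : HasFDerivAt (fderiv ℂ u) (fderiv ℂ (fderiv ℂ u) (t, ξ)) (t, ξ) :=
      (hG.analyticOnNhd _ hp).fderiv.differentiableAt.hasFDerivAt
    have hsymm : IsSymmSndFDerivAt ℂ u (t, ξ) :=
      (hG.analyticOnNhd _ hp).contDiffAt.isSymmSndFDerivAt (n := ⊤) le_top
    have happ : ∀ v : ℂ × ℂ, HasFDerivAt (fun p => fderiv ℂ u p v)
        ((ContinuousLinearMap.apply ℂ ℂ v).comp (fderiv ℂ (fderiv ℂ u) (t, ξ))) (t, ξ) :=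
      fun v => (ContinuousLinearMap.apply ℂ ℂ v).hasFDerivAt.comp (t, ξ) hu2
    -- mixed partial derivatives
    have h1 : HasDerivAt (fun τ => fderiv ℂ u (τ, ξ) (0, 1))
        (fderiv ℂ (fderiv ℂ u) (t, ξ) (1, 0) (0, 1)) t :=
      (happ (0, 1)).comp_hasDerivAt (f := fun τ => (τ, ξ)) t
        ((hasDerivAt_id t).prodMk (hasDerivAt_const t ξ))
    have h2 : HasDerivAt (fun z => fderiv ℂ u (t, z) (1, 0))
        (fderiv ℂ (fderiv ℂ u) (t, ξ) (0, 1) (1, 0)) ξ :=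
      (happ (1, 0)).comp_hasDerivAt (f := fun z => (t, z)) ξ
        ((hasDerivAt_const ξ t).prodMk (hasDerivAt_id ξ))
    have h3 : HasDerivAt (fun τ => fderiv ℂ u (τ, ξ) (1, 0))
        (fderiv ℂ (fderiv ℂ u) (t, ξ) (1, 0) (1, 0)) t :=
      (happ (1, 0)).comp_hasDerivAt (f := fun τ => (τ, ξ)) t
        ((hasDerivAt_id t).prodMk (hasDerivAt_const t ξ))
    have hnt : ∀ᶠ τ in 𝓝 t, (τ, ξ) ∈ shiftDomain E :=
      (Continuous.prodMk_left ξ).continuousAt.eventually (hDo.mem_nhds hp)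
    have hnξ : ∀ᶠ z in 𝓝 ξ, (t, z) ∈ shiftDomain E :=
      (Continuous.prodMk_right t).continuousAt.eventually (hDo.mem_nhds hp)
    have e2 : deriv (fun z => deriv (fun τ => G τ z) t) ξ =
        fderiv ℂ (fderiv ℂ u) (t, ξ) (0, 1) (1, 0) := by
      refine (h2.congr_of_eventuallyEq ?_).deriv
      filter_upwards [hnξ] with z hz using (hfst _ hz).symm
    have e3 : deriv (fun τ => deriv (fun τ => G τ ξ) τ) t =
        fderiv ℂ (fderiv ℂ u) (t, ξ) (1, 0) (1, 0) := by
      refine (h3.congr_of_eventuallyEq ?_).deriv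
      filter_upwards [hnt] with z hz using (hfst _ hz).symm
    have h4 := ((h3.const_mul 2).add h1)
    have h5 : (fun τ => 2 * fderiv ℂ u (τ, ξ) (1, 0) + fderiv ℂ u (τ, ξ) (0, 1)) =ᶠ[𝓝 t]
        fun τ => -source φ V G τ ξ := by
      filter_upwards [hnt] with τ hτ
      rw [← hG.transport τ ξ hτ, (hG.hasDerivAt_fst hτ).deriv, (hG.hasDerivAt_snd hτ).deriv]
    have h6 := h4.unique ((hG.hasDerivAt_source hL hp).neg.congr_of_eventuallyEq h5)
    rw [e2, e3, ← h6, hsymm.eq (0, 1) (1, 0)]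

theorem LeftData.isTransportSolution_iteratedDeriv (hL : LeftData E φ V C ρ) (n : ℕ) :
    IsTransportSolution E φ V (fun t ξ => iteratedDeriv n (fun τ => borel φ V τ ξ) t) := by
  induction n with
  | zero => simpa only [iteratedDeriv_zero] using hL.isTransportSolution_borel
  | succ n ih => simpa only [iteratedDeriv_succ] using ih.deriv_fst hL

theorem LeftData.borel_zero (hL : LeftData E φ V C ρ) {ξ : ℂ} (hξ : ξ ∈ E) :
    borel φ V 0 ξ = firstCoeff φ V ξ := by
  obtain ⟨b, K, δ, M, M', hM⟩ := exists_isMajorant hL.C_pos hL.ρ_pos one_pos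
  have := hL.borel_eq hM zero_le_one (mk_zero_mem_shiftDomain hξ)
  simpa [step] using this

theorem wkbCoeff_one_succ (φ ψ : ℂ → ℂ) (n : ℕ) (ξ : ℂ) : wkbCoeff 1 φ ψ (n + 1) ξ =
    -(1 / 2) * φ ξ * wkbCoeff 1 φ ψ n ξ - 1 / 2 * deriv (wkbCoeff 1 φ ψ n) ξ -
      1 / 2 * ∫ x in Ioi (0 : ℝ), wkbPotential 1 φ ψ (ξ - x) * wkbCoeff 1 φ ψ n (ξ - x) := by
  simp [wkbCoeff, rayIntegral]

/-- At `t = 0` the transport equation for `∂_t^n F` is the recurrence that defines the WKB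
coefficients. -/
theorem LeftData.wkbCoeff_succ {ψ : ℂ → ℂ} (hL : LeftData E φ (wkbPotential 1 φ ψ) C ρ) (n : ℕ) :
    ∀ ξ ∈ E, wkbCoeff 1 φ ψ (n + 1) ξ =
      iteratedDeriv n (fun τ => borel φ (wkbPotential 1 φ ψ) τ ξ) 0 := by
  induction n with
  | zero =>
    intro ξ hξ
    rw [iteratedDeriv_zero, hL.borel_zero hξ, wkbCoeff_one_succ, firstCoeff]
    have : wkbCoeff 1 φ ψ 0 = fun _ => 1 := rfl
    simp [this]
  | succ n ih =>
    intro ξ hξ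
    have hT := hL.isTransportSolution_iteratedDeriv n
    have h1 := hT.transport 0 ξ (mk_zero_mem_shiftDomain hξ)
    rw [wkbCoeff_one_succ, iteratedDeriv_succ, ih ξ hξ]
    have h2 : deriv (wkbCoeff 1 φ ψ (n + 1)) ξ =
        deriv (fun z => iteratedDeriv n (fun τ => borel φ (wkbPotential 1 φ ψ) τ z) 0) ξ := by
      refine Filter.EventuallyEq.deriv_eq ?_
      filter_upwards [hL.isOpen.mem_nhds hξ] with z hz using ih z hz
    have h3 : ∫ x in Ioi (0 : ℝ), wkbPotential 1 φ ψ (ξ - x) * wkbCoeff 1 φ ψ (n + 1) (ξ - x) =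
        ∫ x in Ioi (0 : ℝ), wkbPotential 1 φ ψ (ξ - x) *
          iteratedDeriv n (fun τ => borel φ (wkbPotential 1 φ ψ) τ (ξ - x)) 0 := by
      refine setIntegral_congr_fun measurableSet_Ioi fun x hx => ?_
      rw [ih _ (hL.left ξ hξ x (le_of_lt hx))]
    rw [h2, h3]
    simp only [source] at h1
    linear_combination (-1 / 2 : ℂ) * h1

theorem LeftData.analyticOnNhd_wkbCoeff {ψ : ℂ → ℂ}
    (hL : LeftData E φ (wkbPotential 1 φ ψ) C ρ) (n : ℕ) :
    AnalyticOnNhd ℂ (wkbCoeff 1 φ ψ n) E := by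
  cases n with
  | zero => exact analyticOnNhd_const
  | succ n =>
    refine DifferentiableOn.analyticOnNhd (fun ξ hξ => ?_) hL.isOpen
    have h := ((hL.isTransportSolution_iteratedDeriv n).hasDerivAt_snd
      (mk_zero_mem_shiftDomain hξ)).differentiableAt
    refine (h.congr_of_eventuallyEq ?_).differentiableWithinAt
    filter_upwards [hL.isOpen.mem_nhds hξ] with z hz using hL.wkbCoeff_succ n z hz

theorem LeftData.integrableOn_wkbCoeff {ψ : ℂ → ℂ}
    (hL : LeftData E φ (wkbPotential 1 φ ψ) C ρ) (n : ℕ) {ξ : ℂ} (hξ : ξ ∈ E) :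
    IntegrableOn (fun x : ℝ => wkbPotential 1 φ ψ (ξ - x) * wkbCoeff 1 φ ψ n (ξ - x)) (Ioi 0) := by
  obtain ⟨B, hB⟩ : ∃ B : ℝ, ∀ x : ℝ, 0 ≤ x → ‖wkbCoeff 1 φ ψ n (ξ - x)‖ ≤ B := by
    cases n with
    | zero => exact ⟨1, fun x _ => by simp [wkbCoeff]⟩
    | succ n =>
      obtain ⟨ε, hε, B, hB⟩ := (hL.isTransportSolution_iteratedDeriv n).bounded 0 ξ
        (mk_zero_mem_shiftDomain hξ)
      refine ⟨B, fun x hx => ?_⟩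
      rw [hL.wkbCoeff_succ n _ (hL.left ξ hξ x hx)]
      exact (hB 0 (Metric.mem_ball_self hε) x hx).2
  refine (((integral_decay hL.ρ_pos ξ.re).1.const_mul C).mul_const B).mono' ?_ ?_
  · refine ContinuousOn.aestronglyMeasurable ?_ measurableSet_Ioi
    have hc : ContinuousOn (fun z => wkbPotential 1 φ ψ z * wkbCoeff 1 φ ψ n z) E :=
      hL.differentiableOn_V.continuousOn.mul (hL.analyticOnNhd_wkbCoeff n).continuousOn
    exact hc.comp (by fun_prop) fun x hx => hL.left ξ hξ x (le_of_lt hx)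
  · filter_upwards [ae_restrict_mem measurableSet_Ioi] with x hx
    have h1 := hL.norm_V_le _ (hL.left ξ hξ x (le_of_lt hx))
    rw [re_sub_ofReal] at h1
    rw [norm_mul]
    exact mul_le_mul h1 (hB x (le_of_lt hx)) (norm_nonneg _) ((norm_nonneg _).trans h1)

end

/-! ### The Laplace transform -/

theorem isOpen_stripU (r : ℝ) : IsOpen (stripU r) :=
  ((isOpen_lt continuous_const Complex.continuous_re).inter
    (isOpen_lt Complex.continuous_im.abs continuous_const)).union Metric.isOpen_ball

theorem norm_sub_re_le_of_mem_stripU {r : ℝ} {t : ℂ} (ht : t ∈ stripU r) :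
    ‖t‖ - t.re ≤ 2 * r := by
  rcases ht with ⟨h1, h2⟩ | h
  · have := Complex.norm_le_abs_re_add_abs_im t
    rw [abs_of_pos h1] at this
    linarith [abs_nonneg t.im]
  · rw [mem_ball_zero_iff] at h
    linarith [(abs_le.1 (Complex.abs_re_le_norm t)).1]

theorem closedBall_subset_stripU {r s : ℝ} (hs : s < r) {t : ℝ} (ht : 0 ≤ t) :
    Metric.closedBall (t : ℂ) s ⊆ stripU r := by
  intro z hz
  rw [Metric.mem_closedBall, dist_eq_norm] at hz
  rcases lt_or_ge 0 z.re with h | h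
  · left
    refine ⟨h, lt_of_le_of_lt ?_ hs⟩
    refine le_trans ?_ hz
    simpa using Complex.abs_im_le_norm (z - t)
  · right
    rw [mem_ball_zero_iff]
    refine lt_of_le_of_lt (le_trans ?_ hz) hs
    rw [Complex.norm_def, Complex.norm_def]
    refine Real.sqrt_le_sqrt ?_
    simp only [Complex.normSq_apply, Complex.sub_re, Complex.ofReal_re, Complex.sub_im,
      Complex.ofReal_im, sub_zero]
    nlinarith

theorem ofReal_mem_stripU {r : ℝ} (hr : 0 < r) {t : ℝ} (ht : 0 ≤ t) : (t : ℂ) ∈ stripU r :=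
  closedBall_subset_stripU hr ht (Metric.mem_closedBall_self le_rfl)

theorem norm_exp_neg_mul_ofReal (u : ℂ) (t : ℝ) :
    ‖Complex.exp (-u * t)‖ = Real.exp (-(u.re * t)) := by
  rw [Complex.norm_exp]
  simp

theorem integral_exp_sub {a c : ℝ} (h : c < a) :
    IntegrableOn (fun t : ℝ => Real.exp (-(a * t)) * Real.exp (c * t)) (Ioi 0) ∧
      ∫ t in Ioi (0 : ℝ), Real.exp (-(a * t)) * Real.exp (c * t) = 1 / (a - c) := by
  have he : (fun t : ℝ => Real.exp (-(a * t)) * Real.exp (c * t)) =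
      fun t => Real.exp ((c - a) * t) := by
    funext t
    rw [← Real.exp_add]
    congr 1
    ring
  rw [he]
  refine ⟨integrableOn_exp_mul_Ioi (by linarith) 0, ?_⟩
  rw [integral_exp_mul_Ioi (by linarith)]
  simp only [mul_zero, Real.exp_zero]
  rw [← neg_sub a c, neg_div_neg_eq]

/-- `f` is holomorphic on the strip `stripU r` and bounded there by `B exp (σ Re t)`. -/
structure IsStripBounded (r B σ : ℝ) (f : ℂ → ℂ) : Prop where
  r_pos : 0 < r
  B_nonneg : 0 ≤ B
  σ_nonneg : 0 ≤ σ
  differentiableOn : DifferentiableOn ℂ f (stripU r)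
  norm_le : ∀ t ∈ stripU r, ‖f t‖ ≤ B * Real.exp (σ * t.re)

/-- The constant in the bound `‖f⁽ⁿ⁾ t‖ ≤ cauchyConst r B σ n * exp (σ t)`, `t ≥ 0`, that Cauchy's
estimate on discs of radius `r / 2` gives for `f` as in `IsStripBounded r B σ f`. -/
def cauchyConst (r B σ : ℝ) (n : ℕ) : ℝ :=
  n.factorial * (B * Real.exp (σ * (r / 2))) / (r / 2) ^ n

namespace IsStripBounded

variable {r B σ : ℝ} {f : ℂ → ℂ} {u : ℂ}

theorem cauchyConst_nonneg (hf : IsStripBounded r B σ f) (n : ℕ) : 0 ≤ cauchyConst r B σ n := by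
  have := hf.B_nonneg
  have := hf.r_pos
  unfold cauchyConst
  positivity

theorem norm_iteratedDeriv_le (hf : IsStripBounded r B σ f) (n : ℕ) {t : ℝ} (ht : 0 ≤ t) :
    ‖iteratedDeriv n f t‖ ≤ cauchyConst r B σ n * Real.exp (σ * t) := by
  have hr := hf.r_pos
  have hB := hf.B_nonneg
  have hsub : Metric.closedBall (t : ℂ) (r / 2) ⊆ stripU r :=
    closedBall_subset_stripU (by linarith) ht
  have h := Complex.norm_iteratedDeriv_le_of_forall_mem_sphere_norm_le n
    (c := (t : ℂ)) (R := r / 2) (C := B * Real.exp (σ * (r / 2)) * Real.exp (σ * t)) (f := f)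
    (by positivity) ((hf.differentiableOn.mono hsub).diffContOnCl_ball le_rfl) ?_
  · refine h.trans (le_of_eq ?_)
    unfold cauchyConst
    ring
  · intro z hz
    refine (hf.norm_le z (hsub (Metric.sphere_subset_closedBall hz))).trans ?_
    rw [mul_assoc, ← Real.exp_add]
    have hz1 : z.re ≤ t + r / 2 := by
      have h1 : (z - t).re ≤ ‖z - t‖ := Complex.re_le_norm _
      rw [mem_sphere_iff_norm.1 hz] at h1
      simp only [Complex.sub_re, Complex.ofReal_re] at h1
      linarith
    have hσ := hf.σ_nonneg
    gcongr
    nlinarith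

theorem hasDerivAt_iteratedDeriv (hf : IsStripBounded r B σ f) (n : ℕ) {t : ℝ} (ht : 0 ≤ t) :
    HasDerivAt (fun t : ℝ => iteratedDeriv n f t) (iteratedDeriv (n + 1) f t) t := by
  have h : DifferentiableAt ℂ (iteratedDeriv n f) t := by
    have ha := hf.differentiableOn.analyticOnNhd (isOpen_stripU r) _ (ofReal_mem_stripU hf.r_pos ht)
    rw [iteratedDeriv_eq_iterate]
    exact (ha.iterated_deriv n).differentiableAt
  rw [iteratedDeriv_succ]
  exact h.hasDerivAt.comp_ofReal

theorem integrableOn_laplace (hf : IsStripBounded r B σ f) (n : ℕ) (hu : σ < u.re) :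
    IntegrableOn (fun t : ℝ => Complex.exp (-u * t) * iteratedDeriv n f t) (Ioi 0) := by
  refine ((integral_exp_sub hu).1.const_mul (cauchyConst r B σ n)).mono' ?_ ?_
  · refine ContinuousOn.aestronglyMeasurable ?_ measurableSet_Ioi
    refine ContinuousOn.mul (by fun_prop) fun t ht => ?_
    exact (hf.hasDerivAt_iteratedDeriv n (le_of_lt ht)).continuousAt.continuousWithinAt
  · filter_upwards [ae_restrict_mem measurableSet_Ioi] with t ht
    rw [norm_mul, norm_exp_neg_mul_ofReal]
    calc _ ≤ Real.exp (-(u.re * t)) * (cauchyConst r B σ n * Real.exp (σ * t)) := by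
          gcongr
          exact hf.norm_iteratedDeriv_le n (le_of_lt ht)
      _ = _ := by ring

theorem norm_laplace_le (hf : IsStripBounded r B σ f) (n : ℕ) (hu : σ < u.re) :
    ‖∫ t in Ioi (0 : ℝ), Complex.exp (-u * t) * iteratedDeriv n f t‖ ≤
      cauchyConst r B σ n / (u.re - σ) := by
  obtain ⟨hi, he⟩ := integral_exp_sub hu
  refine (norm_integral_le_of_norm_le (hi.const_mul (cauchyConst r B σ n)) ?_).trans
    (le_of_eq ?_)
  · filter_upwards [ae_restrict_mem measurableSet_Ioi] with t ht
    rw [norm_mul, norm_exp_neg_mul_ofReal]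
    calc _ ≤ Real.exp (-(u.re * t)) * (cauchyConst r B σ n * Real.exp (σ * t)) := by
          gcongr
          exact hf.norm_iteratedDeriv_le n (le_of_lt ht)
      _ = _ := by ring
  · rw [integral_const_mul, he]
    ring

/-- Integration by parts in the Laplace integral. -/
theorem mul_laplace (hf : IsStripBounded r B σ f) (n : ℕ) (hu : σ < u.re) :
    u * ∫ t in Ioi (0 : ℝ), Complex.exp (-u * t) * iteratedDeriv n f t =
      iteratedDeriv n f 0 +
        ∫ t in Ioi (0 : ℝ), Complex.exp (-u * t) * iteratedDeriv (n + 1) f t := by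
  have hi0 := hf.integrableOn_laplace n hu
  have hi1 := hf.integrableOn_laplace (n + 1) hu
  have hd : ∀ t ∈ Ici (0 : ℝ), HasDerivAt (fun t : ℝ => Complex.exp (-u * t) * iteratedDeriv n f t)
      (-u * (Complex.exp (-u * t) * iteratedDeriv n f t) +
        Complex.exp (-u * t) * iteratedDeriv (n + 1) f t) t := by
    intro t ht
    have h1 : HasDerivAt (fun t : ℝ => Complex.exp (-u * t)) (Complex.exp (-u * t) * -u) t := by
      have h2 : HasDerivAt (fun t : ℝ => -u * (t : ℂ)) (-u) t := by
        simpa using (Complex.ofRealCLM.hasDerivAt (x := t)).const_mul (-u)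
      exact h2.cexp
    refine (h1.mul (hf.hasDerivAt_iteratedDeriv n ht)).congr_deriv ?_
    ring
  have ht : Tendsto (fun t : ℝ => Complex.exp (-u * t) * iteratedDeriv n f t) atTop (𝓝 0) := by
    refine squeeze_zero_norm'
      (a := fun t : ℝ => cauchyConst r B σ n * Real.exp (-((u.re - σ) * t))) ?_ ?_
    · filter_upwards [Ici_mem_atTop 0] with t ht
      rw [norm_mul, norm_exp_neg_mul_ofReal]
      calc _ ≤ Real.exp (-(u.re * t)) * (cauchyConst r B σ n * Real.exp (σ * t)) := by
            gcongr
            exact hf.norm_iteratedDeriv_le n ht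
        _ = cauchyConst r B σ n * (Real.exp (-(u.re * t)) * Real.exp (σ * t)) := by ring
        _ = _ := by
          rw [← Real.exp_add]
          congr 2
          ring
    · have h1 : Tendsto (fun t : ℝ => (u.re - σ) * t) atTop atTop :=
        tendsto_id.const_mul_atTop (by linarith)
      have := (Real.tendsto_exp_neg_atTop_nhds_zero.comp h1).const_mul (cauchyConst r B σ n)
      simpa [Function.comp_def] using this
  have hFTC := integral_Ioi_of_hasDerivAt_of_tendsto' hd ((hi0.const_mul (-u)).add hi1) ht
  rw [integral_add (hi0.const_mul (-u)) hi1, integral_const_mul] at hFTC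
  simp only [Complex.ofReal_zero, mul_zero, Complex.exp_zero, one_mul] at hFTC
  linear_combination -hFTC

theorem laplace_sub_sum (hf : IsStripBounded r B σ f) (N : ℕ) (hu : σ < u.re) :
    (∫ t in Ioi (0 : ℝ), Complex.exp (-u * t) * f t) -
        ∑ n ∈ Finset.Icc 1 N, iteratedDeriv (n - 1) f 0 / u ^ n =
      (∫ t in Ioi (0 : ℝ), Complex.exp (-u * t) * iteratedDeriv N f t) / u ^ N := by
  have hu0 : u ≠ 0 := fun h => by
    have := hf.σ_nonneg
    rw [h, Complex.zero_re] at hu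
    linarith
  induction N with
  | zero => simp
  | succ N ih =>
    rw [Finset.sum_Icc_succ_top (by omega), ← sub_sub, ih, Nat.add_sub_cancel]
    have := hf.mul_laplace N hu
    generalize (∫ t in Ioi (0 : ℝ), Complex.exp (-u * t) * iteratedDeriv N f t) = I at this ⊢
    rw [← sub_eq_iff_eq_add'.2 this]
    field_simp
    ring

/-- One more integration by parts than the number of terms keeps the remainder `O(|u|^(-N-1))`
uniformly in the half-plane, also where `u` tends to infinity with bounded real part. -/
theorem norm_laplace_sub_sum_le (hf : IsStripBounded r B σ f) (N : ℕ) (hu : σ < u.re) :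
    ‖(∫ t in Ioi (0 : ℝ), Complex.exp (-u * t) * f t) -
        ∑ n ∈ Finset.Icc 1 N, iteratedDeriv (n - 1) f 0 / u ^ n‖ ≤
      (cauchyConst r B σ N + cauchyConst r B σ (N + 1) / (u.re - σ)) / ‖u‖ ^ (N + 1) := by
  have hu0 : u ≠ 0 := fun h => by
    have := hf.σ_nonneg
    rw [h, Complex.zero_re] at hu
    linarith
  have h1 : (∫ t in Ioi (0 : ℝ), Complex.exp (-u * t) * iteratedDeriv N f t) / u ^ N =
      (iteratedDeriv N f 0 +
        ∫ t in Ioi (0 : ℝ), Complex.exp (-u * t) * iteratedDeriv (N + 1) f t) / u ^ (N + 1) := by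
    rw [← hf.mul_laplace N hu]
    generalize (∫ t in Ioi (0 : ℝ), Complex.exp (-u * t) * iteratedDeriv N f t) = I
    field_simp
    ring
  rw [hf.laplace_sub_sum N hu, h1, norm_div, norm_pow]
  gcongr
  refine (norm_add_le _ _).trans (add_le_add ?_ (hf.norm_laplace_le (N + 1) hu))
  simpa using hf.norm_iteratedDeriv_le N le_rfl

end IsStripBounded

/-- The function `η^+`, the Laplace transform of `borel φ V`. -/
def laplaceBorel (φ V : ℂ → ℂ) (u ξ : ℂ) : ℂ :=
  ∫ t in Ioi (0 : ℝ), Complex.exp (-u * (t : ℂ)) * borel φ V (t : ℂ) ξ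

theorem mem_shiftDomain_of_mem_stripU {E : Set ℂ} (hE : ∀ ξ ∈ E, ∀ x : ℝ, 0 ≤ x → ξ - x ∈ E)
    {r : ℝ} {ξ t : ℂ} (hball : Metric.ball ξ r ⊆ E) (ht : t ∈ stripU (2 * r)) :
    (t, ξ) ∈ shiftDomain E := by
  intro l hl
  rcases ht with ⟨h1, h2⟩ | h
  · have hm : ξ - l * (t.im / 2) * Complex.I ∈ E := by
      refine hball ?_
      rw [Metric.mem_ball, dist_eq_norm, sub_sub_cancel_left, norm_neg, norm_mul, Complex.norm_I,
        mul_one, norm_mul, norm_div, Complex.norm_real, Complex.norm_real, Real.norm_eq_abs,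
        Real.norm_eq_abs, abs_of_nonneg hl.1]
      have : |t.im| / ‖(2 : ℂ)‖ < r := by
        rw [Complex.norm_ofNat]
        linarith
      exact (mul_le_of_le_one_left (by positivity) hl.2).trans_lt this
    have := hE _ hm (l * (t.re / 2)) (mul_nonneg hl.1 (by linarith))
    convert this using 1
    push_cast
    conv_lhs => rw [← Complex.re_add_im t]
    ring
  · refine hball ?_
    rw [mem_ball_zero_iff] at h
    rw [Metric.mem_ball, dist_eq_norm, sub_sub_cancel_left, norm_neg, norm_mul, norm_div,
      Complex.norm_real, Real.norm_eq_abs, abs_of_nonneg hl.1, Complex.norm_ofNat]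
    have : ‖t‖ / 2 < r := by linarith
    exact (mul_le_of_le_one_left (by positivity) hl.2).trans_lt this

section

variable {E : Set ℂ} {φ V : ℂ → ℂ} {C ρ σ b K δ r : ℝ} {M M' : ℝ → ℝ} {u ξ : ℂ}

theorem LeftData.norm_borel_le_of_mem_stripU (hL : LeftData E φ V C ρ)
    (hM : IsMajorant C ρ σ b K δ M M') (hσ : 0 ≤ σ) {t : ℂ} (hp : (t, ξ) ∈ shiftDomain E)
    (ht : t ∈ stripU r) :
    ‖borel φ V t ξ‖ ≤ (C + C / ρ) * 2 * Real.exp ((σ + b) * (2 * r)) * M ξ.re *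
      Real.exp (σ * t.re) := by
  have hC := hL.C_pos
  have hρ := hL.ρ_pos
  have hb := hM.b_nonneg
  have hMp := hM.pos hρ ξ.re
  refine (hL.norm_borel_le hM hσ hp).trans ?_
  have h1 : growth σ b t ≤ (σ + b) * (2 * r) + σ * t.re := by
    have h2 := mul_le_mul_of_nonneg_left (norm_sub_re_le_of_mem_stripU ht)
      (by positivity : 0 ≤ σ + b)
    unfold growth
    linarith
  calc (C + C / ρ) * 2 * Real.exp (growth σ b t) * M ξ.re
      ≤ (C + C / ρ) * 2 * Real.exp ((σ + b) * (2 * r) + σ * t.re) * M ξ.re := by gcongr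
    _ = _ := by rw [Real.exp_add]; ring

theorem LeftData.norm_borel_ofReal_le (hL : LeftData E φ V C ρ)
    (hM : IsMajorant C ρ σ b K δ M M') (hσ : 0 ≤ σ) (hξ : ξ ∈ E) {t : ℝ} (ht : 0 ≤ t) :
    ‖borel φ V t ξ‖ ≤ (C + C / ρ) * 2 * M ξ.re * Real.exp (σ * t) := by
  refine (hL.norm_borel_le hM hσ (ofReal_mem_shiftDomain hL.left hξ ht)).trans (le_of_eq ?_)
  have : growth σ b t = σ * t := by
    simp [growth, abs_of_nonneg ht]
  simp only [this]
  ring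

theorem LeftData.isStripBounded_borel (hL : LeftData E φ V C ρ)
    (hM : IsMajorant C ρ σ b K δ M M') (hσ : 0 ≤ σ) (hr : 0 < r) (hball : Metric.ball ξ r ⊆ E) :
    IsStripBounded (2 * r) ((C + C / ρ) * 2 * Real.exp ((σ + b) * (2 * (2 * r))) * (K * 2)) σ
      (fun t => borel φ V t ξ) := by
  have hC := hL.C_pos
  have hρ := hL.ρ_pos
  have hK := hM.K_pos
  refine ⟨by positivity, by positivity, hσ, fun t ht => ?_, fun t ht => ?_⟩
  · exact (hL.isTransportSolution_borel.hasDerivAt_fst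
      (mem_shiftDomain_of_mem_stripU hL.left hball ht)).differentiableAt.differentiableWithinAt
  · refine (hL.norm_borel_le_of_mem_stripU hM hσ
      (mem_shiftDomain_of_mem_stripU hL.left hball ht) ht).trans ?_
    gcongr
    exact hM.le_const hρ _

theorem LeftData.continuousOn_borel_ofReal (hL : LeftData E φ V C ρ) (hξ : ξ ∈ E) :
    ContinuousOn (fun t : ℝ => borel φ V t ξ) (Ioi 0) :=
  hL.isTransportSolution_borel.analyticOnNhd.continuousOn.comp (f := fun t : ℝ => ((t : ℂ), ξ))
    (by fun_prop) fun _ ht => ofReal_mem_shiftDomain hL.left hξ (le_of_lt ht)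

theorem LeftData.norm_laplace_integrand_le (hL : LeftData E φ V C ρ)
    (hM : IsMajorant C ρ σ b K δ M M') (hσ : 0 ≤ σ) (hξ : ξ ∈ E) {a : ℝ} (ha : a ≤ u.re) {t : ℝ}
    (ht : 0 ≤ t) : ‖Complex.exp (-u * t) * borel φ V t ξ‖ ≤
      (C + C / ρ) * 2 * M ξ.re * (Real.exp (-(a * t)) * Real.exp (σ * t)) := by
  rw [norm_mul, norm_exp_neg_mul_ofReal]
  calc _ ≤ Real.exp (-(a * t)) * ((C + C / ρ) * 2 * M ξ.re * Real.exp (σ * t)) := by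
        gcongr
        exact hL.norm_borel_ofReal_le hM hσ hξ ht
    _ = _ := by ring

theorem LeftData.aestronglyMeasurable_laplace (hL : LeftData E φ V C ρ) (u : ℂ) (hξ : ξ ∈ E) :
    AEStronglyMeasurable (fun t : ℝ => Complex.exp (-u * t) * borel φ V t ξ)
      (volume.restrict (Ioi 0)) :=
  (ContinuousOn.mul (by fun_prop) (hL.continuousOn_borel_ofReal hξ)).aestronglyMeasurable
    measurableSet_Ioi

theorem LeftData.integrableOn_laplace (hL : LeftData E φ V C ρ) (hu : 0 < u.re) (hξ : ξ ∈ E) :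
    IntegrableOn (fun t : ℝ => Complex.exp (-u * t) * borel φ V t ξ) (Ioi 0) := by
  obtain ⟨b, K, δ, M, M', hM⟩ := exists_isMajorant hL.C_pos hL.ρ_pos (half_pos hu)
  refine ((integral_exp_sub (half_lt_self hu)).1.const_mul ((C + C / ρ) * 2 * M ξ.re)).mono'
    (hL.aestronglyMeasurable_laplace u hξ) ?_
  filter_upwards [ae_restrict_mem measurableSet_Ioi] with t ht
  exact hL.norm_laplace_integrand_le hM (half_pos hu).le hξ le_rfl (le_of_lt ht)

theorem LeftData.norm_laplaceBorel_le (hL : LeftData E φ V C ρ)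
    (hM : IsMajorant C ρ σ b K δ M M') (hσ : 0 ≤ σ) (hu : σ < u.re) (hξ : ξ ∈ E) :
    ‖laplaceBorel φ V u ξ‖ ≤ (C + C / ρ) * 2 * M ξ.re * (1 / (u.re - σ)) := by
  obtain ⟨hi, he⟩ := integral_exp_sub hu
  refine (norm_integral_le_of_norm_le (hi.const_mul ((C + C / ρ) * 2 * M ξ.re)) ?_).trans
    (le_of_eq ?_)
  · filter_upwards [ae_restrict_mem measurableSet_Ioi] with t ht
    exact hL.norm_laplace_integrand_le hM hσ hξ le_rfl (le_of_lt ht)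
  · rw [integral_const_mul, he]

theorem LeftData.analyticOnNhd_laplaceBorel (hL : LeftData E φ V C ρ) :
    AnalyticOnNhd ℂ (fun p : ℂ × ℂ => laplaceBorel φ V p.1 p.2) ({u : ℂ | 0 < u.re} ×ˢ E) := by
  have hC := hL.C_pos
  have hρ := hL.ρ_pos
  have hF := hL.isTransportSolution_borel.analyticOnNhd
  refine analyticOnNhd_integral
    ((isOpen_lt continuous_const Complex.continuous_re).prod hL.isOpen)
    (fun p hp => hL.aestronglyMeasurable_laplace p.1 hp.2) ?_ ?_
  · filter_upwards [ae_restrict_mem measurableSet_Ioi] with t ht p hp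
    refine AnalyticAt.mul (analyticAt_fst.neg.mul analyticAt_const).cexp ?_
    exact (hF _ (ofReal_mem_shiftDomain hL.left hp.2 (le_of_lt ht))).fun_comp
      (f := fun p : ℂ × ℂ => ((t : ℂ), p.2)) (analyticAt_const.prod analyticAt_snd)
  · rintro ⟨u, ξ⟩ ⟨hu, hξ⟩
    replace hu : 0 < u.re := hu
    obtain ⟨b, K, δ, M, M', hM⟩ := exists_isMajorant hC hρ (by positivity : 0 < u.re / 4)
    refine ⟨fun t => (C + C / ρ) * 2 * (K * 2) *
      (Real.exp (-(u.re / 2 * t)) * Real.exp (u.re / 4 * t)), u.re / 2, by positivity,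
      (integral_exp_sub (by linarith)).1.const_mul _, ?_⟩
    filter_upwards [ae_restrict_mem measurableSet_Ioi] with t ht q hq
    have hq1 : u.re / 2 ≤ q.1.re := by
      have h1 : dist q.1 u < u.re / 2 := (le_max_left _ _).trans_lt (Metric.mem_ball.1 hq.1)
      rw [dist_comm, dist_eq_norm] at h1
      have h2 := Complex.re_le_norm (u - q.1)
      rw [Complex.sub_re] at h2
      linarith
    refine (hL.norm_laplace_integrand_le hM (by positivity) hq.2.2 hq1 (le_of_lt ht)).trans ?_
    gcongr
    exact hM.le_const hρ _

theorem LeftData.laplace_integral_swap (hL : LeftData E φ V C ρ) (hu : 0 < u.re) (hξ : ξ ∈ E) :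
    IntegrableOn (fun t : ℝ => Complex.exp (-u * t) *
        ∫ x in Ioi (0 : ℝ), V (ξ - x) * borel φ V t (ξ - x)) (Ioi 0) ∧
      ∫ t in Ioi (0 : ℝ), Complex.exp (-u * t) *
          ∫ x in Ioi (0 : ℝ), V (ξ - x) * borel φ V t (ξ - x) =
        ∫ x in Ioi (0 : ℝ), V (ξ - x) * laplaceBorel φ V u (ξ - x) := by
  have hC := hL.C_pos
  have hρ := hL.ρ_pos
  obtain ⟨b, K, δ, M, M', hM⟩ := exists_isMajorant hC hρ (half_pos hu)
  have hK := hM.K_pos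
  have hint : Integrable (Function.uncurry fun (t x : ℝ) => Complex.exp (-u * t) *
      (V (ξ - x) * borel φ V t (ξ - x)))
      ((volume.restrict (Ioi 0)).prod (volume.restrict (Ioi 0))) := by
    refine (((integral_exp_sub (half_lt_self hu)).1.mul_prod
      ((integral_decay hρ ξ.re).1.const_mul (C * ((C + C / ρ) * 2 * (K * 2)))))).mono' ?_ ?_
    · rw [Measure.prod_restrict]
      refine ContinuousOn.aestronglyMeasurable ?_ (measurableSet_Ioi.prod measurableSet_Ioi)
      have hm : ∀ z ∈ Ioi (0 : ℝ) ×ˢ Ioi (0 : ℝ), ξ - (z.2 : ℂ) ∈ E := fun z hz =>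
        hL.left ξ hξ _ (le_of_lt hz.2)
      refine ContinuousOn.mul (by fun_prop) (ContinuousOn.mul ?_ ?_)
      · exact hL.differentiableOn_V.continuousOn.comp (by fun_prop) hm
      · exact hL.isTransportSolution_borel.analyticOnNhd.continuousOn.comp
          (f := fun z : ℝ × ℝ => ((z.1 : ℂ), ξ - (z.2 : ℂ))) (by fun_prop)
          fun z hz => ofReal_mem_shiftDomain hL.left (hm z hz) (le_of_lt hz.1)
    · rw [Measure.prod_restrict]
      filter_upwards [ae_restrict_mem (measurableSet_Ioi.prod measurableSet_Ioi)] with z hz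
      have hm : ξ - (z.2 : ℂ) ∈ E := hL.left ξ hξ _ (le_of_lt hz.2)
      have h1 := hL.norm_V_le _ hm
      rw [re_sub_ofReal] at h1
      have h2 := hL.norm_laplace_integrand_le hM (half_pos hu).le hm (le_refl u.re)
        (le_of_lt hz.1)
      have h3 : ‖Complex.exp (-u * z.1) * borel φ V z.1 (ξ - z.2)‖ ≤ (C + C / ρ) * 2 * (K * 2) *
          (Real.exp (-(u.re * z.1)) * Real.exp (u.re / 2 * z.1)) := by
        refine h2.trans ?_
        gcongr
        exact hM.le_const hρ _
      simp only [Function.uncurry]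
      rw [mul_left_comm, norm_mul]
      refine (mul_le_mul h1 h3 (norm_nonneg _) ((norm_nonneg _).trans h1)).trans (le_of_eq ?_)
      ring
  constructor
  · have := hint.integral_prod_left
    simp only [Function.uncurry, integral_const_mul] at this
    exact this
  · have := integral_integral_swap hint
    simp only [integral_const_mul] at this
    rw [this]
    refine integral_congr_ae (Eventually.of_forall fun x => ?_)
    simp only [laplaceBorel]
    rw [← integral_const_mul]
    refine integral_congr_ae (Eventually.of_forall fun t => ?_)
    simp only
    ring

/-- The Laplace transform of the transport equation: `η' = 2 A₁ - 2 u η - φ η - ∫ V η`, where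
`2 F_t` contributes `-2 A₁ + 2 u η` after an integration by parts. -/
theorem LeftData.hasDerivAt_laplaceBorel (hL : LeftData E φ V C ρ) (hu : 0 < u.re) (hξ : ξ ∈ E) :
    HasDerivAt (laplaceBorel φ V u) (2 * firstCoeff φ V ξ - 2 * u * laplaceBorel φ V u ξ -
      φ ξ * laplaceBorel φ V u ξ -
        ∫ x in Ioi (0 : ℝ), V (ξ - x) * laplaceBorel φ V u (ξ - x)) ξ := by
  have hC := hL.C_pos
  have hρ := hL.ρ_pos
  obtain ⟨b, K, δ, M, M', hM⟩ := exists_isMajorant hC hρ (half_pos hu)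
  obtain ⟨ε, hε, hεE⟩ := Metric.isOpen_iff.1 hL.isOpen ξ hξ
  have hT := hL.isTransportSolution_borel
  have hPI := (hasDerivAt_integral_of_holomorphic (μ := volume.restrict (Ioi (0 : ℝ)))
    (f := fun z t => Complex.exp (-u * t) * borel φ V t z) (z := ξ) (ε := ε)
    (g := fun t => (C + C / ρ) * 2 * (K * 2) *
      (Real.exp (-(u.re * t)) * Real.exp (u.re / 2 * t))) hε
    (fun w hw => hL.aestronglyMeasurable_laplace u (hεE hw)) ?_
    ((integral_exp_sub (half_lt_self hu)).1.const_mul _) ?_).2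
  · refine hPI.congr_deriv ?_
    have hsb := hL.isStripBounded_borel hM (half_pos hu).le hε hεE
    have hparts := hsb.mul_laplace 0 (half_lt_self hu)
    have hi1 := hsb.integrableOn_laplace 1 (half_lt_self hu)
    simp only [zero_add, iteratedDeriv_zero, iteratedDeriv_one] at hparts hi1
    rw [hL.borel_zero hξ] at hparts
    obtain ⟨hi3, hF⟩ := hL.laplace_integral_swap hu hξ
    have hi2 := hL.integrableOn_laplace hu hξ
    have hae : ∀ᵐ t : ℝ ∂(volume.restrict (Ioi (0 : ℝ))),
        deriv (fun z => Complex.exp (-u * t) * borel φ V t z) ξ =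
          (-2) * (Complex.exp (-u * t) * deriv (fun τ => borel φ V τ ξ) t) -
            φ ξ * (Complex.exp (-u * t) * borel φ V t ξ) -
            Complex.exp (-u * t) * ∫ x in Ioi (0 : ℝ), V (ξ - x) * borel φ V t (ξ - x) := by
      filter_upwards [ae_restrict_mem measurableSet_Ioi] with t ht
      have h1 := hT.transport t ξ (ofReal_mem_shiftDomain hL.left hξ (le_of_lt ht))
      rw [deriv_const_mul_field]
      simp only [source] at h1
      linear_combination Complex.exp (-u * t) * h1
    have hi12 : IntegrableOn (fun t : ℝ =>
        (-2) * (Complex.exp (-u * t) * deriv (fun τ => borel φ V τ ξ) t) -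
          φ ξ * (Complex.exp (-u * t) * borel φ V t ξ)) (Ioi 0) :=
      (hi1.const_mul _).sub (hi2.const_mul _)
    rw [integral_congr_ae hae, integral_sub hi12 hi3,
      integral_sub (hi1.const_mul _) (hi2.const_mul _), integral_const_mul, integral_const_mul, hF]
    change -2 * _ - φ ξ * laplaceBorel φ V u ξ - _ = _
    change u * laplaceBorel φ V u ξ = _ at hparts
    linear_combination 2 * hparts
  · filter_upwards [ae_restrict_mem measurableSet_Ioi] with t ht w hw
    exact ((hT.hasDerivAt_snd (ofReal_mem_shiftDomain hL.left (hεE hw)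
      (le_of_lt ht))).differentiableAt.const_mul _).differentiableWithinAt
  · filter_upwards [ae_restrict_mem measurableSet_Ioi] with t ht w hw
    refine (hL.norm_laplace_integrand_le hM (half_pos hu).le (hεE hw) le_rfl (le_of_lt ht)).trans ?_
    gcongr
    exact hM.le_const hρ _

/-- Differentiating the first-order equation for `η` removes the integral, and the result is
equivalent to the Schrödinger-type equation for `exp (u ξ + Φ / 2) (1 + η)`. -/
theorem LeftData.solvesEq (hL : LeftData E φ (wkbPotential 1 φ ψ) C ρ) {Γ : Set ℂ}
    (hΓ : IsOpen Γ) (hΓE : Γ ⊆ E) {Φ : ℂ → ℂ} (hΦ : IsPrimitiveOn φ Φ Γ) (hu : 0 < u.re) :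
    SolvesEq φ ψ u (wkbForm 1 Φ (laplaceBorel φ (wkbPotential 1 φ ψ)) u) Γ := by
  have hC := hL.C_pos
  have hρ := hL.ρ_pos
  set V := wkbPotential 1 φ ψ with hV
  set η := laplaceBorel φ V u with hη
  set J : ℂ → ℂ := fun ξ => ∫ x in Ioi (0 : ℝ), V (ξ - x) * η (ξ - x) with hJ
  set R : ℂ → ℂ := fun ξ => 2 * firstCoeff φ V ξ - 2 * u * η ξ - φ ξ * η ξ - J ξ with hR
  obtain ⟨b, K, δ, M, M', hM⟩ := exists_isMajorant hC hρ (half_pos hu)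
  have hη' : ∀ ξ ∈ E, HasDerivAt η (R ξ) ξ := fun ξ hξ => hL.hasDerivAt_laplaceBorel hu hξ
  have hφ' : ∀ ξ ∈ E, HasDerivAt φ (deriv φ ξ) ξ := fun ξ hξ =>
    ((hL.differentiableOn_φ ξ hξ).differentiableAt (hL.isOpen.mem_nhds hξ)).hasDerivAt
  have hJ' : ∀ ξ ∈ E, HasDerivAt J (V ξ * η ξ) ξ := fun ξ hξ =>
    (hasDerivAt_integral_left hL.isOpen hL.left hρ (g := fun ξ => V ξ * η ξ)
      (B := C * ((C + C / ρ) * 2 * (K * 2) * (1 / (u.re - u.re / 2))))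
      (hL.differentiableOn_V.mul fun z hz => (hη' z hz).differentiableAt.differentiableWithinAt)
      (fun z hz => by
        have h1 := hL.norm_V_le z hz
        have h2 := hL.norm_laplaceBorel_le hM (half_pos hu).le (half_lt_self hu) hz
        have h3 : ‖η z‖ ≤ (C + C / ρ) * 2 * (K * 2) * (1 / (u.re - u.re / 2)) := by
          refine h2.trans ?_
          have : 0 < u.re - u.re / 2 := by linarith
          gcongr
          exact hM.le_const hρ _
        rw [norm_mul]
        exact (mul_le_mul h1 h3 (norm_nonneg _) ((norm_nonneg _).trans h1)).trans
          (le_of_eq (by ring))) hξ).2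
  have hA' : ∀ ξ ∈ E, HasDerivAt (firstCoeff φ V) (-(1 / 2) * deriv φ ξ - 1 / 2 * V ξ) ξ :=
    fun ξ hξ => ((hφ' ξ hξ).const_mul _).sub ((hasDerivAt_integral_left hL.isOpen hL.left hρ
      hL.differentiableOn_V hL.norm_V_le hξ).2.const_mul _)
  have hR' : ∀ ξ ∈ E, HasDerivAt R (2 * (-(1 / 2) * deriv φ ξ - 1 / 2 * V ξ) - 2 * u * R ξ -
      (deriv φ ξ * η ξ + φ ξ * R ξ) - V ξ * η ξ) ξ := fun ξ hξ =>
    ((((hA' ξ hξ).const_mul 2).sub ((hη' ξ hξ).const_mul (2 * u))).sub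
      ((hφ' ξ hξ).mul (hη' ξ hξ))).sub (hJ' ξ hξ)
  set e : ℂ → ℂ := fun ξ => Complex.exp (u * ξ + 1 / 2 * Φ ξ) with he
  have he' : ∀ ξ ∈ Γ, HasDerivAt e (e ξ * (u + 1 / 2 * φ ξ)) ξ := fun ξ hξ => by
    have h1 := ((hasDerivAt_id ξ).const_mul u).add ((hΦ ξ hξ).const_mul (1 / 2 : ℂ))
    exact h1.cexp.congr_deriv (by simp [he])
  have hw : wkbForm 1 Φ (laplaceBorel φ V) u = fun ξ => e ξ * (1 + η ξ) := by
    funext ξ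
    simp [wkbForm, he, hη]
  set W1 : ℂ → ℂ := fun ξ => e ξ * ((u + 1 / 2 * φ ξ) * (1 + η ξ) + R ξ) with hW1
  have hw1 : ∀ ξ ∈ Γ, HasDerivAt (fun ξ => e ξ * (1 + η ξ)) (W1 ξ) ξ := fun ξ hξ => by
    refine ((he' ξ hξ).mul ((hη' ξ (hΓE hξ)).const_add 1)).congr_deriv ?_
    rw [hW1]
    ring
  have hw2 : ∀ ξ ∈ Γ, HasDerivAt W1 ((u ^ 2 + u * φ ξ + ψ ξ) * (e ξ * (1 + η ξ))) ξ :=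
    fun ξ hξ => by
    have hξE := hΓE hξ
    refine ((he' ξ hξ).mul (((((hφ' ξ hξE).const_mul (1 / 2)).const_add u).mul
      ((hη' ξ hξE).const_add 1)).add (hR' ξ hξE))).congr_deriv ?_
    have hVξ : V ξ = 1 / 4 * φ ξ ^ 2 - 1 / 2 * deriv φ ξ - ψ ξ := by
      simp [hV, wkbPotential]
    rw [hVξ]
    simp only [Pi.mul_apply, Pi.add_apply]
    ring
  rw [hw]
  refine ⟨DifferentiableOn.analyticOnNhd (fun ξ hξ =>
    (hw1 ξ hξ).differentiableAt.differentiableWithinAt) hΓ, fun ξ hξ => ?_⟩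
  have hev : deriv (fun ξ => e ξ * (1 + η ξ)) =ᶠ[𝓝 ξ] W1 := by
    filter_upwards [hΓ.mem_nhds hξ] with z hz using (hw1 z hz).deriv
  rw [hev.deriv_eq, (hw2 ξ hξ).deriv]

end

/-! ### Consequences of the decay conditions -/

theorem ball_subset_of_le_dist_frontier {Δ : Set ℂ} (hΔ : IsOpen Δ) {ξ : ℂ} (hξ : ξ ∈ Δ) {d : ℝ}
    (hd : 0 < d) (h : ∀ ζ ∈ frontier Δ, d ≤ dist ξ ζ) : Metric.ball ξ d ⊆ Δ := by
  refine (convex_ball ξ d).isPreconnected.subset_of_closure_inter_subset hΔ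
    ⟨ξ, Metric.mem_ball_self hd, hξ⟩ ?_
  rintro z ⟨hz, hzb⟩
  by_contra hzΔ
  have := h z (by rw [hΔ.frontier_eq]; exact ⟨hz, hzΔ⟩)
  rw [Metric.mem_ball, dist_comm] at hzb
  linarith

theorem div_one_add_rpow_le {a c : ℝ} (ha : 0 ≤ a) (hc : 0 ≤ c) (ξ : ℂ) :
    c / (1 + ‖ξ‖ ^ a) ≤ c * 2 ^ a * decay a ξ.re := by
  have hn := norm_nonneg ξ
  have h1 : (1 + ‖ξ‖) ^ a ≤ 2 ^ a * (1 + ‖ξ‖ ^ a) := by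
    have h2 : 0 ≤ ‖ξ‖ ^ a := by positivity
    rcases le_total ‖ξ‖ 1 with h | h
    · calc (1 + ‖ξ‖) ^ a ≤ 2 ^ a := Real.rpow_le_rpow (by positivity) (by linarith) ha
        _ ≤ 2 ^ a * (1 + ‖ξ‖ ^ a) := le_mul_of_one_le_right (by positivity) (by linarith)
    · calc (1 + ‖ξ‖) ^ a ≤ (2 * ‖ξ‖) ^ a := Real.rpow_le_rpow (by positivity) (by linarith) ha
        _ = 2 ^ a * ‖ξ‖ ^ a := Real.mul_rpow (by norm_num) hn
        _ ≤ _ := by gcongr; linarith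
  have h3 : (1 + |ξ.re|) ^ a ≤ (1 + ‖ξ‖) ^ a :=
    Real.rpow_le_rpow (by positivity) (by linarith [Complex.abs_re_le_norm ξ]) ha
  unfold decay
  rw [Real.rpow_neg (by positivity), ← div_eq_mul_inv, div_le_div_iff₀ (by positivity)
    (by positivity), mul_assoc]
  gcongr
  exact h3.trans h1

theorem decay_le_of_dist_le {a ε : ℝ} (ha : 0 ≤ a) {z w : ℂ} (h : ‖w - z‖ ≤ ε) :
    decay a w.re ≤ (1 + ε) ^ a * decay a z.re := by
  refine (decay_le_mul_decay ha z.re w.re).trans ?_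
  have h1 : |z.re - w.re| ≤ ε := by
    rw [abs_sub_comm, ← Complex.sub_re]
    exact (Complex.abs_re_le_norm _).trans h
  have := decay_pos a z.re
  gcongr

theorem norm_deriv_le_decay {a B ε : ℝ} (ha : 0 ≤ a) (hB : 0 ≤ B) (hε : 0 < ε) {φ : ℂ → ℂ} {z : ℂ}
    (hφ : DifferentiableOn ℂ φ (Metric.closedBall z ε))
    (hb : ∀ w ∈ Metric.closedBall z ε, ‖φ w‖ ≤ B * decay a w.re) :
    ‖deriv φ z‖ ≤ B * (1 + ε) ^ a / ε * decay a z.re := by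
  refine (Complex.norm_deriv_le_of_forall_mem_sphere_norm_le hε (hφ.diffContOnCl_ball le_rfl)
    (C := B * ((1 + ε) ^ a * decay a z.re)) fun w hw => ?_).trans (le_of_eq (by ring))
  refine (hb w (Metric.sphere_subset_closedBall hw)).trans ?_
  gcongr
  exact decay_le_of_dist_le ha (mem_sphere_iff_norm.1 hw).le

/-- Either decay condition gives the bounds of `LeftData` on the `r`-neighbourhood of `Γ`, `r < d`.
Under the first one, the bound on `φ'` comes from Cauchy's estimate on discs of radius `(d - r) / 2`. -/
theorem exists_leftData {Δ : Set ℂ} (hΔ : IsOpen Δ) {φ ψ : ℂ → ℂ} {c ρ : ℝ} (hc : 0 < c)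
    (hρ : 0 < ρ) (hcond : DecayCond1 Δ φ ψ c ρ ∨ DecayCond2 Δ φ ψ c ρ) {d : ℝ} (hd : 0 < d)
    {Γ : Set ℂ} (hΓ : IsGammaDomain 1 Δ d Γ) {r : ℝ} (hrd : r < d) :
    ∃ C, LeftData (Metric.thickening r Γ) φ (wkbPotential 1 φ ψ) C ρ := by
  obtain ⟨-, hΓΔ, hdist, hleft⟩ := hΓ
  set E := Metric.thickening r Γ with hE
  set ε := (d - r) / 2 with hεdef
  have hε : 0 < ε := by rw [hεdef]; linarith
  have hEball : ∀ z ∈ E, Metric.closedBall z ε ⊆ Δ := by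
    intro z hz w hw
    obtain ⟨ξ, hξ, hzξ⟩ := Metric.mem_thickening_iff.1 hz
    refine ball_subset_of_le_dist_frontier hΔ (hΓΔ hξ) hd (hdist ξ hξ) ?_
    rw [Metric.mem_closedBall] at hw
    rw [Metric.mem_ball]
    linarith [dist_triangle w z ξ]
  have hEΔ : E ⊆ Δ := fun z hz => hEball z hz (Metric.mem_closedBall_self hε.le)
  have hEleft : ∀ ξ ∈ E, ∀ x : ℝ, 0 ≤ x → ξ - x ∈ E := by
    intro ξ hξ x hx
    obtain ⟨ζ, hζ, h⟩ := Metric.mem_thickening_iff.1 hξ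
    refine Metric.mem_thickening_iff.2 ⟨ζ - x, ?_, by rwa [dist_sub_right]⟩
    rcases hx.eq_or_lt with rfl | hx
    · simpa using hζ
    · simpa using hleft ζ hζ x hx
  have hφ : AnalyticOnNhd ℂ φ Δ := hcond.elim (·.1) (·.1)
  have hψ : AnalyticOnNhd ℂ ψ Δ := hcond.elim (·.2.1) (·.2.1)
  have key : ∃ B : ℝ, 0 < B ∧ ∀ z ∈ E, ‖φ z‖ ≤ B * decay (1 / 2 + ρ) z.re ∧
      ‖deriv φ z‖ ≤ B * decay (1 + ρ) z.re ∧ ‖ψ z‖ ≤ B * decay (1 + ρ) z.re := by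
    rcases hcond with ⟨-, -, h⟩ | ⟨-, -, h⟩
    · set B₀ := c * 2 ^ (1 + ρ) with hB₀
      have hB0 : 0 < B₀ := by positivity
      have hφb : ∀ z ∈ Δ, ‖φ z‖ ≤ B₀ * decay (1 + ρ) z.re := fun z hz =>
        ((h z hz).1).trans (div_one_add_rpow_le (by linarith) hc.le z)
      refine ⟨max B₀ (B₀ * (1 + ε) ^ (1 + ρ) / ε), by positivity, fun z hz => ⟨?_, ?_, ?_⟩⟩
      · refine (hφb z (hEΔ hz)).trans ?_
        have := decay_pos (1 + ρ) z.re
        gcongr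
        · exact le_max_left _ _
        · exact decay_anti (by linarith) _
      · refine (norm_deriv_le_decay (by linarith) hB0.le hε
          (hφ.differentiableOn.mono (hEball z hz)) fun w hw => hφb w (hEball z hz hw)).trans ?_
        have := decay_pos (1 + ρ) z.re
        gcongr
        exact le_max_right _ _
      · refine (((h z (hEΔ hz)).2).trans (div_one_add_rpow_le (by linarith) hc.le z)).trans ?_
        have := decay_pos (1 + ρ) z.re
        gcongr
        exact le_max_left _ _
    · refine ⟨c * 2 ^ (1 + ρ), by positivity, fun z hz => ⟨?_, ?_, ?_⟩⟩
      · refine (((h z (hEΔ hz)).1).trans (div_one_add_rpow_le (by linarith) hc.le z)).trans ?_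
        have := decay_pos (1 / 2 + ρ) z.re
        gcongr
        · norm_num
        · norm_num
      · exact ((h z (hEΔ hz)).2.1).trans (div_one_add_rpow_le (by linarith) hc.le z)
      · exact ((h z (hEΔ hz)).2.2).trans (div_one_add_rpow_le (by linarith) hc.le z)
  obtain ⟨B, hB, hbound⟩ := key
  refine ⟨B ^ 2 + 2 * B, Metric.isOpen_thickening, hEleft, by positivity, hρ,
    hφ.differentiableOn.mono hEΔ, ?_, fun z hz => ?_, fun z hz => ?_⟩
  · have hφE := hφ.differentiableOn.mono hEΔ
    have hφ'E := hφ.deriv.differentiableOn.mono hEΔ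
    have hψE := hψ.differentiableOn.mono hEΔ
    exact (((hφE.pow 2).const_mul _).sub (hφ'E.const_mul _)).sub hψE
  · refine (hbound z hz).1.trans ?_
    have := decay_pos (1 / 2 + ρ) z.re
    gcongr
    nlinarith
  · obtain ⟨h1, h2, h3⟩ := hbound z hz
    have hq := decay_pos (1 + ρ) z.re
    have h4 : ‖φ z‖ ^ 2 ≤ B ^ 2 * decay (1 + ρ) z.re := by
      calc ‖φ z‖ ^ 2 ≤ (B * decay (1 / 2 + ρ) z.re) ^ 2 := by gcongr
        _ = B ^ 2 * (decay (1 / 2 + ρ) z.re * decay (1 / 2 + ρ) z.re) := by ring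
        _ ≤ _ := by
          rw [decay_mul]
          gcongr
          exact decay_anti (by linarith) _
    have h5 : ‖wkbPotential 1 φ ψ z‖ ≤ 1 / 4 * ‖φ z‖ ^ 2 + 1 / 2 * ‖deriv φ z‖ + ‖ψ z‖ := by
      unfold wkbPotential
      refine (norm_sub_le _ _).trans (add_le_add_left ((norm_sub_le _ _).trans (le_of_eq ?_)) _)
      simp only [norm_mul, norm_pow]
      norm_num
    nlinarith [mul_pos hB hq, mul_pos (pow_pos hB 2) hq]

section Primitive

variable {E : Set ℂ} {φ V : ℂ → ℂ} {C ρ : ℝ}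

theorem LeftData.hasDerivAt_integral_Ioc (hL : LeftData E φ V C ρ) (n : ℕ) {ξ : ℂ} (hξ : ξ ∈ E) :
    HasDerivAt (fun ξ => ∫ x in Ioc (0 : ℝ) n, φ (ξ - x)) (φ ξ - φ (ξ - n)) ξ := by
  have hC := hL.C_pos
  have hρ := hL.ρ_pos
  obtain ⟨ε, hε, hεE⟩ := Metric.isOpen_iff.1 hL.isOpen ξ hξ
  have hd : ∀ z ∈ E, ∀ x : ℝ, 0 ≤ x → HasDerivAt φ (deriv φ (z - x)) (z - x) := fun z hz x hx =>
    ((hL.differentiableOn_φ _ (hL.left z hz x hx)).differentiableAt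
      (hL.isOpen.mem_nhds (hL.left z hz x hx))).hasDerivAt
  have hPI := hasDerivAt_integral_of_holomorphic (μ := volume.restrict (Ioc (0 : ℝ) n))
    (f := fun w x => φ (w - x)) (z := ξ) (ε := ε) (g := fun _ => C) hε ?_ ?_
    (integrable_const _) ?_
  · refine hPI.2.congr_deriv ?_
    have hi := hPI.1
    simp only [deriv_comp_sub_const] at hi ⊢
    have hn : (0 : ℝ) ≤ n := n.cast_nonneg
    have hFTC := intervalIntegral.integral_eq_sub_of_hasDerivAt (a := 0) (b := n)
      (f := fun x : ℝ => -φ (ξ - x)) (f' := fun x : ℝ => deriv φ (ξ - x)) ?_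
      ((intervalIntegrable_iff_integrableOn_Ioc_of_le hn).2 hi)
    · rw [← intervalIntegral.integral_of_le hn, hFTC]
      simp
      ring
    · intro x hx
      rw [uIcc_of_le hn] at hx
      have h1 : HasDerivAt (fun x : ℝ => ξ - (x : ℂ)) (-1) x :=
        (Complex.ofRealCLM.hasDerivAt (x := x)).const_sub ξ
      exact ((hd ξ hξ x hx.1).scomp x h1).neg.congr_deriv (by simp)
  · intro w hw
    refine ContinuousOn.aestronglyMeasurable ?_ measurableSet_Ioc
    exact hL.differentiableOn_φ.continuousOn.comp (by fun_prop) fun x hx =>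
      hL.left w (hεE hw) x hx.1.le
  · filter_upwards [ae_restrict_mem measurableSet_Ioc] with x hx w hw
    exact ((hd w (hεE hw) x hx.1.le).differentiableAt.comp w
      (differentiableAt_id.sub_const _)).differentiableWithinAt
  · filter_upwards [ae_restrict_mem measurableSet_Ioc] with x hx w hw
    refine (hL.norm_φ_le _ (hL.left w (hεE hw) x hx.1.le)).trans ?_
    exact mul_le_of_le_one_right hC.le (decay_le_one (by linarith) _)

theorem LeftData.tendstoUniformlyOn_sub (hL : LeftData E φ V C ρ) {ξ : ℂ} {ε : ℝ}
    (hball : Metric.ball ξ ε ⊆ E) :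
    TendstoUniformlyOn (fun (n : ℕ) z => φ z - φ (z - n)) φ atTop (Metric.ball ξ ε) := by
  have hC := hL.C_pos
  have hρ := hL.ρ_pos
  have hlim : Tendsto (fun n : ℕ => C * ((1 + ε) ^ (1 / 2 + ρ) * decay (1 / 2 + ρ) (ξ.re - n)))
      atTop (𝓝 0) := by
    have h1 : Tendsto (fun x : ℝ => 1 + |ξ.re - x|) atTop atTop :=
      tendsto_atTop_add_const_left _ _ (tendsto_abs_atBot_atTop.comp
        (tendsto_atBot_add_const_left _ _ tendsto_neg_atTop_atBot))
    have h2 := ((tendsto_rpow_neg_atTop (by linarith : (0 : ℝ) < 1 / 2 + ρ)).comp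
      (h1.comp tendsto_natCast_atTop_atTop)).const_mul (C * (1 + ε) ^ (1 / 2 + ρ))
    simpa [decay, Function.comp_def, mul_assoc] using h2
  rw [Metric.tendstoUniformlyOn_iff]
  intro δ hδ
  filter_upwards [hlim.eventually (gt_mem_nhds hδ)] with n hn z hz
  rw [dist_eq_norm, sub_sub_cancel]
  have hm := hL.left z (hball hz) n n.cast_nonneg
  rw [Complex.ofReal_natCast] at hm
  refine ((hL.norm_φ_le _ hm).trans ?_).trans_lt hn
  gcongr
  have := decay_le_of_dist_le (a := 1 / 2 + ρ) (ε := ε) (by linarith) (z := ξ - n) (w := z - n)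
    (by rw [sub_sub_sub_cancel_right, ← dist_eq_norm]; exact (Metric.mem_ball.1 hz).le)
  simpa using this

/-- `φ` need not be integrable along left half-lines, so the integrals `∫_0^n φ(ξ - x) dx`, whose
derivatives `φ(ξ) - φ(ξ - n)` converge locally uniformly, are normalized at a base point. -/
theorem LeftData.exists_primitive (hL : LeftData E φ V C ρ) {Γ : Set ℂ} (hΓ : IsOpen Γ)
    (hΓc : IsConnected Γ) (hΓE : Γ ⊆ E) : ∃ Φ : ℂ → ℂ, IsPrimitiveOn φ Φ Γ := by
  obtain ⟨ξ₀, hξ₀⟩ := hΓc.nonempty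
  set P : ℕ → ℂ → ℂ := fun n ξ => ∫ x in Ioc (0 : ℝ) n, φ (ξ - x) with hP
  have hP' : ∀ n, ∀ ξ ∈ E, HasDerivAt (P n) (φ ξ - φ (ξ - n)) ξ := fun n ξ hξ =>
    hL.hasDerivAt_integral_Ioc n hξ
  -- convergence of the normalized functions propagates along the connected set `Γ`
  have hcauchy : ∀ ξ ∈ Γ, ∀ ζ ∈ Γ, CauchySeq fun n => P n ζ - P n ξ := by
    intro ξ hξ ζ hζ
    refine hΓc.isPreconnected.induction₂ (fun ξ ζ => CauchySeq fun n => P n ζ - P n ξ)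
      (fun ξ hξ => ?_) ?_ ?_ hξ hζ
    · obtain ⟨ε, hε, hεE⟩ := Metric.isOpen_iff.1 hL.isOpen ξ (hΓE hξ)
      have h1 := uniformCauchySeqOn_ball_of_deriv (f := fun n ζ => P n ζ - P n ξ) (l := atTop)
        (hL.tendstoUniformlyOn_sub hεE).uniformCauchySeqOn
        (fun n ζ hζ => (hP' n ζ (hεE hζ)).sub_const _) (by
          have : CauchySeq fun _ : ℕ => (0 : ℂ) := cauchySeq_const 0
          simpa [CauchySeq] using this)
      filter_upwards [mem_nhdsWithin_of_mem_nhds (Metric.ball_mem_nhds ξ hε)] with ζ hζ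
      exact h1.cauchySeq hζ
    · intro x y z _ _ _ h1 h2
      have e : (fun n => P n z - P n x) = (fun n => P n y - P n x) + fun n => P n z - P n y := by
        funext n
        simp
      rw [e]
      exact h1.add h2
    · intro x y _ _ h
      have e : (fun n => P n x - P n y) = -fun n => P n y - P n x := by
        funext n
        simp
      rw [e]
      exact h.neg
  choose! Φ hΦ using fun ξ (hξ : ξ ∈ Γ) => cauchySeq_tendsto_of_complete (hcauchy ξ₀ hξ₀ ξ hξ)
  refine ⟨Φ, fun ξ hξ => ?_⟩
  obtain ⟨ε, hε, hεΓ⟩ := Metric.isOpen_iff.1 hΓ ξ hξ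
  exact hasDerivAt_of_tendstoUniformlyOn Metric.isOpen_ball
    (hL.tendstoUniformlyOn_sub (hεΓ.trans hΓE))
    (Eventually.of_forall fun n z hz => (hP' n z (hΓE (hεΓ hz))).sub_const (P n ξ₀))
    (fun z hz => hΦ z (hεΓ hz)) (Metric.mem_ball_self hε)

end Primitive

/-! ### The statement for one sign -/

/-- The assertion of the theorem for one choice of sign `s`: existence of the coefficients, of a
primitive of `φ`, and of `η` and `F` with all the stated properties. -/
def IsBorelSummable (s : ℝ) (φ ψ : ℂ → ℂ) (ρ d : ℝ) (Γ : Set ℂ) : Prop :=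
  (∀ n : ℕ, AnalyticOnNhd ℂ (wkbCoeff s φ ψ n) Γ ∧
    ∀ ξ ∈ Γ, IntegrableOn
      (fun x : ℝ => wkbPotential s φ ψ (ξ - (s : ℂ) * (x : ℂ)) *
        wkbCoeff s φ ψ n (ξ - (s : ℂ) * (x : ℂ))) (Ioi 0)) ∧
  (∃ Φ : ℂ → ℂ, IsPrimitiveOn φ Φ Γ) ∧
  ∃ η F : ℂ → ℂ → ℂ,
    AnalyticOnNhd ℂ (fun p : ℂ × ℂ => η p.1 p.2) ({u : ℂ | 0 < u.re} ×ˢ Γ) ∧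
    (∀ Φ : ℂ → ℂ, IsPrimitiveOn φ Φ Γ → ∀ u : ℂ, 0 < u.re →
      SolvesEq φ ψ u (wkbForm s Φ η u) Γ) ∧
    (∀ u : ℂ, 0 < u.re →
      Tendsto (η u) (comap (fun ξ : ℂ => s * ξ.re) atBot ⊓ 𝓟 Γ) (𝓝 0)) ∧
    (∀ u : ℂ, 0 < u.re → ∀ ξ ∈ Γ,
      IntegrableOn (fun t : ℝ => Complex.exp (-u * (t : ℂ)) * F (t : ℂ) ξ) (Ioi 0) ∧
      η u ξ = ∫ t in Ioi (0 : ℝ), Complex.exp (-u * (t : ℂ)) * F (t : ℂ) ξ) ∧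
    AnalyticOnNhd ℂ (fun p : ℂ × ℂ => F p.1 p.2) (stripU (2 * d) ×ˢ Γ) ∧
    (∀ t ∈ Metric.ball (0 : ℂ) (2 * d), ∀ ξ ∈ Γ,
      HasSum (fun n : ℕ => wkbCoeff s φ ψ (n + 1) ξ / (n.factorial : ℂ) * t ^ n) (F t ξ)) ∧
    (∀ σ r : ℝ, 0 < σ → 0 < r → r < d → ∃ K : ℝ, 0 < K ∧
      ∀ t ∈ stripU (2 * r), ∀ ξ ∈ Γ,
        ‖F t ξ‖ ≤ K * (Real.exp (σ * t.re) /
          max 1 (-s * Real.sign ξ.re * |ξ.re| ^ ρ))) ∧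
    (∀ σ : ℝ, 0 < σ →
      UniformAsymptotic {u : ℂ | σ < u.re} Γ η (wkbCoeff s φ ψ)) ∧
    (∀ θ : ℝ, θ < Real.pi / 2 →
      UniformAsymptotic {u : ℂ | |u.arg| ≤ θ} Γ η (wkbCoeff s φ ψ))

theorem exists_mem_stripU_lt {d : ℝ} (hd : 0 < d) {t : ℂ} (ht : t ∈ stripU (2 * d)) :
    ∃ r, 0 < r ∧ r < d ∧ t ∈ stripU (2 * r) := by
  rcases ht with ⟨h1, h2⟩ | h
  · exact ⟨(|t.im| / 2 + d) / 2, by positivity, by linarith, Or.inl ⟨h1, by linarith⟩⟩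
  · rw [mem_ball_zero_iff] at h
    exact ⟨(‖t‖ / 2 + d) / 2, by positivity, by linarith,
      Or.inr (mem_ball_zero_iff.2 (by linarith))⟩

/-- A closed subsector of the right half-plane lies in `Re u > 1` for `|u|` large. -/
theorem UniformAsymptotic.sector {Γ : Set ℂ} {η : ℂ → ℂ → ℂ} {A : ℕ → ℂ → ℂ}
    (h : UniformAsymptotic {u : ℂ | 1 < u.re} Γ η A) {θ : ℝ} (hθ : θ < Real.pi / 2) :
    UniformAsymptotic {u : ℂ | |u.arg| ≤ θ} Γ η A := by
  intro N
  obtain ⟨C, R, hR, hC⟩ := h N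
  rcases lt_or_ge θ 0 with h0 | h0
  · exact ⟨C, R, hR, fun u hu => absurd ((abs_nonneg _).trans hu) h0.not_ge⟩
  have hcos : 0 < Real.cos θ := Real.cos_pos_of_mem_Ioo ⟨by linarith [Real.pi_pos], hθ⟩
  refine ⟨C, max R (2 / Real.cos θ), lt_max_of_lt_left hR, fun u hu hRu ξ hξ =>
    hC u ?_ ((le_max_left _ _).trans hRu) ξ hξ⟩
  have h1 : Real.cos θ ≤ Real.cos u.arg := by
    rw [← Real.cos_abs u.arg]
    exact Real.cos_le_cos_of_nonneg_of_le_pi (abs_nonneg _) (by linarith [Real.pi_pos]) hu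
  have h2 : 2 ≤ ‖u‖ * Real.cos θ := (div_le_iff₀ hcos).1 ((le_max_right _ _).trans hRu)
  have h3 : u.re = ‖u‖ * Real.cos u.arg := (Complex.norm_mul_cos_arg u).symm
  have h4 := mul_le_mul_of_nonneg_left h1 (norm_nonneg u)
  change 1 < u.re
  linarith

theorem isBorelSummable_one {Δ : Set ℂ} (hΔ : IsOpen Δ) {φ ψ : ℂ → ℂ} {c ρ : ℝ} (hc : 0 < c)
    (hρ : 0 < ρ) (hcond : DecayCond1 Δ φ ψ c ρ ∨ DecayCond2 Δ φ ψ c ρ) {d : ℝ} (hd : 0 < d)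
    {Γ : Set ℂ} (hΓ : IsGammaDomain 1 Δ d Γ) : IsBorelSummable 1 φ ψ ρ d Γ := by
  set V := wkbPotential 1 φ ψ with hV
  have hdata : ∀ r, r < d → ∃ C, LeftData (Metric.thickening r Γ) φ V C ρ := fun r hr =>
    exists_leftData hΔ hc hρ hcond hd hΓ hr
  have hball : ∀ r, ∀ ξ ∈ Γ, Metric.ball ξ r ⊆ Metric.thickening r Γ := fun r ξ hξ =>
    Metric.ball_subset_thickening hξ r
  obtain ⟨C, hL⟩ := hdata (d / 2) (half_lt_self hd)
  have hΓE : Γ ⊆ Metric.thickening (d / 2) Γ := Metric.self_subset_thickening (half_pos hd) Γ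
  have hasymp : ∀ σ : ℝ, 0 < σ → UniformAsymptotic {u : ℂ | σ < u.re} Γ (laplaceBorel φ V)
      (wkbCoeff 1 φ ψ) := by
    intro σ hσ N
    obtain ⟨b, K, δ, M, M', hM⟩ := exists_isMajorant hL.C_pos hρ (half_pos hσ)
    set B := (C + C / ρ) * 2 * Real.exp ((σ / 2 + b) * (2 * (2 * (d / 2)))) * (K * 2)
    refine ⟨cauchyConst (2 * (d / 2)) B (σ / 2) N +
      cauchyConst (2 * (d / 2)) B (σ / 2) (N + 1) / (σ / 2), 1, one_pos, fun u hu _ ξ hξ => ?_⟩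
    replace hu : σ < u.re := hu
    have hsb := hL.isStripBounded_borel hM (half_pos hσ).le (half_pos hd) (hball _ ξ hξ)
    have h := hsb.norm_laplace_sub_sum_le N (u := u) (by linarith)
    have hsum : ∑ n ∈ Finset.Icc 1 N, wkbCoeff 1 φ ψ n ξ / u ^ n =
        ∑ n ∈ Finset.Icc 1 N, iteratedDeriv (n - 1) (fun t => borel φ V t ξ) 0 / u ^ n := by
      refine Finset.sum_congr rfl fun n hn => ?_
      obtain ⟨m, rfl⟩ := Nat.exists_eq_add_of_le' (Finset.mem_Icc.1 hn).1
      rw [hL.wkbCoeff_succ m ξ (hΓE hξ), Nat.add_sub_cancel]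
    rw [hsum]
    refine h.trans ?_
    have h1 := hsb.cauchyConst_nonneg (N + 1)
    gcongr
    linarith
  refine ⟨fun n => ⟨(hL.analyticOnNhd_wkbCoeff n).mono hΓE, fun ξ hξ => ?_⟩,
    hL.exists_primitive hΓ.1.1 hΓ.1.2 hΓE, laplaceBorel φ V, borel φ V,
    hL.analyticOnNhd_laplaceBorel.mono (prod_mono_right hΓE),
    fun Φ hΦ u hu => hL.solvesEq hΓ.1.1 hΓE hΦ hu, fun u hu => ?_,
    fun u hu ξ hξ => ⟨hL.integrableOn_laplace hu (hΓE hξ), rfl⟩, ?_, ?_, ?_, hasymp,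
    fun θ hθ => (hasymp 1 one_pos).sector hθ⟩
  · simpa using hL.integrableOn_wkbCoeff n (hΓE hξ)
  · obtain ⟨b, K, δ, M, M', hM⟩ := exists_isMajorant hL.C_pos hρ (half_pos hu)
    have hC := hL.C_pos
    have hre : Tendsto (fun ξ : ℂ => ξ.re) (comap (fun ξ : ℂ => (1 : ℝ) * ξ.re) atBot ⊓ 𝓟 Γ)
        atBot := by
      simpa using (tendsto_comap (f := fun ξ : ℂ => ξ.re) (x := atBot)).mono_left inf_le_left
    have h0 := ((tendsto_ramp_atBot hρ).comp hre).const_mul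
      ((C + C / ρ) * 2 * K * (1 / (u.re - u.re / 2)))
    rw [mul_zero] at h0
    refine squeeze_zero_norm' ?_ h0
    filter_upwards [mem_inf_of_right (mem_principal_self Γ)] with ξ hξ
    refine (hL.norm_laplaceBorel_le hM (half_pos hu).le (half_lt_self hu) (hΓE hξ)).trans ?_
    have h1 : 0 < u.re - u.re / 2 := by linarith
    calc (C + C / ρ) * 2 * M ξ.re * (1 / (u.re - u.re / 2))
        ≤ (C + C / ρ) * 2 * (K * ramp ρ ξ.re) * (1 / (u.re - u.re / 2)) := by
          gcongr
          exact hM.le_ramp _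
      _ = _ := by simp only [Function.comp]; ring
  · rintro ⟨t, ξ⟩ ⟨ht, hξ⟩
    obtain ⟨r, hr, hrd, htr⟩ := exists_mem_stripU_lt hd ht
    obtain ⟨C', hL'⟩ := hdata r hrd
    exact hL'.isTransportSolution_borel.analyticOnNhd _
      (mem_shiftDomain_of_mem_stripU hL'.left (hball r ξ hξ) htr)
  · intro t ht ξ hξ
    have hdiff : DifferentiableOn ℂ (fun τ => borel φ V τ ξ) (Metric.ball 0 (2 * d)) := by
      intro τ hτ
      obtain ⟨r, hr, hrd, hτr⟩ := exists_mem_stripU_lt hd (Or.inr hτ)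
      obtain ⟨C', hL'⟩ := hdata r hrd
      exact (hL'.isTransportSolution_borel.hasDerivAt_fst (mem_shiftDomain_of_mem_stripU hL'.left
        (hball r ξ hξ) hτr)).differentiableAt.differentiableWithinAt
    have h := Complex.hasSum_taylorSeries_on_ball hdiff ht
    refine h.congr_fun ?_
    intro n
    rw [hL.wkbCoeff_succ n ξ (hΓE hξ), sub_zero, smul_eq_mul, smul_eq_mul]
    ring
  · intro σ r hσ hr hrd
    obtain ⟨C', hL'⟩ := hdata r hrd
    obtain ⟨b, K, δ, M, M', hM⟩ := exists_isMajorant hL'.C_pos hρ hσ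
    have hC := hL'.C_pos
    have hK := hM.K_pos
    refine ⟨(C' + C' / ρ) * 2 * Real.exp ((σ + b) * (2 * (2 * r))) * (K * 2), by positivity,
      fun t ht ξ hξ => ?_⟩
    refine (hL'.norm_borel_le_of_mem_stripU hM hσ.le
      (mem_shiftDomain_of_mem_stripU hL'.left (hball r ξ hξ) ht) ht).trans ?_
    have h1 : M ξ.re ≤ K * (2 / max 1 (-1 * Real.sign ξ.re * |ξ.re| ^ ρ)) := by
      refine (hM.le_ramp _).trans ?_
      gcongr
      simpa using ramp_le_div_max hρ ξ.re
    calc _ ≤ (C' + C' / ρ) * 2 * Real.exp ((σ + b) * (2 * (2 * r))) *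
          (K * (2 / max 1 (-1 * Real.sign ξ.re * |ξ.re| ^ ρ))) * Real.exp (σ * t.re) := by gcongr
      _ = _ := by ring

/-! ### Reflection `ξ ↦ -ξ` -/

theorem wkbPotential_neg (φ ψ : ℂ → ℂ) (ξ : ℂ) :
    wkbPotential (-1) φ ψ ξ = wkbPotential 1 (fun z => φ (-z)) (fun z => ψ (-z)) (-ξ) := by
  simp [wkbPotential, deriv_comp_neg]

theorem wkbCoeff_neg (φ ψ : ℂ → ℂ) (n : ℕ) :
    wkbCoeff (-1) φ ψ n = fun ξ => wkbCoeff 1 (fun z => φ (-z)) (fun z => ψ (-z)) n (-ξ) := by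
  induction n with
  | zero => rfl
  | succ n ih =>
    funext ξ
    simp only [wkbCoeff, ih, rayIntegral, wkbPotential_neg, deriv_comp_neg]
    have e : ∀ x : ℝ, -(ξ - ((-1 : ℝ) : ℂ) * x) = -ξ - ((1 : ℝ) : ℂ) * x := fun x => by
      push_cast
      ring
    simp only [e]
    rw [neg_neg, Complex.ofReal_neg, Complex.ofReal_one]
    ring

theorem IsGammaDomain.neg {Δ Γ : Set ℂ} {d : ℝ} (h : IsGammaDomain (-1) Δ d Γ) :
    IsGammaDomain 1 (Neg.neg ⁻¹' Δ) d (Neg.neg ⁻¹' Γ) := by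
  obtain ⟨⟨ho, hc⟩, hsub, hdist, hleft⟩ := h
  refine ⟨⟨ho.preimage continuous_neg, ?_⟩, preimage_mono hsub, ?_, ?_⟩
  · exact (Homeomorph.neg ℂ).isConnected_preimage.2 hc
  · intro ξ hξ ζ hζ
    have hζ' : -ζ ∈ frontier Δ := by
      have := (Homeomorph.neg ℂ).preimage_frontier Δ
      rw [Homeomorph.coe_neg] at this
      rw [← this] at hζ
      exact hζ
    have := hdist _ hξ _ hζ'
    rwa [dist_neg_neg] at this
  · intro ξ hξ x hx
    have := hleft _ hξ x hx
    change -(ξ - _) ∈ Γ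
    convert this using 1
    push_cast
    ring

theorem DecayCond1.neg {Δ : Set ℂ} {φ ψ : ℂ → ℂ} {c ρ : ℝ} (h : DecayCond1 Δ φ ψ c ρ) :
    DecayCond1 (Neg.neg ⁻¹' Δ) (fun z => φ (-z)) (fun z => ψ (-z)) c ρ := by
  obtain ⟨h1, h2, h3⟩ := h
  refine ⟨fun z hz => (h1 _ hz).fun_comp analyticAt_id.fun_neg,
    fun z hz => (h2 _ hz).fun_comp analyticAt_id.fun_neg, fun ξ hξ => ?_⟩
  simpa using h3 (-ξ) hξ

theorem DecayCond2.neg {Δ : Set ℂ} {φ ψ : ℂ → ℂ} {c ρ : ℝ} (h : DecayCond2 Δ φ ψ c ρ) :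
    DecayCond2 (Neg.neg ⁻¹' Δ) (fun z => φ (-z)) (fun z => ψ (-z)) c ρ := by
  obtain ⟨h1, h2, h3⟩ := h
  refine ⟨fun z hz => (h1 _ hz).fun_comp analyticAt_id.fun_neg,
    fun z hz => (h2 _ hz).fun_comp analyticAt_id.fun_neg, fun ξ hξ => ?_⟩
  simpa [deriv_comp_neg] using h3 (-ξ) hξ

theorem UniformAsymptotic.neg {S Γ : Set ℂ} {η : ℂ → ℂ → ℂ} {φ ψ : ℂ → ℂ}
    (h : UniformAsymptotic S (Neg.neg ⁻¹' Γ) η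
      (wkbCoeff 1 (fun z => φ (-z)) (fun z => ψ (-z)))) :
    UniformAsymptotic S Γ (fun u ξ => η u (-ξ)) (wkbCoeff (-1) φ ψ) := by
  intro N
  obtain ⟨C, R, hR, hC⟩ := h N
  refine ⟨C, R, hR, fun u hu hRu ξ hξ => ?_⟩
  simpa only [wkbCoeff_neg] using hC u hu hRu (-ξ) (by simpa using hξ)

theorem SolvesEq.neg {Γ : Set ℂ} {φ ψ w : ℂ → ℂ} {u : ℂ}
    (h : SolvesEq (fun z => φ (-z)) (fun z => ψ (-z)) u w (Neg.neg ⁻¹' Γ)) :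
    SolvesEq φ ψ u (fun ξ => w (-ξ)) Γ := by
  have hm : ∀ ξ ∈ Γ, -ξ ∈ Neg.neg ⁻¹' Γ := fun ξ hξ => by simpa using hξ
  refine ⟨fun ξ hξ => (h.1 _ (hm ξ hξ)).fun_comp analyticAt_id.fun_neg, fun ξ hξ => ?_⟩
  have h1 : deriv (fun ξ => w (-ξ)) = fun ξ => -deriv w (-ξ) := by
    funext z
    rw [deriv_comp_neg]
  have h2 : deriv (fun ξ => -deriv w (-ξ)) ξ = deriv (deriv w) (-ξ) := by
    rw [deriv.fun_neg, deriv_comp_neg (deriv w), neg_neg]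
  rw [h1, h2]
  simpa using h.2 (-ξ) (hm ξ hξ)

theorem IsBorelSummable.neg {Γ : Set ℂ} {φ ψ : ℂ → ℂ} {ρ d : ℝ}
    (h : IsBorelSummable 1 (fun z => φ (-z)) (fun z => ψ (-z)) ρ d (Neg.neg ⁻¹' Γ)) :
    IsBorelSummable (-1) φ ψ ρ d Γ := by
  obtain ⟨hA, ⟨Φ, hΦ⟩, η, F, hη, hsol, hlim, hlap, hF, hsum, hbd, has1, has2⟩ := h
  have hm : ∀ ξ ∈ Γ, -ξ ∈ Neg.neg ⁻¹' Γ := fun ξ hξ => by simpa using hξ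
  have han : ∀ p : ℂ × ℂ, AnalyticAt ℂ (fun p : ℂ × ℂ => (p.1, -p.2)) p := fun p =>
    analyticAt_fst.prod analyticAt_snd.fun_neg
  refine ⟨fun n => ⟨?_, fun ξ hξ => ?_⟩, ⟨fun ξ => -Φ (-ξ), fun ξ hξ => ?_⟩,
    fun u ξ => η u (-ξ), fun t ξ => F t (-ξ), ?_, ?_, ?_, fun u hu ξ hξ => hlap u hu _ (hm ξ hξ),
    ?_, fun t ht ξ hξ => ?_, fun σ r hσ hr hrd => ?_, fun σ hσ => (has1 σ hσ).neg,
    fun θ hθ => (has2 θ hθ).neg⟩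
  · rw [wkbCoeff_neg]
    exact fun ξ hξ => ((hA n).1 _ (hm ξ hξ)).fun_comp analyticAt_id.fun_neg
  · have := (hA n).2 _ (hm ξ hξ)
    have e : ∀ x : ℝ, -(ξ - ((-1 : ℝ) : ℂ) * x) = -ξ - ((1 : ℝ) : ℂ) * x := fun x => by
      push_cast
      ring
    simpa only [wkbPotential_neg, wkbCoeff_neg, e] using this
  · have h1 := hΦ _ (hm ξ hξ)
    have h2 := (h1.comp ξ (hasDerivAt_neg ξ)).neg
    exact h2.congr_deriv (by simp)
  · exact fun p hp => (hη (p.1, -p.2) ⟨hp.1, hm _ hp.2⟩).fun_comp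
      (f := fun p : ℂ × ℂ => (p.1, -p.2)) (han p)
  · intro Φ hΦ u hu
    have hΦ' : IsPrimitiveOn (fun z => φ (-z)) (fun z => -Φ (-z)) (Neg.neg ⁻¹' Γ) :=
      fun ξ hξ => ((hΦ (-ξ) hξ).comp ξ (hasDerivAt_neg ξ)).neg.congr_deriv (by simp)
    have h := (hsol _ hΦ' u hu).neg
    have e : wkbForm (-1) Φ (fun u ξ => η u (-ξ)) u =
        fun ξ => wkbForm 1 (fun z => -Φ (-z)) η u (-ξ) := by
      funext ξ
      simp [wkbForm]
    rw [e]
    exact h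
  · intro u hu
    refine (hlim u hu).comp ?_
    rw [tendsto_inf, tendsto_comap_iff, tendsto_principal]
    refine ⟨?_, ?_⟩
    · refine (tendsto_comap.mono_left inf_le_left).congr fun ξ => ?_
      simp
    · filter_upwards [mem_inf_of_right (mem_principal_self Γ)] with ξ hξ using hm ξ hξ
  · exact fun p hp => (hF (p.1, -p.2) ⟨hp.1, hm _ hp.2⟩).fun_comp
      (f := fun p : ℂ × ℂ => (p.1, -p.2)) (han p)
  · simpa only [wkbCoeff_neg] using hsum t ht _ (hm ξ hξ)
  · obtain ⟨K, hK, hb⟩ := hbd σ r hσ hr hrd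
    refine ⟨K, hK, fun t ht ξ hξ => ?_⟩
    simpa [Real.sign_neg] using hb t ht _ (hm ξ hξ)

end WKB

end

theorem theorem1p1
    (Δ : Set ℂ) (hΔ : WKB.IsPlaneDomain Δ) (φ ψ : ℂ → ℂ)
    (c ρ : ℝ) (hc : 0 < c) (hρ : 0 < ρ)
    (hcond : WKB.DecayCond1 Δ φ ψ c ρ ∨ WKB.DecayCond2 Δ φ ψ c ρ)
    (d : ℝ) (hd : 0 < d)
    (s : ℝ) (hs : s = 1 ∨ s = -1)
    (Γ : Set ℂ) (hΓ : WKB.IsGammaDomain s Δ d Γ) :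
    -- the coefficients are well-defined analytic functions on `Γ`
    (∀ n : ℕ, AnalyticOnNhd ℂ (WKB.wkbCoeff s φ ψ n) Γ ∧
      ∀ ξ ∈ Γ, IntegrableOn
        (fun x : ℝ => WKB.wkbPotential s φ ψ (ξ - (s : ℂ) * (x : ℂ)) *
          WKB.wkbCoeff s φ ψ n (ξ - (s : ℂ) * (x : ℂ))) (Ioi 0)) ∧
    (∃ Φ : ℂ → ℂ, WKB.IsPrimitiveOn φ Φ Γ) ∧
    ∃ η F : ℂ → ℂ → ℂ,
      -- `η` is analytic and gives exact solutions of the differential equation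
      AnalyticOnNhd ℂ (fun p : ℂ × ℂ => η p.1 p.2) ({u : ℂ | 0 < u.re} ×ˢ Γ) ∧
      (∀ Φ : ℂ → ℂ, WKB.IsPrimitiveOn φ Φ Γ → ∀ u : ℂ, 0 < u.re →
        WKB.SolvesEq φ ψ u (WKB.wkbForm s Φ η u) Γ) ∧
      -- `η(u, ξ) → 0` as `Re ξ → ∓∞` within `Γ`
      (∀ u : ℂ, 0 < u.re →
        Tendsto (η u) (comap (fun ξ : ℂ => s * ξ.re) atBot ⊓ 𝓟 Γ) (𝓝 0)) ∧
      -- Laplace transform representation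
      (∀ u : ℂ, 0 < u.re → ∀ ξ ∈ Γ,
        IntegrableOn (fun t : ℝ => Complex.exp (-u * (t : ℂ)) * F (t : ℂ) ξ) (Ioi 0) ∧
        η u ξ = ∫ t in Ioi (0 : ℝ), Complex.exp (-u * (t : ℂ)) * F (t : ℂ) ξ) ∧
      -- the Borel transform: analyticity, power series and growth
      AnalyticOnNhd ℂ (fun p : ℂ × ℂ => F p.1 p.2) (WKB.stripU (2 * d) ×ˢ Γ) ∧
      (∀ t ∈ Metric.ball (0 : ℂ) (2 * d), ∀ ξ ∈ Γ,
        HasSum (fun n : ℕ => WKB.wkbCoeff s φ ψ (n + 1) ξ / (n.factorial : ℂ) * t ^ n) (F t ξ)) ∧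
      (∀ σ r : ℝ, 0 < σ → 0 < r → r < d → ∃ K : ℝ, 0 < K ∧
        ∀ t ∈ WKB.stripU (2 * r), ∀ ξ ∈ Γ,
          ‖F t ξ‖ ≤ K * (Real.exp (σ * t.re) /
            max 1 (-s * Real.sign ξ.re * |ξ.re| ^ ρ))) ∧
      -- uniform asymptotic expansions
      (∀ σ : ℝ, 0 < σ →
        WKB.UniformAsymptotic {u : ℂ | σ < u.re} Γ η (WKB.wkbCoeff s φ ψ)) ∧
      (∀ θ : ℝ, θ < Real.pi / 2 →
        WKB.UniformAsymptotic {u : ℂ | |u.arg| ≤ θ} Γ η (WKB.wkbCoeff s φ ψ)) := by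
  rcases hs with rfl | rfl
  · exact WKB.isBorelSummable_one hΔ.1 hc hρ hcond hd hΓ
  · exact (WKB.isBorelSummable_one (hΔ.1.preimage continuous_neg) hc hρ
      (hcond.imp WKB.DecayCond1.neg WKB.DecayCond2.neg) hd hΓ.neg).neg
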